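/- Theorem 1. Let $d\in\mathbb{N}$, let $W$ be a two-sided $d$-dimensional standard Brownian motion on a probability space $(\Omega,\mathcal{F},\mathbb{P})$, and let $\mathbb{F}=(\mathcal{F}_t)_{t\in\mathbb{R}}$ be the complete filtration generated by the increments of $W$ (that is, $\mathcal F_t$ is generated by the increments $W_u-W_v$, $v\le u\le t$, and the null events). For $h\in(0,1)$ let $B^h$ be the (continuous) Mandelbrot–van Ness fractional Brownian motion $$B^h_t=\int_{-\infty}^0\bigl(|t-s|^{h-1/2}-|s|^{h-1/2}\bigr)\,dW_s+\int_0^t|t-s|^{h-1/2}\,dW_s,\qquad t\ge 0,$$ and for $H\in(1,\infty)\setminus\mathbb{Z}$ let $B^H$ be the $\lfloor H\rfloor$-fold time integral of $B^{H-\lfloor H\rfloor}$, $$B^H_t=\int_{0\le r_1\le\cdots\le r_{\lfloor H\rfloor}\le t}B^{H-\lfloor H\rfloor}_{r_1}\,dr_1\cdots dr_{\lfloor H\rfloor}.$$ For $\alpha>0$ write $\alpha=n+\beta$ with $n\in\mathbb{N}_0$, $\beta\in(0,1]$, and let $C^\alpha$ be the set of bounded, $n$ times differentiable $b:\mathbb{R}^d\to\mathbb{R}^d$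 whose $n$-th order derivatives are globally $\beta$-Hölder continuous. Let $H\in[1/2,\infty)\setminus\mathbb{Z}$ and $b\in C^\alpha$, where $\alpha>1-\frac{1}{2H}$. Then the equation $$X_t=\int_0^t b(X_r)\,dr+B^H_t$$ has a unique strong solution up to time $1$: there is an $\mathbb{F}$-adapted process $X$ such that, almost surely, the equation holds for all $t\in[0,1]$, and any two such processes $X,Y$ satisfy, almost surely, $X_t=Y_t$ for all $t\in[0,1]$. -/

import Mathlib

open MeasureTheory ProbabilityTheory Filter Topology

noncomputable section

namespace RegNoise

/-- The state space `ℝ^d` with its Euclidean norm. -/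
abbrev Vec (d : ℕ) : Type := EuclideanSpace ℝ (Fin d)

/-- The class `C^α(ℝ^d; ℝ^d)`, `α > 0`. Write `α = n + β` with `n ∈ ℕ` and `β ∈ (0, 1]`, that is,
`n = ⌈α⌉ - 1`. Then `b ∈ C^α` if `b` is bounded, `n` times differentiable, and its `n`-th derivative
is globally `β`-Hölder continuous (the seminorm is finite). -/
def MemHolder {d : ℕ} (α : ℝ) (b : Vec d → Vec d) : Prop :=
  (∃ C : ℝ, ∀ x, ‖b x‖ ≤ C) ∧
  ContDiff ℝ (((⌈α⌉₊ - 1 : ℕ) : ℕ∞)) b ∧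
  ∃ C : ℝ, ∀ x y,
    ‖iteratedFDeriv ℝ (⌈α⌉₊ - 1) b x - iteratedFDeriv ℝ (⌈α⌉₊ - 1) b y‖
      ≤ C * ‖x - y‖ ^ (α - ((⌈α⌉₊ - 1 : ℕ) : ℝ))

variable {Ω : Type*} [mΩ : MeasurableSpace Ω]

/-- `W` is a two-sided standard `d`-dimensional Brownian motion under `P`. -/
structure IsTwoSidedBM {d : ℕ} (P : Measure Ω) (W : ℝ → Ω → Vec d) : Prop where
  measurable : ∀ t, Measurable (W t)
  zero : ∀ᵐ ω ∂P, W 0 ω = 0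
  indep : HasIndepIncrements W P
  gauss : ∀ s t : ℝ, s ≤ t →
    P.map (fun ω (i : Fin d) => W t ω i - W s ω i)
      = Measure.pi (fun _ : Fin d => gaussianReal 0 (t - s).toNNReal)
  cont : ∀ᵐ ω ∂P, Continuous (fun t => W t ω)

/-- The complete filtration `(ℱ_t)_{t ∈ ℝ}` generated by the increments of `W`: `ℱ_t` is generated
by all `W_u - W_v` with `v ≤ u ≤ t` and by all events of probability zero. -/
def incrFiltration {d : ℕ} (P : Measure Ω) (W : ℝ → Ω → Vec d) (hW : ∀ t, Measurable (W t)) :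
    Filtration ℝ mΩ where
  seq t :=
    (⨆ (u : ℝ) (v : ℝ) (_ : v ≤ u ∧ u ≤ t),
      MeasurableSpace.comap (fun ω => W u ω - W v ω) inferInstance) ⊔
    MeasurableSpace.generateFrom {A : Set Ω | MeasurableSet[mΩ] A ∧ P A = 0}
  mono' s t hst := by
    refine sup_le_sup_right ?_ _
    exact iSup_mono fun u => iSup_mono fun v => iSup_mono' fun h => ⟨⟨h.1, h.2.trans hst⟩, le_rfl⟩
  le' t := by
    refine sup_le ?_ ?_
    · exact iSup_le fun u => iSup_le fun v => iSup_le fun _ =>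
        ((hW u).sub (hW v)).comap_le
    · exact MeasurableSpace.generateFrom_le fun A hA => hA.1

/-- Real step functions `∑ i, coef i • 1_{(left i, right i]}` on the line. -/
structure Step where
  n : ℕ
  coef : Fin n → ℝ
  left : Fin n → ℝ
  right : Fin n → ℝ
  le : ∀ i, left i ≤ right i

/-- The step function as a function. -/
def Step.toFun (g : Step) (s : ℝ) : ℝ :=
  ∑ i, (Set.Ioc (g.left i) (g.right i)).indicator (fun _ => g.coef i) s

/-- The elementary integral of a step function against a real process. -/
def Step.integral (g : Step) (w : ℝ → Ω → ℝ) (ω : Ω) : ℝ :=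
  ∑ i, g.coef i * (w (g.right i) ω - w (g.left i) ω)

/-- `J` is (a version of) the Wiener integral `∫ f dw` over the whole line of `f ∈ L²(ℝ)`: the
`L²(P)`-limit of the elementary integrals of step functions converging to `f` in `L²(ℝ)`. -/
def IsWienerIntegral (P : Measure Ω) (w : ℝ → Ω → ℝ) (f : ℝ → ℝ) (J : Ω → ℝ) : Prop :=
  MemLp f 2 volume ∧ MemLp J 2 P ∧
  ∃ g : ℕ → Step,
    Tendsto (fun n => eLpNorm (fun s => (g n).toFun s - f s) 2 volume) atTop (𝓝 0) ∧
    Tendsto (fun n => eLpNorm (fun ω => (g n).integral w ω - J ω) 2 P) atTop (𝓝 0)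

/-- The Mandelbrot–van Ness kernel: the integrand, as a function of `s`, in
`∫_{-∞}^0 (|t-s|^{H-1/2} - |s|^{H-1/2}) dW_s + ∫_0^t |t-s|^{H-1/2} dW_s`. -/
def mvnKernel (H t s : ℝ) : ℝ :=
  if s < 0 then |t - s| ^ (H - 1 / 2) - |s| ^ (H - 1 / 2)
  else if s ≤ t then |t - s| ^ (H - 1 / 2)
  else 0

/-- `B = (B_t)_{t ≥ 0}` is the Mandelbrot–van Ness fractional Brownian motion with Hurst parameter
`H ∈ (0, 1)` built from `W`: a continuous process whose value at each time is, coordinatewise, the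
Wiener integral of the Mandelbrot–van Ness kernel against `W`. -/
structure IsFBM {d : ℕ} (P : Measure Ω) (W : ℝ → Ω → Vec d) (H : ℝ) (B : ℝ → Ω → Vec d) :
    Prop where
  measurable : ∀ t, 0 ≤ t → Measurable (B t)
  cont : ∀ᵐ ω ∂P, ContinuousOn (fun t => B t ω) (Set.Ici 0)
  eq_integral : ∀ t, 0 ≤ t → ∀ i : Fin d,
    IsWienerIntegral P (fun s ω => W s ω i) (mvnKernel H t) (fun ω => B t ω i)

/-- The time integral `t ↦ ∫_0^t f(r) dr` of a path. -/
def timeIntegral {d : ℕ} (f : ℝ → Vec d) (t : ℝ) : Vec d := ∫ r in (0 : ℝ)..t, f r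

/-- The noise `B^H` obtained from a fractional Brownian motion `B` with Hurst parameter
`H - ⌊H⌋`: its `⌊H⌋`-fold time integral (`B` itself if `H < 1`). -/
def fracNoise {d : ℕ} (H : ℝ) (B : ℝ → Ω → Vec d) (t : ℝ) (ω : Ω) : Vec d :=
  (timeIntegral^[⌊H⌋₊] (fun r => B r ω)) t

/-- `X` is a strong solution up to time `T` of `X_t = ∫_0^t b(X_r) dr + Z_t`: it is adapted to the
filtration `ℱ`, and almost surely the equation holds for all `t ∈ [0, T]`. -/
structure IsStrongSolution {d : ℕ} (P : Measure Ω) (ℱ : Filtration ℝ mΩ) (b : Vec d → Vec d)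
    (Z : ℝ → Ω → Vec d) (T : ℝ) (X : ℝ → Ω → Vec d) : Prop where
  adapted : ∀ t ∈ Set.Icc 0 T, Measurable[ℱ t] (X t)
  integrable : ∀ᵐ ω ∂P, IntervalIntegrable (fun r => b (X r ω)) volume 0 T
  eqn : ∀ᵐ ω ∂P, ∀ t ∈ Set.Icc 0 T, X t ω = (∫ r in (0 : ℝ)..t, b (X r ω)) + Z t ω

end RegNoise

end

/-! Write X = φ + Z with Z the noise. The equation becomes φ_t = ∫_0^t b(Z_r + φ_r) dr, read as an
equation for a path in the Hilbert space L²(Ω), where conditional expectations are orthogonal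
projections E_u. The information needed about the noise is collected in `IsSplitNoise`: besides
continuity and adaptedness, given ℱ_u, Z_r is an ℱ_u-measurable vector plus an independent centred
Gaussian vector of standard deviation σ = c (r - u)^H in each coordinate. Hence E_u b(Z_r + x), for
ℱ_u-measurable x, is a Gaussian average of b. It is smooth in x although b is only α-Hölder: its
first and second differences cost σ^(α-1) and σ^(α-2).

The core is `exists_stability`. For solutions φ, ψ, the integral of b(Z_r + φ_r) - b(Z_r + ψ_r) is
estimated by sewing the germ A_u(r) = E_u(b(Z_r + E_u φ_r) - b(Z_r + E_u ψ_r)).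
`SewingData.norm_integral_le` is an abstract sewing estimate for projections in a Hilbert space:
under mesh refinement, the change of the Riemann sums is a small remainder plus orthogonal terms,
and orthogonality replaces N by √N. Summability requires H(1 - α) < 1/2, which is the assumption α >
1 - 1/(2H).

Controlling the remainder requires solutions to be predictable: conditionally on ℱ_u, φ_r - E_u φ_r
must have size (r - u)^γ with γ > H(2 - α). Boundedness of b gives γ = 1. Inserting a prediction
bound into the equation improves γ to 1 + α min(H, γ) (`predictionBound_step`), and finitely many
iterations suffice (`exists_lt_predExp`).

Absorbing terms on short intervals shows that φ - ψ is at most a constant times sup |b₁ - b₂|, where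
the constant sees the drifts only through their Hölder bound. Equal drifts give uniqueness. For
existence, Gaussian averages of b are Lipschitz and share the Hölder bound, the equation with
Lipschitz drift is solved by Picard iteration in L², and stability makes the solutions Cauchy.
`strong_existence_uniqueness` passes between L² and paths.

Two inputs remain. `IsFBM.exists_isSplitNoise` verifies the splitting: on s > 0 the integrand of
B^H_t is a multiple of (t - s)^(H - 1/2), and cutting it at u isolates the independent part, whose
variance is an explicit integral. `MemHolder.exists_bddHolder` reduces every admissible α to an
exponent below one, with a Landau–Kolmogorov inequality when b is differentiable. -/

noncomputable section
namespace RegNoise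

/-! ### Gaussian averages of Hölder functions -/

section Gauss
variable {d : ℕ}

/-- The exponent is complex so that one formula covers both exponential moments and the
characteristic function of an exponentially weighted Gaussian measure. -/
lemma integral_cexp_sum_stdGaussian (z : Fin d → ℂ) :
    ∫ y : Vec d, Complex.exp (∑ j, z j * (y j : ℂ)) ∂(stdGaussian (Vec d)) =
      Complex.exp (∑ j, z j ^ 2 / 2) := by
  rw [← map_pi_eq_stdGaussian, integral_map (by fun_prop) (by fun_prop)]
  simp only [Complex.exp_sum]
  rw [integral_fintype_prod_eq_prod (f := fun j (x : ℝ) => Complex.exp (z j * (x : ℂ)))]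
  refine Finset.prod_congr rfl fun j _ => ?_
  have := complexMGF_id_gaussianReal (μ := 0) (v := 1) (z j)
  simpa [complexMGF] using this

/-- The density of the standard Gaussian measure shifted by `a`. -/
def shiftDensity (a y : Vec d) : ℝ := Real.exp (inner ℝ a y - ‖a‖ ^ 2 / 2)

lemma shiftDensity_pos (a y : Vec d) : 0 < shiftDensity a y := Real.exp_pos _

lemma continuous_shiftDensity (a : Vec d) : Continuous (shiftDensity a) := by
  unfold shiftDensity; fun_prop

lemma integral_exp_inner (a : Vec d) :
    ∫ y, Real.exp (inner ℝ a y) ∂(stdGaussian (Vec d)) = Real.exp (‖a‖ ^ 2 / 2) := by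
  have h := integral_cexp_sum_stdGaussian (fun j => (a j : ℂ))
  have h1 : ∀ y : Vec d, Complex.exp (∑ j, (a j : ℂ) * (y j : ℂ)) =
      ((Real.exp (inner ℝ a y) : ℝ) : ℂ) := fun y => by
    rw [Complex.ofReal_exp, PiLp.inner_apply]; congr 1; push_cast
    exact Finset.sum_congr rfl fun j _ => by simp [mul_comm]
  simp_rw [h1] at h
  rw [integral_complex_ofReal] at h
  have h2 : (∑ j, (a j : ℂ) ^ 2 / 2) = ((‖a‖ ^ 2 / 2 : ℝ) : ℂ) := by
    rw [EuclideanSpace.real_norm_sq_eq, Finset.sum_div]; push_cast; rfl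
  rw [h2] at h
  exact_mod_cast h

lemma integrable_exp_inner (a : Vec d) :
    Integrable (fun y => Real.exp (inner ℝ a y)) (stdGaussian (Vec d)) := by
  -- A non-integrable function has Bochner integral zero, whereas this integral is an exponential.
  by_contra h
  have := integral_exp_inner a
  rw [integral_undef h] at this
  exact absurd this (Real.exp_pos _).ne

lemma integral_shiftDensity (a : Vec d) :
    ∫ y, shiftDensity a y ∂(stdGaussian (Vec d)) = 1 := by
  simp only [shiftDensity, sub_eq_add_neg, Real.exp_add]
  rw [integral_mul_const, integral_exp_inner, ← Real.exp_add]; simp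

lemma integrable_shiftDensity (a : Vec d) :
    Integrable (shiftDensity a) (stdGaussian (Vec d)) := by
  by_contra h
  have := integral_shiftDensity a
  rw [integral_undef h] at this
  exact absurd this (by simp)

lemma shiftDensity_sq (a y : Vec d) :
    shiftDensity a y ^ 2 = Real.exp (inner ℝ ((2 : ℝ) • a) y) * Real.exp (-‖a‖ ^ 2) := by
  rw [shiftDensity, ← Real.exp_nat_mul, ← Real.exp_add, inner_smul_left]
  congr 1; simp; ring

lemma integral_shiftDensity_sub_one_sq (a : Vec d) :
    Integrable (fun y => (shiftDensity a y - 1) ^ 2) (stdGaussian (Vec d)) ∧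
    ∫ y, (shiftDensity a y - 1) ^ 2 ∂(stdGaussian (Vec d)) = Real.exp (‖a‖ ^ 2) - 1 := by
  have e : ∀ y, (shiftDensity a y - 1) ^ 2 =
      Real.exp (inner ℝ ((2 : ℝ) • a) y) * Real.exp (-‖a‖ ^ 2) - 2 * shiftDensity a y + 1 :=
    fun y => by rw [← shiftDensity_sq]; ring
  have i1 := (integrable_exp_inner ((2 : ℝ) • a)).mul_const (Real.exp (-‖a‖ ^ 2))
  have i2 := (integrable_shiftDensity a).const_mul 2
  have i3 : Integrable (fun _ : Vec d => (1 : ℝ)) (stdGaussian (Vec d)) := integrable_const _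
  have i12 : Integrable (fun y => Real.exp (inner ℝ ((2 : ℝ) • a) y) * Real.exp (-‖a‖ ^ 2) -
    2 * shiftDensity a y) (stdGaussian (Vec d)) := i1.sub i2
  constructor
  · simp_rw [e]; exact i12.add i3
  · simp_rw [e]
    rw [integral_add i12 i3, integral_sub i1 i2, integral_mul_const, integral_const_mul,
      integral_exp_inner, integral_shiftDensity, ← Real.exp_add, norm_smul]
    simp
    ring_nf

/-- Cameron–Martin formula in finite dimension. The characteristic function of the weighted measure
at t is a Gaussian integral with complex exponent a + i t. -/
lemma stdGaussian_map_add (a : Vec d) :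
    (stdGaussian (Vec d)).map (fun y => y + a) =
      (stdGaussian (Vec d)).withDensity (fun y => ENNReal.ofReal (shiftDensity a y)) := by
  have : IsFiniteMeasure ((stdGaussian (Vec d)).withDensity
      (fun y => ENNReal.ofReal (shiftDensity a y))) :=
    isFiniteMeasure_withDensity_ofReal (integrable_shiftDensity a).2
  apply Measure.ext_of_charFun
  ext t
  rw [charFun_map_add_const, charFun_stdGaussian, charFun_apply,
    integral_withDensity_eq_integral_toReal_smul
      (continuous_shiftDensity a).measurable.ennreal_ofReal (by simp)]
  have h := integral_cexp_sum_stdGaussian (fun j => (a j : ℂ) + t j * Complex.I)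
  have h1 : ∀ y : Vec d, (ENNReal.ofReal (shiftDensity a y)).toReal •
      Complex.exp ((inner ℝ y t : ℝ) * Complex.I) =
      Complex.exp (-(‖a‖ ^ 2 / 2 : ℝ)) *
        Complex.exp (∑ j, ((a j : ℂ) + t j * Complex.I) * (y j : ℂ)) := fun y => by
    rw [ENNReal.toReal_ofReal (shiftDensity_pos a y).le, shiftDensity, Complex.real_smul,
      Complex.ofReal_exp, ← Complex.exp_add, ← Complex.exp_add]
    congr 1
    simp only [PiLp.inner_apply, add_mul, Finset.sum_add_distrib]
    push_cast
    rw [Finset.sum_mul]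
    have e1 : ∀ j, (((inner ℝ (a j) (y j) : ℝ)) : ℂ) = (a j : ℂ) * y j := fun j => by
      simp [mul_comm]
    have e2 : ∀ j, (((inner ℝ (y j) (t j) : ℝ)) : ℂ) * Complex.I = (t j : ℂ) * Complex.I * y j :=
      fun j => by simp; ring
    simp only [e1, e2]; ring
  simp_rw [h1]
  rw [integral_const_mul, h, ← Complex.exp_add, ← Complex.exp_add]
  congr 1
  have e0 : ((‖a‖ : ℂ)) ^ 2 = ∑ j, (a j : ℂ) ^ 2 := by
    rw [← Complex.ofReal_pow, EuclideanSpace.real_norm_sq_eq]; push_cast; rfl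
  have e1 : ((‖t‖ : ℂ)) ^ 2 = ∑ j, (t j : ℂ) ^ 2 := by
    rw [← Complex.ofReal_pow, EuclideanSpace.real_norm_sq_eq]; push_cast; rfl
  push_cast
  rw [e0, e1, PiLp.inner_apply]
  push_cast
  rw [Finset.sum_mul, neg_div, Finset.sum_div, Finset.sum_div, ← Finset.sum_neg_distrib,
    ← Finset.sum_neg_distrib, ← Finset.sum_add_distrib, ← Finset.sum_add_distrib]
  refine Finset.sum_congr rfl fun j _ => ?_
  have : Complex.I ^ 2 = -1 := Complex.I_sq
  simp only [RCLike.inner_apply, conj_trivial]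
  push_cast
  linear_combination (- (t j : ℂ) ^ 2 / 2) * this

lemma integral_stdGaussian_add {E : Type*} [NormedAddCommGroup E] [NormedSpace ℝ E]
    {g : Vec d → E} (hg : StronglyMeasurable g) (a : Vec d) :
    ∫ y, g (y + a) ∂(stdGaussian (Vec d)) =
      ∫ y, shiftDensity a y • g y ∂(stdGaussian (Vec d)) := by
  have h := integral_map (μ := stdGaussian (Vec d)) (φ := fun y => y + a) (f := g) (by fun_prop)
    hg.aestronglyMeasurable
  rw [← h, stdGaussian_map_add, integral_withDensity_eq_integral_toReal_smul
      (continuous_shiftDensity a).measurable.ennreal_ofReal (by simp)]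
  refine integral_congr_ae (ae_of_all _ fun y => ?_)
  simp only [ENNReal.toReal_ofReal (shiftDensity_pos a y).le]

lemma exp_sq_sub_one_le {t : ℝ} (h0 : 0 ≤ t) (h1 : t ≤ 1) : Real.exp (t ^ 2) - 1 ≤ (2 * t) ^ 2 := by
  have h := Real.abs_exp_sub_one_le (x := t ^ 2) (by rw [abs_of_nonneg (by positivity)]; nlinarith)
  rw [abs_of_nonneg (by positivity : (0:ℝ) ≤ t ^ 2)] at h
  nlinarith [le_abs_self (Real.exp (t ^ 2) - 1), sq_nonneg t]

/-- Shifting a Gaussian average by `a` changes it by at most twice the `L²` norm times `‖a‖`. -/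
lemma norm_gaussian_shift_le {g : Vec d → Vec d} (hg : StronglyMeasurable g) {c : Vec d} {B : ℝ}
    (hB : 0 ≤ B) (hgi : Integrable g (stdGaussian (Vec d)))
    (hL : MemLp (fun y => g y - c) 2 (stdGaussian (Vec d)))
    (hle : ∫ y, ‖g y - c‖ ^ 2 ∂(stdGaussian (Vec d)) ≤ B ^ 2) {a : Vec d} (ha : ‖a‖ ≤ 1)
    (hga : Integrable (fun y => g (y + a)) (stdGaussian (Vec d))) :
    ‖(∫ y, g (y + a) ∂(stdGaussian (Vec d))) - ∫ y, g y ∂(stdGaussian (Vec d))‖ ≤ 2 * B * ‖a‖ := by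
  obtain ⟨hi, hI⟩ := integral_shiftDensity_sub_one_sq a
  have hga' : ∫ y, g (y + a) ∂(stdGaussian (Vec d)) - c =
      ∫ y, shiftDensity a y • (g y - c) ∂(stdGaussian (Vec d)) := by
    rw [← integral_stdGaussian_add (g := fun y => g y - c) (hg.sub stronglyMeasurable_const),
      integral_sub hga (integrable_const _)]
    simp
  have hm : MemLp (fun y => shiftDensity a y - 1) 2 (stdGaussian (Vec d)) :=
    (memLp_two_iff_integrable_sq
      ((continuous_shiftDensity a).sub continuous_const).aestronglyMeasurable).2 hi
  have hi1 : Integrable (fun y => (shiftDensity a y - 1) • (g y - c)) (stdGaussian (Vec d)) :=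
    memLp_one_iff_integrable.1 (hL.smul hm)
  have hi2 : Integrable (fun y => g y - c) (stdGaussian (Vec d)) := hgi.sub (integrable_const _)
  -- The density has mean one, so the constant `c` cancels and only the fluctuation of `g` around
  -- `c` meets the Cauchy–Schwarz inequality.
  have key : (∫ y, g (y + a) ∂(stdGaussian (Vec d))) - ∫ y, g y ∂(stdGaussian (Vec d)) =
      ∫ y, (shiftDensity a y - 1) • (g y - c) ∂(stdGaussian (Vec d)) := by
    have h1 : ∫ y, g y ∂(stdGaussian (Vec d)) - c = ∫ y, (g y - c) ∂(stdGaussian (Vec d)) := by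
      rw [integral_sub hgi (integrable_const _)]; simp
    have h2 : ∫ y, shiftDensity a y • (g y - c) ∂(stdGaussian (Vec d)) =
        ∫ y, ((shiftDensity a y - 1) • (g y - c) + (g y - c)) ∂(stdGaussian (Vec d)) := by
      congr 1; ext1 y; rw [sub_smul, one_smul]; abel
    rw [integral_add hi1 hi2, ← h1, ← hga'] at h2
    rw [← sub_eq_iff_eq_add] at h2
    rw [← h2]; abel
  rw [key]
  refine (norm_integral_le_integral_norm _).trans ?_
  simp_rw [norm_smul]
  have hcs := integral_mul_le_Lp_mul_Lq_of_nonneg (μ := stdGaussian (Vec d))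
    Real.HolderConjugate.two_two (f := fun y => ‖shiftDensity a y - 1‖) (g := fun y => ‖g y - c‖)
    (ae_of_all _ fun _ => norm_nonneg _) (ae_of_all _ fun _ => norm_nonneg _)
    (by simpa using hm.norm) (by simpa using hL.norm)
  refine hcs.trans ?_
  have e1 : ∫ y, ‖shiftDensity a y - 1‖ ^ (2 : ℝ) ∂(stdGaussian (Vec d)) ≤ (2 * ‖a‖) ^ 2 := by
    simp_rw [Real.rpow_two, Real.norm_eq_abs, sq_abs]
    rw [hI]; exact exp_sq_sub_one_le (norm_nonneg _) ha
  have e2 : ∫ y, ‖g y - c‖ ^ (2 : ℝ) ∂(stdGaussian (Vec d)) ≤ B ^ 2 := by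
    simp_rw [Real.rpow_two]; exact hle
  calc _ ≤ ((2 * ‖a‖) ^ 2) ^ (1 / 2 : ℝ) * (B ^ 2) ^ (1 / 2 : ℝ) := by
        gcongr
    _ = 2 * B * ‖a‖ := by
        rw [← Real.sqrt_eq_rpow, ← Real.sqrt_eq_rpow, Real.sqrt_sq (by positivity),
          Real.sqrt_sq hB]; ring

/-- The average of `b` against a centred Gaussian measure with standard deviation `σ`. -/
def gaussAvg (σ : ℝ) (b : Vec d → Vec d) (x : Vec d) : Vec d :=
  ∫ y, b (x + σ • y) ∂(stdGaussian (Vec d))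

/-- `b` is bounded by `K` and `α`-Hölder continuous with constant `K`. -/
structure BddHolder (α K : ℝ) (b : Vec d → Vec d) : Prop where
  bound : ∀ x, ‖b x‖ ≤ K
  holder : ∀ x y, ‖b x - b y‖ ≤ K * ‖x - y‖ ^ α

lemma continuous_of_holder {α K : ℝ} (hα : 0 < α) {b : Vec d → Vec d}
    (hb : ∀ x y, ‖b x - b y‖ ≤ K * ‖x - y‖ ^ α) : Continuous b := by
  refine continuous_iff_continuousAt.2 fun x => ?_
  rw [ContinuousAt, tendsto_iff_norm_sub_tendsto_zero]
  refine squeeze_zero (fun _ => norm_nonneg _) (fun y => hb y x) ?_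
  have : Tendsto (fun y => K * ‖y - x‖ ^ α) (𝓝 x) (𝓝 (K * ‖x - x‖ ^ α)) := by
    have : Continuous (fun y : Vec d => K * ‖y - x‖ ^ α) :=
      continuous_const.mul
        (((continuous_id.sub continuous_const).norm).rpow_const fun _ => Or.inr hα.le)
    exact this.tendsto x
  simpa [hα.ne'] using this

lemma integrable_of_bdd {E : Type*} [MeasurableSpace E] {μ : Measure E} [IsFiniteMeasure μ]
    {f : E → Vec d} (hf : AEStronglyMeasurable f μ) {M : ℝ} (hM : ∀ x, ‖f x‖ ≤ M) :
    Integrable f μ :=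
  Integrable.of_bound hf M (ae_of_all _ hM)

variable (d) in
/-- The `L²` norm of `1 + ‖y‖` under the standard Gaussian measure. -/
def gaussMoment : ℝ := Real.sqrt (∫ y : Vec d, (1 + ‖y‖) ^ 2 ∂(stdGaussian (Vec d)))

lemma memLp_one_add_norm : MemLp (fun y : Vec d => 1 + ‖y‖) 2 (stdGaussian (Vec d)) := by
  have h : MemLp (fun y : Vec d => y) 2 (stdGaussian (Vec d)) :=
    IsGaussian.memLp_id (stdGaussian (Vec d)) 2 ENNReal.ofNat_ne_top
  have h1 : MemLp (fun _ : Vec d => (1 : ℝ)) 2 (stdGaussian (Vec d)) := memLp_const 1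
  exact h1.add h.norm

lemma integrable_one_add_norm_sq :
    Integrable (fun y : Vec d => (1 + ‖y‖) ^ 2) (stdGaussian (Vec d)) :=
  memLp_one_add_norm.integrable_sq

lemma one_le_gaussMoment : 1 ≤ gaussMoment d := by
  rw [gaussMoment, Real.one_le_sqrt]
  calc (1 : ℝ) = ∫ y : Vec d, 1 ∂(stdGaussian (Vec d)) := by simp
    _ ≤ _ := integral_mono (integrable_const _) integrable_one_add_norm_sq fun y => by
        have := norm_nonneg y
        simp only; nlinarith

lemma rpow_le_one_add {t α : ℝ} (ht : 0 ≤ t) (h0 : 0 ≤ α) (h1 : α ≤ 1) : t ^ α ≤ 1 + t := by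
  rcases le_total t 1 with h | h
  · exact (Real.rpow_le_one ht h h0).trans (by linarith)
  · calc t ^ α ≤ t ^ (1 : ℝ) := Real.rpow_le_rpow_of_exponent_le h h1
      _ ≤ _ := by rw [Real.rpow_one]; linarith

variable {α K M σ : ℝ} {b : Vec d → Vec d}

lemma norm_gaussAvg_le (hM : ∀ x, ‖b x‖ ≤ M) (x : Vec d) : ‖gaussAvg σ b x‖ ≤ M := by
  have h := norm_integral_le_of_norm_le_const (μ := stdGaussian (Vec d))
    (f := fun y => b (x + σ • y)) (ae_of_all _ fun y => hM (x + σ • y))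
  simpa [gaussAvg] using h

lemma gaussAvg_sub (hbc : Continuous b) (hM : ∀ x, ‖b x‖ ≤ M) (x y : Vec d) :
    gaussAvg σ b x - gaussAvg σ b y =
      ∫ w, (b (x + σ • w) - b (y + σ • w)) ∂(stdGaussian (Vec d)) := by
  unfold gaussAvg
  rw [integral_sub] <;>
  exact integrable_of_bdd (Continuous.aestronglyMeasurable (by fun_prop)) fun w => hM _

lemma norm_gaussAvg_sub_le_holder (hα : 0 < α) (hM : ∀ x, ‖b x‖ ≤ M)
    (hb : ∀ x y, ‖b x - b y‖ ≤ K * ‖x - y‖ ^ α) (x y : Vec d) :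
    ‖gaussAvg σ b x - gaussAvg σ b y‖ ≤ K * ‖x - y‖ ^ α := by
  rw [gaussAvg_sub (continuous_of_holder hα hb) hM]
  refine (norm_integral_le_of_norm_le_const (ae_of_all _ fun w =>
    (hb (x + σ • w) (y + σ • w)).trans_eq ?_)).trans_eq (b := ((K * ‖x - y‖ ^ α) * _)) ?_
  · rw [add_sub_add_right_eq_sub]
  · simp

/-- For ‖x - y‖ ≤ 1 the shift estimate is applied with `c = b y`, since Hölder continuity bounds the
recentred integrand by K (1 + ‖w‖). For larger distances the Hölder bound is already smaller than
the linear one, as α ≤ 1. -/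
lemma norm_gaussAvg_one_sub_le (h0 : 0 < α) (h1 : α ≤ 1) (hK : 0 ≤ K) (hM : ∀ x, ‖b x‖ ≤ M)
    (hb : ∀ x y, ‖b x - b y‖ ≤ K * ‖x - y‖ ^ α) (x y : Vec d) :
    ‖gaussAvg 1 b x - gaussAvg 1 b y‖ ≤ 2 * gaussMoment d * K * ‖x - y‖ := by
  have hbc := continuous_of_holder h0 hb
  have hm := one_le_gaussMoment (d := d)
  rcases le_total ‖x - y‖ 1 with h | h
  · have key := norm_gaussian_shift_le (g := fun w => b (y + w)) (c := b y)
      (B := K * gaussMoment d) (a := x - y)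
      (hbc.comp (by fun_prop)).stronglyMeasurable (by positivity)
      (integrable_of_bdd (Continuous.aestronglyMeasurable (by fun_prop)) fun w => hM _)
      (MemLp.of_bound (Continuous.aestronglyMeasurable (by fun_prop)) (M + M)
        (ae_of_all _ fun w => (norm_sub_le _ _).trans (add_le_add (hM _) (hM _)))) ?_ h
      (integrable_of_bdd (Continuous.aestronglyMeasurable (by fun_prop)) fun w => hM _)
    · unfold gaussAvg
      simp only [one_smul]
      refine (le_of_eq ?_).trans (key.trans_eq (by ring))
      congr 3; ext1 w; congr 1; abel
    · rw [mul_pow, gaussMoment, Real.sq_sqrt (integral_nonneg fun _ => sq_nonneg _),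
        ← integral_const_mul]
      refine integral_mono_of_nonneg (ae_of_all _ fun _ => sq_nonneg _)
        (integrable_one_add_norm_sq.const_mul _) (ae_of_all _ fun w => ?_)
      simp only [← mul_pow]
      refine pow_le_pow_left₀ (norm_nonneg _) ((hb _ _).trans ?_) 2
      gcongr
      simpa using rpow_le_one_add (norm_nonneg w) h0.le h1
  · refine (norm_gaussAvg_sub_le_holder h0 hM hb x y).trans ?_
    calc K * ‖x - y‖ ^ α ≤ K * ‖x - y‖ ^ (1 : ℝ) := by
          gcongr
      _ ≤ _ := by rw [Real.rpow_one]; nlinarith [mul_nonneg hK (norm_nonneg (x - y))]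

lemma gaussAvg_eq_one (hσ : 0 < σ) (x : Vec d) :
    gaussAvg σ b x = gaussAvg 1 (fun w => b (σ • w)) (σ⁻¹ • x) := by
  unfold gaussAvg
  congr 1; ext1 w
  beta_reduce
  rw [smul_add, smul_smul, mul_inv_cancel₀ hσ.ne', one_smul, one_smul]

lemma holder_comp_smul (hσ : 0 < σ) (hb : ∀ x y, ‖b x - b y‖ ≤ K * ‖x - y‖ ^ α) (x y : Vec d) :
    ‖b (σ • x) - b (σ • y)‖ ≤ (K * σ ^ α) * ‖x - y‖ ^ α := by
  refine (hb _ _).trans_eq ?_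
  rw [← smul_sub, norm_smul, Real.norm_of_nonneg hσ.le, Real.mul_rpow hσ.le (norm_nonneg _)]
  ring

/-- Rescaling space by σ multiplies the Hölder constant by σ^α and distances by σ⁻¹, so the case σ =
1 yields the factor σ^(α-1). -/
lemma norm_gaussAvg_sub_le (h0 : 0 < α) (h1 : α ≤ 1) (hK : 0 ≤ K) (hM : ∀ x, ‖b x‖ ≤ M)
    (hb : ∀ x y, ‖b x - b y‖ ≤ K * ‖x - y‖ ^ α) (hσ : 0 < σ) (x y : Vec d) :
    ‖gaussAvg σ b x - gaussAvg σ b y‖ ≤ 2 * gaussMoment d * K * σ ^ (α - 1) * ‖x - y‖ := by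
  rw [gaussAvg_eq_one hσ, gaussAvg_eq_one hσ]
  refine (norm_gaussAvg_one_sub_le h0 h1 (by positivity) (fun w => hM (σ • w))
    (holder_comp_smul hσ hb) _ _).trans_eq ?_
  rw [← smul_sub, norm_smul, norm_inv, Real.norm_of_nonneg hσ.le, Real.rpow_sub_one hσ.ne']
  ring

lemma stdGaussian_map_prod {s : ℝ} (hs : 2 * s ^ 2 = 1) :
    ((stdGaussian (Vec d)).prod (stdGaussian (Vec d))).map (fun p => s • p.1 + s • p.2) =
      stdGaussian (Vec d) := by
  have h := Measure.map_prod_map (stdGaussian (Vec d)) (stdGaussian (Vec d))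
    (f := fun y => s • y) (g := fun y => s • y) (by fun_prop) (by fun_prop)
  have e : ((stdGaussian (Vec d)).prod (stdGaussian (Vec d))).map (fun p => s • p.1 + s • p.2) =
      ((stdGaussian (Vec d)).map (fun y => s • y)) ∗ ((stdGaussian (Vec d)).map (fun y => s • y)) := by
    rw [Measure.conv, h, Measure.map_map (by fun_prop) (by fun_prop)]
    rfl
  have : IsProbabilityMeasure ((stdGaussian (Vec d)).map (fun y => s • y)) :=
    Measure.isProbabilityMeasure_map (by fun_prop)
  rw [e]
  apply Measure.ext_of_charFun
  ext t
  rw [charFun_conv, charFun_map_smul, charFun_stdGaussian, charFun_stdGaussian, ← Complex.exp_add,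
    norm_smul]
  congr 1
  have h2 : (2 : ℂ) * (s : ℂ) ^ 2 = 1 := by exact_mod_cast hs
  have h3 : ((|s| : ℝ) : ℂ) ^ 2 = (s : ℂ) ^ 2 := by
    rw [← Complex.ofReal_pow, sq_abs, Complex.ofReal_pow]
  push_cast
  rw [Real.norm_eq_abs, mul_pow, h3]
  linear_combination (-(‖t‖ : ℂ) ^ 2 / 2) * h2

/-- Averaging in two independent stages of equal variance lets each stage pay for one difference in
the second-order estimate. -/
lemma gaussAvg_gaussAvg (hbc : Continuous b) (hM : ∀ x, ‖b x‖ ≤ M) {s : ℝ}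
    (hs : 2 * s ^ 2 = 1) (x : Vec d) :
    gaussAvg 1 b x = ∫ y, gaussAvg s b (x + s • y) ∂(stdGaussian (Vec d)) := by
  unfold gaussAvg
  conv_lhs => rw [← stdGaussian_map_prod hs]
  rw [integral_map (by fun_prop) (Continuous.aestronglyMeasurable (by fun_prop)), integral_prod]
  · simp only [one_smul, add_assoc]
  · exact integrable_of_bdd (Continuous.aestronglyMeasurable (by fun_prop)) fun w => hM _

/-- The inner averaging stage turns the difference in x, y into a bounded function of size ‖x - y‖.
The outer stage then smooths this bounded function in the direction a. If the rescaled shift is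
longer than one, boundedness alone is enough. -/
lemma norm_gaussAvg_one_second_diff_le (h0 : 0 < α) (h1 : α ≤ 1) (hK : 0 ≤ K)
    (hM : ∀ x, ‖b x‖ ≤ M) (hb : ∀ x y, ‖b x - b y‖ ≤ K * ‖x - y‖ ^ α) (x y a : Vec d) :
    ‖(gaussAvg 1 b (x + a) - gaussAvg 1 b (y + a)) - (gaussAvg 1 b x - gaussAvg 1 b y)‖ ≤
      16 * gaussMoment d * K * ‖x - y‖ * ‖a‖ := by
  have hbc := continuous_of_holder h0 hb
  have hm := one_le_gaussMoment (d := d)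
  obtain ⟨s, hs0, hs⟩ : ∃ s : ℝ, 0 < s ∧ 2 * s ^ 2 = 1 :=
    ⟨Real.sqrt (1 / 2), by positivity, by rw [Real.sq_sqrt (by norm_num)]; norm_num⟩
  have hs1 : 1 / 2 ≤ s := by nlinarith
  have hs2 : s ≤ 1 := by nlinarith
  have hsinv : s⁻¹ ≤ 2 := by rw [inv_le_comm₀ hs0 (by norm_num)]; linarith
  have hsα : s ^ (α - 1) ≤ 2 := by
    calc s ^ (α - 1) ≤ s ^ (-1 : ℝ) :=
          Real.rpow_le_rpow_of_exponent_ge hs0 hs2 (by linarith)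
      _ ≤ 2 := by rw [Real.rpow_neg_one]; exact hsinv
  set F : Vec d → Vec d := gaussAvg s b
  have hF : ∀ x y, ‖F x - F y‖ ≤ K * ‖x - y‖ ^ α := norm_gaussAvg_sub_le_holder h0 hM hb
  have hFM : ∀ x, ‖F x‖ ≤ M := norm_gaussAvg_le hM
  have hFc : Continuous F := continuous_of_holder h0 hF
  set B : ℝ := 4 * gaussMoment d * K * ‖x - y‖
  have hB : 0 ≤ B := by positivity
  have hD : ∀ w, ‖F (x + w) - F (y + w)‖ ≤ B := fun w => by
    refine (norm_gaussAvg_sub_le h0 h1 hK hM hb hs0 _ _).trans ?_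
    rw [add_sub_add_right_eq_sub]
    have : 0 ≤ gaussMoment d * K * ‖x - y‖ := by positivity
    calc 2 * gaussMoment d * K * s ^ (α - 1) * ‖x - y‖
        = 2 * (gaussMoment d * K * ‖x - y‖) * s ^ (α - 1) := by ring
      _ ≤ 2 * (gaussMoment d * K * ‖x - y‖) * 2 := by gcongr
      _ = B := by simp only [B]; ring
  set g : Vec d → Vec d := fun w => F (x + s • w) - F (y + s • w)
  have hgc : Continuous g := by fun_prop
  have hgB : ∀ w, ‖g w‖ ≤ B := fun w => hD _
  have hdiff : ∀ v, gaussAvg 1 b (x + v) - gaussAvg 1 b (y + v) =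
      ∫ w, g (w + s⁻¹ • v) ∂(stdGaussian (Vec d)) := fun v => by
    rw [gaussAvg_gaussAvg hbc hM hs, gaussAvg_gaussAvg hbc hM hs, ← integral_sub]
    · congr 1; ext1 w
      simp only [g, smul_add, smul_smul, mul_inv_cancel₀ hs0.ne', one_smul, F]
      congr 2 <;> abel
    · exact integrable_of_bdd (M := M)
        (Continuous.aestronglyMeasurable (hFc.comp (by fun_prop))) fun w => hFM _
    · exact integrable_of_bdd (M := M)
        (Continuous.aestronglyMeasurable (hFc.comp (by fun_prop))) fun w => hFM _
  have hgi : ∀ v, Integrable (fun w => g (w + v)) (stdGaussian (Vec d)) := fun v =>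
    integrable_of_bdd (Continuous.aestronglyMeasurable (by fun_prop)) fun w => hgB _
  have e0 : gaussAvg 1 b x - gaussAvg 1 b y = ∫ w, g w ∂(stdGaussian (Vec d)) := by
    have := hdiff 0; simpa using this
  rw [hdiff a, e0]
  have hna : ‖s⁻¹ • a‖ ≤ 2 * ‖a‖ := by
    rw [norm_smul, norm_inv, Real.norm_of_nonneg hs0.le]; gcongr
  have fin : 2 * B * ‖s⁻¹ • a‖ ≤ 16 * gaussMoment d * K * ‖x - y‖ * ‖a‖ := by
    calc 2 * B * ‖s⁻¹ • a‖ ≤ 2 * B * (2 * ‖a‖) := by gcongr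
      _ = _ := by simp only [B]; ring
  refine le_trans ?_ fin
  rcases le_total ‖s⁻¹ • a‖ 1 with h | h
  · refine norm_gaussian_shift_le (c := 0) hgc.stronglyMeasurable hB (by simpa using hgi 0)
      (MemLp.of_bound (Continuous.aestronglyMeasurable (by fun_prop)) B
        (ae_of_all _ fun w => by simpa using hgB w)) ?_ h (hgi _)
    calc ∫ w, ‖g w - 0‖ ^ 2 ∂(stdGaussian (Vec d)) ≤ ∫ w : Vec d, B ^ 2 ∂(stdGaussian (Vec d)) :=
          integral_mono_of_nonneg (ae_of_all _ fun _ => sq_nonneg _) (integrable_const _)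
            (ae_of_all _ fun w => by
              simp only [sub_zero]; exact pow_le_pow_left₀ (norm_nonneg _) (hgB w) 2)
      _ = B ^ 2 := by simp
  · have hb' : ∀ v, ‖∫ w, g (w + v) ∂(stdGaussian (Vec d))‖ ≤ B := fun v => by
      have := norm_integral_le_of_norm_le_const (μ := stdGaussian (Vec d))
        (f := fun w => g (w + v)) (ae_of_all _ fun w => hgB (w + v))
      simpa using this
    calc _ ≤ B + B := (norm_sub_le _ _).trans (add_le_add (hb' _) (by simpa using hb' 0))
      _ ≤ 2 * B * ‖s⁻¹ • a‖ := by nlinarith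

lemma norm_gaussAvg_second_diff_le (h0 : 0 < α) (h1 : α ≤ 1) (hK : 0 ≤ K)
    (hM : ∀ x, ‖b x‖ ≤ M) (hb : ∀ x y, ‖b x - b y‖ ≤ K * ‖x - y‖ ^ α) (hσ : 0 < σ)
    (x y a : Vec d) :
    ‖(gaussAvg σ b (x + a) - gaussAvg σ b (y + a)) - (gaussAvg σ b x - gaussAvg σ b y)‖ ≤
      16 * gaussMoment d * K * σ ^ (α - 2) * (‖x - y‖ * ‖a‖) := by
  simp only [gaussAvg_eq_one hσ, smul_add]
  refine (norm_gaussAvg_one_second_diff_le h0 h1 (by positivity) (fun w => hM (σ • w))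
    (holder_comp_smul hσ hb) _ _ _).trans_eq ?_
  rw [← smul_sub, norm_smul, norm_smul, norm_inv, Real.norm_of_nonneg hσ.le,
    show α - 2 = α - 1 - 1 by ring, Real.rpow_sub_one hσ.ne', Real.rpow_sub_one hσ.ne']
  field_simp

/-- Rectangular increments of `gaussAvg σ b`: a second order bound at four points, with a
first order correction. -/
lemma norm_gaussAvg_four_le (h0 : 0 < α) (h1 : α ≤ 1) (hK : 0 ≤ K)
    (hM : ∀ x, ‖b x‖ ≤ M) (hb : ∀ x y, ‖b x - b y‖ ≤ K * ‖x - y‖ ^ α) (hσ : 0 < σ)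
    (x₁ y₁ x₂ y₂ : Vec d) :
    ‖(gaussAvg σ b x₂ - gaussAvg σ b y₂) - (gaussAvg σ b x₁ - gaussAvg σ b y₁)‖ ≤
      16 * gaussMoment d * K * σ ^ (α - 2) * (‖x₁ - y₁‖ * ‖x₂ - x₁‖) +
      2 * gaussMoment d * K * σ ^ (α - 1) * ‖(x₂ - y₂) - (x₁ - y₁)‖ := by
  have e1 := norm_gaussAvg_second_diff_le h0 h1 hK hM hb hσ x₁ y₁ (x₂ - x₁)
  have e2 := norm_gaussAvg_sub_le h0 h1 hK hM hb hσ (y₁ + (x₂ - x₁)) y₂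
  rw [show x₁ + (x₂ - x₁) = x₂ by abel] at e1
  rw [show y₁ + (x₂ - x₁) - y₂ = (x₂ - y₂) - (x₁ - y₁) by abel] at e2
  refine le_trans (le_of_eq ?_) ((norm_add_le _ _).trans (add_le_add e1 e2))
  congr 1; abel

/-- Gaussian averages of a Hölder function converge uniformly as `σ → 0`. -/
lemma norm_gaussAvg_sub_self_le (h0 : 0 < α) (h1 : α ≤ 1) (hK : 0 ≤ K) (hM : ∀ x, ‖b x‖ ≤ M)
    (hb : ∀ x y, ‖b x - b y‖ ≤ K * ‖x - y‖ ^ α) (hσ : 0 < σ) (x : Vec d) :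
    ‖gaussAvg σ b x - b x‖ ≤ K * σ ^ α * gaussMoment d := by
  have hbc := continuous_of_holder h0 hb
  have e : gaussAvg σ b x - b x = ∫ w, (b (x + σ • w) - b x) ∂(stdGaussian (Vec d)) := by
    unfold gaussAvg
    rw [integral_sub _ (integrable_const _)]
    · simp
    · exact integrable_of_bdd (Continuous.aestronglyMeasurable (by fun_prop)) fun w => hM _
  have hI : Integrable (fun w : Vec d => 1 + ‖w‖) (stdGaussian (Vec d)) :=
    memLp_one_add_norm.integrable (by norm_num)
  have hm : ∫ w : Vec d, (1 + ‖w‖) ∂(stdGaussian (Vec d)) ≤ gaussMoment d := by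
    refine Real.le_sqrt_of_sq_le ?_
    have hv := variance_nonneg (fun w : Vec d => 1 + ‖w‖) (stdGaussian (Vec d))
    rw [variance_eq_sub memLp_one_add_norm] at hv
    have : ∫ y : Vec d, (1 + ‖y‖) ^ 2 ∂(stdGaussian (Vec d)) =
      ∫ y : Vec d, ((fun w : Vec d => 1 + ‖w‖) ^ 2) y ∂(stdGaussian (Vec d)) := rfl
    rw [this]; linarith
  rw [e]
  calc ‖∫ w, (b (x + σ • w) - b x) ∂(stdGaussian (Vec d))‖
      ≤ ∫ w, K * σ ^ α * (1 + ‖w‖) ∂(stdGaussian (Vec d)) := by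
        refine norm_integral_le_of_norm_le (hI.const_mul _) (ae_of_all _ fun w => ?_)
        refine (hb _ _).trans ?_
        rw [add_sub_cancel_left, norm_smul, Real.norm_of_nonneg hσ.le,
          Real.mul_rpow hσ.le (norm_nonneg _), ← mul_assoc]
        gcongr
        exact rpow_le_one_add (norm_nonneg w) h0.le h1
    _ ≤ _ := by rw [integral_const_mul]; gcongr

end Gauss

/-! ### Stochastic sewing in a Hilbert space -/

section Sewing
variable {K : Type*} [NormedAddCommGroup K] [InnerProductSpace ℝ K]

/-- An increasing family of orthogonal projections. -/
structure IsProjFamily (E : ℝ → K →L[ℝ] K) : Prop where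
  norm_le : ∀ u x, ‖E u x‖ ≤ ‖x‖
  comp_of_le : ∀ u v x, u ≤ v → E u (E v x) = E u x
  comp_of_ge : ∀ u v x, u ≤ v → E v (E u x) = E u x
  symm : ∀ u x y, inner ℝ (E u x) y = inner ℝ x (E u y)

/-- Pythagoras: N orthogonal terms cost √N instead of N. All the stochastic cancellation in the
sewing estimate comes from here. -/
lemma norm_sum_le_of_orthogonal {D : ℕ → K} (h : ∀ i j, j < i → inner ℝ (D j) (D i) = 0) {B : ℝ}
    (hB0 : 0 ≤ B) (N : ℕ) (hB : ∀ i < N, ‖D i‖ ≤ B) :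
    ‖∑ i ∈ Finset.range N, D i‖ ≤ Real.sqrt N * B := by
  have key : ∀ n ≤ N, ‖∑ i ∈ Finset.range n, D i‖ ^ 2 ≤ n * B ^ 2 := by
    intro n
    induction n with
    | zero => simp
    | succ n ih =>
      intro hn
      rw [Finset.sum_range_succ, norm_add_sq_real, sum_inner,
        Finset.sum_eq_zero fun j hj => h n j (Finset.mem_range.1 hj)]
      have h1 := ih (by omega)
      have h2 := pow_le_pow_left₀ (norm_nonneg _) (hB n (by omega)) 2
      push_cast; linarith
  have := Real.sqrt_le_sqrt (key N le_rfl)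
  rwa [Real.sqrt_sq (norm_nonneg _), Real.sqrt_mul (Nat.cast_nonneg _), Real.sqrt_sq hB0] at this

lemma sum_range_two_mul {M : Type*} [AddCommMonoid M] (a : ℕ → M) (N : ℕ) :
    ∑ j ∈ Finset.range (2 * N), a j = ∑ i ∈ Finset.range N, (a (2 * i) + a (2 * i + 1)) := by
  induction N with
  | zero => simp
  | succ n ih =>
    rw [Finset.sum_range_succ, ← ih, show 2 * (n + 1) = 2 * n + 1 + 1 by ring,
      Finset.sum_range_succ, Finset.sum_range_succ, add_assoc]

/-- The data of a germ `A u r`, its limit `f r`, and the bounds used in the stochastic sewing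
argument on `[S, T]`: `A u₂ r - A u₁ r` is, up to a small remainder, the increment
`(E u₂ - E u₁) (Y u₁ r)`. -/
structure SewingData (E : ℝ → K →L[ℝ] K) (S T : ℝ) (f : ℝ → K) (A Y : ℝ → ℝ → K)
    (p ε Γ : ℝ) : Prop where
  contA : ∀ u ∈ Set.Icc S T, ContinuousOn (A u) (Set.Icc S T)
  contY : ∀ u ∈ Set.Icc S T, ContinuousOn (Y u) (Set.Icc S T)
  contf : ContinuousOn f (Set.Icc S T)
  base : ∀ r, S < r → r ≤ T → ‖A S r‖ ≤ Γ * (r - S) ^ (-p)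
  rem : ∀ u₁ u₂ r, S ≤ u₁ → u₁ < u₂ → u₂ < r → r ≤ T → r - u₁ ≤ 4 * (r - u₂) →
    ‖A u₂ r - A u₁ r - (E u₂ (Y u₁ r) - E u₁ (Y u₁ r))‖ ≤ Γ * (r - u₁) ^ ε
  mart : ∀ u₁ u₂ r, S ≤ u₁ → u₁ < u₂ → u₂ < r → r ≤ T → ‖E u₂ (Y u₁ r)‖ ≤ Γ * (r - u₂) ^ (-p)

variable {E : ℝ → K →L[ℝ] K} {S T : ℝ} {f : ℝ → K} {A Y : ℝ → ℝ → K} {p ε Γ : ℝ}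

/-- The contribution of the `j`-th cell of mesh `δ` to the Riemann type sum of the germ. -/
def cellIntegral (A : ℝ → ℝ → K) (S δ : ℝ) (j : ℕ) : K :=
  ∫ r in (S + j * δ)..(S + (j + 1) * δ), A (S + ((j - 1 : ℕ) : ℝ) * δ) r

/-- The part of the remainder in a cell. -/
def remPart (E : ℝ → K →L[ℝ] K) (A Y : ℝ → ℝ → K) (a c u₁ u₂ : ℝ) : K :=
  ∫ r in a..c, (A u₂ r - A u₁ r - (E u₂ (Y u₁ r) - E u₁ (Y u₁ r)))

/-- The martingale part in a cell. -/
def martPart (E : ℝ → K →L[ℝ] K) (Y : ℝ → ℝ → K) (a c u₁ u₂ : ℝ) : K :=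
  ∫ r in a..c, (E u₂ (Y u₁ r) - E u₁ (Y u₁ r))

lemma intervalIntegrable_of_continuousOn {F : Type*} [NormedAddCommGroup F] {g : ℝ → F}
    {S T a c : ℝ} (hg : ContinuousOn g (Set.Icc S T)) (ha : S ≤ a) (hac : a ≤ c) (hc : c ≤ T) : IntervalIntegrable g volume a c :=
  (hg.mono (by rw [Set.uIcc_of_le hac]; exact Set.Icc_subset_Icc ha hc)).intervalIntegrable

lemma SewingData.integral_sub (h : SewingData E S T f A Y p ε Γ) {a c u₁ u₂ : ℝ} (ha : S ≤ a)
    (hac : a ≤ c) (hc : c ≤ T) (h1 : u₁ ∈ Set.Icc S T) (h2 : u₂ ∈ Set.Icc S T) :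
    (∫ r in a..c, A u₂ r) - ∫ r in a..c, A u₁ r =
      remPart E A Y a c u₁ u₂ + martPart E Y a c u₁ u₂ := by
  have i1 := intervalIntegrable_of_continuousOn (h.contA u₁ h1) ha hac hc
  have i2 := intervalIntegrable_of_continuousOn (h.contA u₂ h2) ha hac hc
  have hy1 : IntervalIntegrable (fun r => E u₁ (Y u₁ r)) volume a c :=
    intervalIntegrable_of_continuousOn ((E u₁).continuous.comp_continuousOn (h.contY u₁ h1)) ha hac hc
  have hy2 : IntervalIntegrable (fun r => E u₂ (Y u₁ r)) volume a c :=
    intervalIntegrable_of_continuousOn ((E u₂).continuous.comp_continuousOn (h.contY u₁ h1)) ha hac hc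
  rw [remPart, martPart, intervalIntegral.integral_sub (i2.sub i1) (hy2.sub hy1),
    intervalIntegral.integral_sub i2 i1]
  abel

/-- For r in the cell, r - u₁ ≤ δ ≤ 4(a - u₂) ≤ 4(r - u₂), which is the non-degeneracy required by
`rem`. -/
lemma SewingData.norm_remPart_le (h : SewingData E S T f A Y p ε Γ) (hΓ : 0 ≤ Γ) (hε : 0 ≤ ε)
    {a c u₁ u₂ δ : ℝ} (hac : a ≤ c) (hc : c ≤ T) (h1 : S ≤ u₁) (h12 : u₁ < u₂)
    (h2 : u₂ ≤ a) (h3 : c - u₁ ≤ δ) (h4 : δ ≤ 4 * (a - u₂)) :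
    ‖remPart E A Y a c u₁ u₂‖ ≤ Γ * δ ^ ε * (c - a) := by
  have := intervalIntegral.norm_integral_le_of_norm_le_const (a := a) (b := c) (C := Γ * δ ^ ε)
    (f := fun r => A u₂ r - A u₁ r - (E u₂ (Y u₁ r) - E u₁ (Y u₁ r))) fun r hr => by
      rw [Set.uIoc_of_le hac] at hr
      refine (h.rem u₁ u₂ r h1 h12 (h2.trans_lt hr.1) (hr.2.trans hc)
        (by linarith [hr.1, hr.2])).trans ?_
      have : 0 ≤ r - u₁ := by linarith [hr.1]
      gcongr
      linarith [hr.2]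
  rwa [abs_of_nonneg (by linarith)] at this

/-- By the tower property E_{u₁} = E_{u₁} E_{u₂}, so the bound at the later time u₂ controls both
terms. Since u₂ stays at distance δ from the cell, the singularity at r = u₂ is avoided. -/
lemma SewingData.norm_martPart_le (hE : IsProjFamily E) (h : SewingData E S T f A Y p ε Γ)
    (hΓ : 0 ≤ Γ) (hp : 0 ≤ p)
    {a c u₁ u₂ δ : ℝ} (hac : a ≤ c) (hc : c ≤ T) (h1 : S ≤ u₁) (h12 : u₁ < u₂) (hδ : 0 < δ)
    (h2 : u₂ + δ ≤ a) :
    ‖martPart E Y a c u₁ u₂‖ ≤ 2 * (Γ * δ ^ (-p)) * (c - a) := by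
  have := intervalIntegral.norm_integral_le_of_norm_le_const (a := a) (b := c)
    (C := 2 * (Γ * δ ^ (-p))) (f := fun r => E u₂ (Y u₁ r) - E u₁ (Y u₁ r)) fun r hr => by
      rw [Set.uIoc_of_le hac] at hr
      have hm := h.mart u₁ u₂ r h1 h12 (by linarith [hr.1]) (hr.2.trans hc)
      have hm' : Γ * (r - u₂) ^ (-p) ≤ Γ * δ ^ (-p) := by
        refine mul_le_mul_of_nonneg_left ?_ hΓ
        exact Real.rpow_le_rpow_of_nonpos hδ (by linarith [hr.1]) (by linarith)
      have e : E u₁ (Y u₁ r) = E u₁ (E u₂ (Y u₁ r)) := (hE.comp_of_le _ _ _ h12.le).symm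
      calc ‖E u₂ (Y u₁ r) - E u₁ (Y u₁ r)‖ ≤ ‖E u₂ (Y u₁ r)‖ + ‖E u₁ (Y u₁ r)‖ := norm_sub_le _ _
        _ ≤ ‖E u₂ (Y u₁ r)‖ + ‖E u₂ (Y u₁ r)‖ := by rw [e]; gcongr; exact hE.norm_le _ _
        _ ≤ _ := by linarith
  rwa [abs_of_nonneg (by linarith)] at this

variable [CompleteSpace K]

lemma SewingData.apply_martPart_of_ge (hE : IsProjFamily E) (h : SewingData E S T f A Y p ε Γ)
    {a c u₁ u₂ v : ℝ} (ha : S ≤ a) (hac : a ≤ c) (hc : c ≤ T) (h1 : u₁ ∈ Set.Icc S T)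
    (h12 : u₁ ≤ u₂) (hv : u₂ ≤ v) :
    E v (martPart E Y a c u₁ u₂) = martPart E Y a c u₁ u₂ := by
  have hy1 : IntervalIntegrable (fun r => E u₁ (Y u₁ r)) volume a c :=
    intervalIntegrable_of_continuousOn ((E u₁).continuous.comp_continuousOn (h.contY u₁ h1)) ha hac hc
  have hy2 : IntervalIntegrable (fun r => E u₂ (Y u₁ r)) volume a c :=
    intervalIntegrable_of_continuousOn ((E u₂).continuous.comp_continuousOn (h.contY u₁ h1)) ha hac hc
  rw [martPart, ← ContinuousLinearMap.intervalIntegral_comp_comm _ (hy2.sub hy1)]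
  congr 1; ext1 r
  rw [map_sub, hE.comp_of_ge _ _ _ hv, hE.comp_of_ge _ _ _ (h12.trans hv)]

lemma SewingData.apply_martPart_of_le (hE : IsProjFamily E) (h : SewingData E S T f A Y p ε Γ)
    {a c u₁ u₂ : ℝ} (ha : S ≤ a) (hac : a ≤ c) (hc : c ≤ T) (h1 : u₁ ∈ Set.Icc S T)
    (h12 : u₁ ≤ u₂) :
    E u₁ (martPart E Y a c u₁ u₂) = 0 := by
  have hy1 : IntervalIntegrable (fun r => E u₁ (Y u₁ r)) volume a c :=
    intervalIntegrable_of_continuousOn ((E u₁).continuous.comp_continuousOn (h.contY u₁ h1)) ha hac hc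
  have hy2 : IntervalIntegrable (fun r => E u₂ (Y u₁ r)) volume a c :=
    intervalIntegrable_of_continuousOn ((E u₂).continuous.comp_continuousOn (h.contY u₁ h1)) ha hac hc
  rw [martPart, ← ContinuousLinearMap.intervalIntegral_comp_comm _ (hy2.sub hy1)]
  have : ∀ r, E u₁ (E u₂ (Y u₁ r) - E u₁ (Y u₁ r)) = 0 := fun r => by
    rw [map_sub, hE.comp_of_le _ _ _ h12, hE.comp_of_le _ _ _ le_rfl, sub_self]
  simp [this]

/-- Halving the mesh moves the base points of the germ closer to the cells. The resulting change is
a sum of remainders, added up by the triangle inequality, and of martingale terms: the i-th is fixed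
by the projection at S + iδ and killed by the one at S + (i-1)δ, so these terms are pairwise
orthogonal. -/
lemma SewingData.norm_refine_le (hE : IsProjFamily E) (h : SewingData E S T f A Y p ε Γ)
    (hΓ : 0 ≤ Γ) (hp : 0 ≤ p) (hε : 0 ≤ ε) {δ : ℝ} (hδ : 0 < δ) (N : ℕ) (hN : S + N * δ ≤ T) :
    ‖(∑ j ∈ Finset.range (2 * N), cellIntegral A S (δ / 2) j) -
      ∑ i ∈ Finset.range N, cellIntegral A S δ i‖ ≤
      N * (Γ * (2 * δ) ^ ε * δ) + Real.sqrt N * (2 * (Γ * (δ / 2) ^ (-p)) * δ) := by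
  -- The base point lies one cell to the left of the cell. By truncated subtraction, cell 0 and both
  -- its halves have base point S, so i = 0 contributes nothing. For i > 0 it moves from S + (i-1)δ
  -- to S + iδ - δ/2 on the left half and to S + iδ on the right half.
  set R : ℕ → K := fun i => if i = 0 then 0 else
    remPart E A Y (S + i * δ) (S + i * δ + δ / 2) (S + (i - 1) * δ) (S + i * δ - δ / 2) +
    remPart E A Y (S + i * δ + δ / 2) (S + (i + 1) * δ) (S + (i - 1) * δ) (S + i * δ)
  -- Setting `D` to zero beyond N makes the orthogonality hold for all indices.
  set D : ℕ → K := fun i => if i = 0 ∨ N ≤ i then 0 else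
    martPart E Y (S + i * δ) (S + i * δ + δ / 2) (S + (i - 1) * δ) (S + i * δ - δ / 2) +
    martPart E Y (S + i * δ + δ / 2) (S + (i + 1) * δ) (S + (i - 1) * δ) (S + i * δ)
  have hcell : ∀ i : ℕ, i < N → S + (i + 1) * δ ≤ T := fun i hi => by
    have : ((i : ℝ) + 1) ≤ N := by exact_mod_cast hi
    nlinarith
  have hpos : ∀ i : ℕ, i ≠ 0 → (1 : ℝ) ≤ i := fun i hi => by
    exact_mod_cast Nat.one_le_iff_ne_zero.2 hi
  have hmem : ∀ i : ℕ, i ≠ 0 → i < N → S + ((i : ℝ) - 1) * δ ∈ Set.Icc S T ∧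
      S + (i : ℝ) * δ - δ / 2 ∈ Set.Icc S T ∧ S + (i : ℝ) * δ ∈ Set.Icc S T := fun i h0 hi => by
    have h1 := hpos i h0
    have h2 := hcell i hi
    refine ⟨⟨?_, ?_⟩, ⟨?_, ?_⟩, ?_, ?_⟩ <;> nlinarith
  have key : ∀ i < N, cellIntegral A S (δ / 2) (2 * i) + cellIntegral A S (δ / 2) (2 * i + 1) -
      cellIntegral A S δ i = R i + D i := by
    intro i hi
    have h2 := hcell i hi
    have hi0 : (0 : ℝ) ≤ i := Nat.cast_nonneg i
    have hSi : S ≤ S + i * δ := by nlinarith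
    have e1 : S + ((2 * i : ℕ) : ℝ) * (δ / 2) = S + i * δ := by push_cast; ring
    have e2 : S + (((2 * i : ℕ) : ℝ) + 1) * (δ / 2) = S + i * δ + δ / 2 := by push_cast; ring
    have e3 : S + ((2 * i + 1 : ℕ) : ℝ) * (δ / 2) = S + i * δ + δ / 2 := by push_cast; ring
    have e4 : S + (((2 * i + 1 : ℕ) : ℝ) + 1) * (δ / 2) = S + (i + 1) * δ := by push_cast; ring
    have e5 : S + (((2 * i + 1 - 1 : ℕ)) : ℝ) * (δ / 2) = S + i * δ := by
      rw [Nat.add_sub_cancel]; push_cast; ring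
    have hu : S + ((i - 1 : ℕ) : ℝ) * δ ∈ Set.Icc S T := by
      have : ((i - 1 : ℕ) : ℝ) ≤ i := by exact_mod_cast Nat.sub_le _ _
      have h0 : (0 : ℝ) ≤ ((i - 1 : ℕ) : ℝ) := Nat.cast_nonneg _
      constructor <;> nlinarith
    have hsplit : cellIntegral A S δ i =
        (∫ r in (S + i * δ)..(S + i * δ + δ / 2), A (S + ((i - 1 : ℕ) : ℝ) * δ) r) +
        ∫ r in (S + i * δ + δ / 2)..(S + (i + 1) * δ), A (S + ((i - 1 : ℕ) : ℝ) * δ) r := by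
      rw [cellIntegral, intervalIntegral.integral_add_adjacent_intervals]
      · exact intervalIntegrable_of_continuousOn (h.contA _ hu) hSi (by linarith) (by linarith)
      · exact intervalIntegrable_of_continuousOn (h.contA _ hu) (by linarith) (by linarith) h2
    rw [hsplit]
    unfold cellIntegral
    rw [e1, e2, e3, e4, e5]
    rcases eq_or_ne i 0 with rfl | h0
    · simp [R, D]
    · have h1 := hpos i h0
      obtain ⟨m1, m2, m3⟩ := hmem i h0 hi
      have e6 : S + ((2 * i - 1 : ℕ) : ℝ) * (δ / 2) = S + i * δ - δ / 2 := by
        rw [Nat.cast_sub (by omega)]; push_cast; ring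
      have e7 : S + ((i - 1 : ℕ) : ℝ) * δ = S + (i - 1) * δ := by
        rw [Nat.cast_sub (by omega)]; push_cast; ring
      rw [e6, e7]
      have s1 := h.integral_sub hSi (by linarith : S + i * δ ≤ S + i * δ + δ / 2) (by linarith)
        m1 m2
      have s2 := h.integral_sub (by linarith : S ≤ S + i * δ + δ / 2)
        (by linarith : S + i * δ + δ / 2 ≤ S + (i + 1) * δ) h2 m1 m3
      simp only [R, D, h0, false_or, not_le.2 hi, if_false]
      rw [add_add_add_comm, ← s1, ← s2]
      abel
  have hDadapt : ∀ (i : ℕ) (v : ℝ), S + i * δ ≤ v → E v (D i) = D i := by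
    intro i v hv
    simp only [D]
    split_ifs with hi
    · simp
    · push Not at hi
      obtain ⟨m1, m2, m3⟩ := hmem i hi.1 hi.2
      have h2 := hcell i hi.2
      rw [map_add, h.apply_martPart_of_ge hE m3.1 (by linarith) (by linarith) m1 (by linarith)
        (by linarith), h.apply_martPart_of_ge hE (by linarith [m3.1]) (by linarith) h2 m1
        (by linarith) hv]
  have hDzero : ∀ i : ℕ, E (S + (i - 1) * δ) (D i) = 0 := by
    intro i
    simp only [D]
    split_ifs with hi
    · simp
    · push Not at hi
      obtain ⟨m1, m2, m3⟩ := hmem i hi.1 hi.2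
      have h2 := hcell i hi.2
      rw [map_add, h.apply_martPart_of_le hE m3.1 (by linarith) (by linarith) m1 (by linarith),
        h.apply_martPart_of_le hE (by linarith [m3.1]) (by linarith) h2 m1
        (by linarith), add_zero]
  have horth : ∀ i j, j < i → inner ℝ (D j) (D i) = 0 := by
    intro i j hij
    have hv : S + j * δ ≤ S + (i - 1) * δ := by
      have : (j : ℝ) + 1 ≤ i := by exact_mod_cast hij
      nlinarith
    rw [← hDadapt j _ hv, hE.symm, hDzero, inner_zero_right]
  have hp2 : 0 ≤ (δ / 2) ^ (-p) := by positivity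
  have hDB : ∀ i < N, ‖D i‖ ≤ 2 * (Γ * (δ / 2) ^ (-p)) * δ := by
    intro i hi
    simp only [D]
    split_ifs with hi'
    · simp only [norm_zero]; positivity
    · push Not at hi'
      obtain ⟨m1, m2, m3⟩ := hmem i hi'.1 hi
      have h2 := hcell i hi
      have b1 := h.norm_martPart_le hE hΓ hp (by linarith : S + i * δ ≤ S + i * δ + δ / 2)
        (by linarith) m1.1 (by linarith : S + ((i : ℝ) - 1) * δ < S + i * δ - δ / 2)
        (by linarith : 0 < δ / 2) (by linarith)
      have b2 := h.norm_martPart_le hE hΓ hp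
        (by linarith : S + i * δ + δ / 2 ≤ S + (i + 1) * δ)
        h2 m1.1 (by linarith : S + ((i : ℝ) - 1) * δ < S + i * δ)
        (by linarith : 0 < δ / 2) (by linarith)
      refine (norm_add_le _ _).trans ((add_le_add b1 b2).trans_eq ?_)
      ring
  have hRB : ∀ i ∈ Finset.range N, ‖R i‖ ≤ Γ * (2 * δ) ^ ε * δ := by
    intro i hi
    rw [Finset.mem_range] at hi
    simp only [R]
    split_ifs with hi'
    · simp only [norm_zero]; positivity
    · obtain ⟨m1, m2, m3⟩ := hmem i hi' hi
      have h2 := hcell i hi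
      have b1 := h.norm_remPart_le hΓ hε (δ := 2 * δ)
        (by linarith : S + i * δ ≤ S + i * δ + δ / 2)
        (by linarith) m1.1 (by linarith : S + ((i : ℝ) - 1) * δ < S + i * δ - δ / 2)
        (by linarith) (by linarith) (by linarith)
      have b2 := h.norm_remPart_le hΓ hε (δ := 2 * δ)
        (by linarith : S + i * δ + δ / 2 ≤ S + (i + 1) * δ)
        h2 m1.1 (by linarith : S + ((i : ℝ) - 1) * δ < S + i * δ)
        (by linarith) (by linarith) (by linarith)
      refine (norm_add_le _ _).trans ((add_le_add b1 b2).trans_eq ?_)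
      ring
  rw [sum_range_two_mul, ← Finset.sum_sub_distrib,
    Finset.sum_congr rfl fun i hi => key i (Finset.mem_range.1 hi), Finset.sum_add_distrib]
  refine (norm_add_le _ _).trans (add_le_add ?_
    (norm_sum_le_of_orthogonal horth (by positivity) N hDB))
  refine (norm_sum_le_of_le _ hRB).trans_eq ?_
  rw [Finset.sum_const, Finset.card_range, nsmul_eq_mul]

lemma integral_sub_rpow {S T p : ℝ} (hp : p < 1) :
    IntervalIntegrable (fun r => (r - S) ^ (-p)) volume S T ∧
    ∫ r in S..T, (r - S) ^ (-p) = (T - S) ^ (1 - p) / (1 - p) := by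
  constructor
  · have h : IntervalIntegrable (fun x : ℝ => x ^ (-p)) volume (S - S) (T - S) :=
      intervalIntegral.intervalIntegrable_rpow' (by linarith)
    have := h.comp_sub_right S
    simpa using this
  · rw [intervalIntegral.integral_comp_sub_right (fun x => x ^ (-p)), integral_rpow
      (Or.inl (by linarith)), sub_self, neg_add_eq_sub, Real.zero_rpow (by linarith), sub_zero]

lemma geom_sum_le {q : ℝ} (h0 : 0 ≤ q) (h1 : q < 1) (n : ℕ) :
    ∑ k ∈ Finset.range n, q ^ k ≤ (1 - q)⁻¹ := by
  rw [← tsum_geometric_of_lt_one h0 h1]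
  exact (summable_geometric_of_lt_one h0 h1).sum_le_tsum _ fun _ _ => by positivity

/-- The constant in the stochastic sewing estimate. -/
def sewConst (p ε : ℝ) : ℝ :=
  1 / (1 - p) + 2 ^ ε * (1 - 2 ^ (-ε))⁻¹ + 2 ^ (1 + p) * (1 - 2 ^ (-(1 / 2 - p)))⁻¹

lemma sewConst_nonneg {p ε : ℝ} (hp : p < 1 / 2) (hε : 0 < ε) : 0 ≤ sewConst p ε := by
  have h1 : (2 : ℝ) ^ (-ε) < 1 := Real.rpow_lt_one_of_one_lt_of_neg (by norm_num) (by linarith)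
  have h2 : (2 : ℝ) ^ (-(1 / 2 - p)) < 1 :=
    Real.rpow_lt_one_of_one_lt_of_neg (by norm_num) (by linarith)
  have h3 : 0 ≤ (1 - (2 : ℝ) ^ (-ε))⁻¹ := inv_nonneg.2 (by linarith)
  have h4 : 0 ≤ (1 - (2 : ℝ) ^ (-(1 / 2 - p)))⁻¹ := inv_nonneg.2 (by linarith)
  have h5 : 0 ≤ 1 / (1 - p) := one_div_nonneg.2 (by linarith)
  unfold sewConst; positivity

/-- Stochastic sewing: the integral of the limit of the germ is of order `(T - S) ^ (1 - p)`. -/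
theorem SewingData.norm_integral_le (hE : IsProjFamily E) (h : SewingData E S T f A Y p ε Γ)
    (hΓ : 0 ≤ Γ) (hp : 0 ≤ p) (hp' : p < 1 / 2) (hε : 0 < ε) (hST : S < T) (hL : T - S ≤ 1)
    {Γ' ε' : ℝ} (hε' : 0 < ε') (hΓ' : 0 ≤ Γ')
    (hconv : ∀ u r, S ≤ u → u < r → r ≤ T → ‖f r - A u r‖ ≤ Γ' * (r - u) ^ ε') :
    ‖∫ r in S..T, f r‖ ≤ sewConst p ε * Γ * (T - S) ^ (1 - p) := by
  set L := T - S
  have hL0 : 0 < L := sub_pos.2 hST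
  set δ : ℕ → ℝ := fun n => L / 2 ^ n
  have hδ0 : ∀ n, 0 < δ n := fun n => by positivity
  have hδN : ∀ n, (2 ^ n : ℕ) * δ n = L := fun n => by simp only [δ]; push_cast; field_simp
  set I : ℕ → K := fun n => ∑ j ∈ Finset.range (2 ^ n), cellIntegral A S (δ n) j
  set q₁ : ℝ := 2 ^ (-ε)
  set q₂ : ℝ := 2 ^ (-(1 / 2 - p))
  have hq₁ : q₁ < 1 := Real.rpow_lt_one_of_one_lt_of_neg (by norm_num) (by linarith)
  have hq₂ : q₂ < 1 := Real.rpow_lt_one_of_one_lt_of_neg (by norm_num) (by linarith)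
  -- With 2^n cells of length L / 2^n, the remainders decay like 2^(-nε) and the martingale terms
  -- like 2^(n/2) 2^(np) 2^(-n) = 2^(-n(1/2-p)). Both series are geometric because p < 1/2.
  have hstep : ∀ n, ‖I (n + 1) - I n‖ ≤
      Γ * L ^ (1 - p) * (2 ^ ε * q₁ ^ n + 2 ^ (1 + p) * q₂ ^ n) := by
    intro n
    have h1 := h.norm_refine_le hE hΓ hp hε.le (hδ0 n) (2 ^ n) (by rw [hδN]; simp [L])
    rw [show 2 * 2 ^ n = 2 ^ (n + 1) by ring, show δ n / 2 = δ (n + 1) by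
      simp only [δ]; rw [pow_succ]; field_simp] at h1
    refine h1.trans ?_
    rw [mul_add]
    have h2n : (2 : ℝ) ^ n = 2 ^ (n : ℝ) := (Real.rpow_natCast _ _).symm
    have two : (0 : ℝ) < 2 := by norm_num
    have hL1 : L ^ (1 + ε) ≤ L ^ (1 - p) :=
      Real.rpow_le_rpow_of_exponent_ge hL0 hL (by linarith)
    refine add_le_add ?_ (le_of_eq ?_)
    · calc ((2 ^ n : ℕ) : ℝ) * (Γ * (2 * δ n) ^ ε * δ n)
          = Γ * (2 * δ n) ^ ε * ((2 ^ n : ℕ) * δ n) := by ring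
        _ = Γ * L ^ (1 + ε) * (2 ^ ε * q₁ ^ n) := by
          rw [hδN]
          have : (2 * δ n) ^ ε = 2 ^ ε * L ^ ε * q₁ ^ n := by
            simp only [δ, q₁]
            rw [Real.mul_rpow two.le (by positivity), Real.div_rpow hL0.le (by positivity), h2n,
              ← Real.rpow_mul two.le, ← Real.rpow_natCast, ← Real.rpow_mul two.le,
              mul_comm (-ε), mul_neg, Real.rpow_neg two.le]
            ring
          rw [this, Real.rpow_add hL0, Real.rpow_one]; ring
        _ ≤ _ := by gcongr
    · have e1 : Real.sqrt ((2 ^ n : ℕ) : ℝ) = 2 ^ ((n : ℝ) / 2) := by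
        push_cast
        rw [h2n, Real.sqrt_eq_rpow, ← Real.rpow_mul two.le]; congr 1; ring
      have e2 : δ (n + 1) = L * 2 ^ (-(n : ℝ) - 1) := by
        simp only [δ]
        rw [div_eq_mul_inv, ← Real.rpow_natCast, ← Real.rpow_neg two.le]; push_cast; ring_nf
      have e3 : δ n = L * 2 ^ (-(n : ℝ)) := by
        simp only [δ]
        rw [div_eq_mul_inv, ← Real.rpow_natCast, ← Real.rpow_neg two.le]
      rw [e1, e2, e3, Real.mul_rpow hL0.le (by positivity), ← Real.rpow_mul two.le]
      simp only [q₂]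
      rw [← Real.rpow_natCast, ← Real.rpow_mul two.le]
      have e4 : L ^ (1 - p) = L ^ (-p) * L := by
        rw [sub_eq_neg_add, Real.rpow_add hL0, Real.rpow_one]
      have e5 : (2 : ℝ) ^ ((n : ℝ) / 2) * 2 * 2 ^ ((-(n : ℝ) - 1) * -p) * 2 ^ (-(n : ℝ)) =
          2 ^ (1 + p) * 2 ^ (-(1 / 2 - p) * (n : ℝ)) := by
        have : (2 : ℝ) ^ ((n : ℝ) / 2) * 2 = 2 ^ ((n : ℝ) / 2 + 1) := by
          rw [Real.rpow_add two, Real.rpow_one]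
        rw [this, ← Real.rpow_add two, ← Real.rpow_add two, ← Real.rpow_add two]
        congr 1; ring
      rw [e4, ← e5]; ring
  -- The coarsest sum is a single cell with base point S, where `base` applies.
  have hI0 : ‖I 0‖ ≤ Γ * L ^ (1 - p) * (1 / (1 - p)) := by
    have : I 0 = ∫ r in S..T, A S r := by simp [I, cellIntegral, δ, L]
    rw [this]
    obtain ⟨hi, hI⟩ := integral_sub_rpow (S := S) (T := T) (p := p) (by linarith)
    refine (intervalIntegral.norm_integral_le_of_norm_le hST.le (ae_of_all _ fun r hr =>
      h.base r hr.1 hr.2) (hi.const_mul Γ)).trans_eq ?_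
    rw [intervalIntegral.integral_const_mul, hI]; simp only [L]; ring
  have hIn : ∀ n, ‖I n‖ ≤ sewConst p ε * Γ * L ^ (1 - p) := by
    intro n
    have h1 : I n = I 0 + ∑ k ∈ Finset.range n, (I (k + 1) - I k) := by
      rw [Finset.sum_range_sub]; abel
    rw [h1]
    refine (norm_add_le _ _).trans ((add_le_add hI0 (norm_sum_le_of_le _ fun k _ => hstep k)).trans ?_)
    rw [← Finset.mul_sum, Finset.sum_add_distrib, ← Finset.mul_sum, ← Finset.mul_sum, ← mul_add]
    have g1 := geom_sum_le (by positivity : 0 ≤ q₁) hq₁ n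
    have g2 := geom_sum_le (by positivity : 0 ≤ q₂) hq₂ n
    calc _ ≤ Γ * L ^ (1 - p) * (1 / (1 - p) + (2 ^ ε * (1 - q₁)⁻¹ + 2 ^ (1 + p) * (1 - q₂)⁻¹)) := by
          gcongr
      _ = _ := by simp only [sewConst, q₁, q₂]; ring
  -- Each point of a cell is within two mesh lengths of its base point, so `hconv` makes the Riemann
  -- sums converge to the integral of f.
  have hlim : Tendsto I atTop (𝓝 (∫ r in S..T, f r)) := by
    rw [tendsto_iff_norm_sub_tendsto_zero]
    have hδlim : Tendsto δ atTop (𝓝 0) := by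
      have := (tendsto_pow_atTop_nhds_zero_of_lt_one (r := (1 / 2 : ℝ)) (by norm_num)
        (by norm_num)).const_mul L
      simpa [δ, div_eq_mul_inv] using this
    have hbd : Tendsto (fun n => L * (Γ' * (2 * δ n) ^ ε')) atTop (𝓝 0) := by
      have h1 : Tendsto (fun n => (2 * δ n) ^ ε') atTop (𝓝 ((2 * 0) ^ ε')) :=
        (hδlim.const_mul 2).rpow_const (Or.inr hε'.le)
      rw [mul_zero, Real.zero_rpow hε'.ne'] at h1
      simpa using (h1.const_mul Γ').const_mul L
    refine squeeze_zero (fun _ => norm_nonneg _) (fun n => ?_) hbd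
    have hcell : ∀ j : ℕ, j < 2 ^ n → S + ((j : ℝ) + 1) * δ n ≤ T := fun j hj => by
      have h1 : ((j : ℝ) + 1) ≤ (2 ^ n : ℕ) := by exact_mod_cast hj
      have h2 := hδN n
      have h3 := mul_le_mul_of_nonneg_right h1 (hδ0 n).le
      simp only [L] at h2; linarith
    have hj0 : ∀ j : ℕ, 0 ≤ (j : ℝ) * δ n := fun j => mul_nonneg (Nat.cast_nonneg _) (hδ0 n).le
    have hsum : ∫ r in S..T, f r =
        ∑ j ∈ Finset.range (2 ^ n), ∫ r in (S + j * δ n)..(S + (j + 1) * δ n), f r := by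
      have := intervalIntegral.sum_integral_adjacent_intervals (μ := volume) (f := f)
        (a := fun j : ℕ => S + j * δ n) (n := 2 ^ n) fun j hj =>
          intervalIntegrable_of_continuousOn h.contf (by linarith [hj0 j])
            (by push_cast; linarith [hδ0 n]) (by push_cast; exact hcell j hj)
      push_cast at this
      rw [this]
      have := hδN n
      push_cast at this
      rw [this]; simp [L]
    rw [norm_sub_rev, hsum, ← Finset.sum_sub_distrib]
    have hcb : ∀ j ∈ Finset.range (2 ^ n),
        ‖(∫ r in (S + j * δ n)..(S + (j + 1) * δ n), f r) - cellIntegral A S (δ n) j‖ ≤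
          Γ' * (2 * δ n) ^ ε' * δ n := by
      intro j hj
      have hj' := hcell j (Finset.mem_range.1 hj)
      have h0 := hj0 j
      have hle : ((j - 1 : ℕ) : ℝ) ≤ j := by exact_mod_cast Nat.sub_le _ _
      have hge : (j : ℝ) - 1 ≤ ((j - 1 : ℕ) : ℝ) := by
        rw [sub_le_iff_le_add]; exact_mod_cast Nat.le_add_of_sub_le le_rfl
      have hz : 0 ≤ ((j - 1 : ℕ) : ℝ) * δ n := hj0 _
      have hle' := mul_le_mul_of_nonneg_right hle (hδ0 n).le
      have hge' := mul_le_mul_of_nonneg_right hge (hδ0 n).le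
      have hab : S + j * δ n ≤ S + (j + 1) * δ n := by linarith [hδ0 n]
      rw [cellIntegral, ← intervalIntegral.integral_sub
        (intervalIntegrable_of_continuousOn h.contf (by linarith) hab hj')
        (intervalIntegrable_of_continuousOn (h.contA _ ⟨by linarith, by linarith⟩)
          (by linarith) hab hj')]
      refine (intervalIntegral.norm_integral_le_of_norm_le_const (C := Γ' * (2 * δ n) ^ ε')
        fun r hr => ?_).trans_eq ?_
      · rw [Set.uIoc_of_le hab] at hr
        refine (hconv _ r (by linarith) (by linarith [hr.1]) (hr.2.trans hj')).trans ?_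
        have : 0 ≤ r - (S + ((j - 1 : ℕ) : ℝ) * δ n) := by linarith [hr.1]
        gcongr
        linarith [hr.2]
      · rw [abs_of_nonneg (by linarith)]; ring
    refine (norm_sum_le_of_le _ hcb).trans_eq ?_
    rw [Finset.sum_const, Finset.card_range, nsmul_eq_mul, ← hδN n]; ring
  exact le_of_tendsto hlim.norm (Eventually.of_forall hIn)

end Sewing

/-! ### Norm estimates and integrals in L² -/

section L2Tools
variable {Ω : Type*} [mΩ : MeasurableSpace Ω] {P : Measure Ω} {d : ℕ}

/-- Square integrable random vectors. -/
abbrev L2 (d : ℕ) (P : Measure Ω) : Type _ := Lp (Vec d) 2 P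

lemma L2.norm_sq_eq {F : Type*} [NormedAddCommGroup F] [InnerProductSpace ℝ F] (x : Lp F 2 P) :
    ‖x‖ ^ 2 = ∫ ω, ‖x ω‖ ^ 2 ∂P := by
  rw [← real_inner_self_eq_norm_sq, L2.inner_def]
  simp_rw [real_inner_self_eq_norm_sq]

lemma L2.norm_le_of_ae_le {x y : L2 d P} {C : ℝ} (h : ∀ᵐ ω ∂P, ‖x ω‖ ≤ C * ‖y ω‖) :
    ‖x‖ ≤ C * ‖y‖ := Lp.norm_le_mul_norm_of_ae_le_mul h

lemma L2.norm_le_add_of_ae_le {x w : L2 d P} {f : Ω → ℝ} {C₁ C₂ B : ℝ} (hC₁ : 0 ≤ C₁)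
    (hC₂ : 0 ≤ C₂) (hf : AEStronglyMeasurable f P) (hB0 : 0 ≤ B) (hB : eLpNorm f 2 P ≤ ENNReal.ofReal B)
    (h : ∀ᵐ ω ∂P, ‖x ω‖ ≤ C₁ * f ω + C₂ * ‖w ω‖) : ‖x‖ ≤ C₁ * B + C₂ * ‖w‖ := by
  have e1 : eLpNorm x 2 P ≤ eLpNorm (fun ω => C₁ * f ω + C₂ * ‖w ω‖) 2 P := by
    refine eLpNorm_mono_ae (h.mono fun ω hω => hω.trans (le_abs_self _))
  have e2 : eLpNorm (fun ω => C₁ * f ω + C₂ * ‖w ω‖) 2 P ≤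
      eLpNorm (fun ω => C₁ * f ω) 2 P + eLpNorm (fun ω => C₂ * ‖w ω‖) 2 P :=
    eLpNorm_add_le (hf.const_mul _) ((Lp.aestronglyMeasurable w).norm.const_mul _) (by norm_num)
  have e3 : eLpNorm (fun ω => C₁ * f ω) 2 P ≤ ENNReal.ofReal (C₁ * B) := by
    have := eLpNorm_const_smul (μ := P) (p := 2) C₁ f
    simp only [Pi.smul_def, smul_eq_mul] at this
    rw [this, Real.enorm_of_nonneg hC₁, ENNReal.ofReal_mul hC₁]
    gcongr
  have e4 : eLpNorm (fun ω => C₂ * ‖w ω‖) 2 P = ENNReal.ofReal (C₂ * ‖w‖) := by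
    have := eLpNorm_const_smul (μ := P) (p := 2) C₂ (fun ω => ‖w ω‖)
    simp only [Pi.smul_def, smul_eq_mul] at this
    rw [this, Real.enorm_of_nonneg hC₂, eLpNorm_norm, ENNReal.ofReal_mul hC₂, Lp.norm_def,
      ENNReal.ofReal_toReal (Lp.eLpNorm_ne_top w)]
  have e5 : eLpNorm x 2 P ≤ ENNReal.ofReal (C₁ * B + C₂ * ‖w‖) := by
    rw [ENNReal.ofReal_add (by positivity) (by positivity), ← e4]
    exact e1.trans (e2.trans (by gcongr))
  rw [Lp.norm_def]
  exact ENNReal.toReal_le_of_le_ofReal (by positivity) e5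

lemma L2.norm_le_of_ae_bound [IsProbabilityMeasure P] {x : L2 d P} {C : ℝ} (hC : 0 ≤ C)
    (h : ∀ᵐ ω ∂P, ‖x ω‖ ≤ C) : ‖x‖ ≤ C := by
  have := Lp.norm_le_of_ae_bound hC h
  simpa [measureUnivNNReal] using this

/-- Pointwise domination by a power, in `L²` over a finite measure. -/
lemma L2.norm_le_rpow [IsFiniteMeasure P] {x y : L2 d P} {K α : ℝ} (hK : 0 ≤ K) (h0 : 0 < α)
    (h1 : α ≤ 1) (h : ∀ᵐ ω ∂P, ‖x ω‖ ≤ K * ‖y ω‖ ^ α) :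
    ‖x‖ ≤ K * (P.real Set.univ ^ ((1 - α) / 2) * ‖y‖ ^ α) := by
  have e1 : eLpNorm x 2 P ≤ ENNReal.ofReal K * eLpNorm (fun ω => ‖y ω‖ ^ α) 2 P := by
    refine eLpNorm_le_mul_eLpNorm_of_ae_le_mul (h.mono fun ω hω => ?_) 2
    rwa [Real.norm_of_nonneg (by positivity)]
  rw [eLpNorm_norm_rpow _ h0] at e1
  have hle : (2 : ENNReal) * ENNReal.ofReal α ≤ 2 := by
    have : ENNReal.ofReal α ≤ 1 := by simpa using h1
    calc (2 : ENNReal) * ENNReal.ofReal α ≤ 2 * 1 := by gcongr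
      _ = 2 := mul_one _
  have e2 := eLpNorm_le_eLpNorm_mul_rpow_measure_univ (μ := P) (f := y) hle
    (Lp.aestronglyMeasurable y)
  have e3 : eLpNorm x 2 P ≤ ENNReal.ofReal K *
      (eLpNorm y 2 P * P Set.univ ^ (1 / ((2 : ENNReal) * ENNReal.ofReal α).toReal -
        1 / (2 : ENNReal).toReal)) ^ α := by
    refine e1.trans ?_
    gcongr
  have hexp : (0 : ℝ) ≤ 1 / ((2 : ENNReal) * ENNReal.ofReal α).toReal - 1 / (2 : ENNReal).toReal := by
    rw [ENNReal.toReal_mul, ENNReal.toReal_ofReal h0.le, ENNReal.toReal_ofNat, sub_nonneg]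
    exact one_div_le_one_div_of_le (by positivity) (by linarith)
  have hfin : ENNReal.ofReal K *
      (eLpNorm y 2 P * P Set.univ ^ (1 / ((2 : ENNReal) * ENNReal.ofReal α).toReal -
        1 / (2 : ENNReal).toReal)) ^ α ≠ ⊤ := by
    refine ENNReal.mul_ne_top ENNReal.ofReal_ne_top (ENNReal.rpow_ne_top_of_nonneg h0.le
      (ENNReal.mul_ne_top (Lp.eLpNorm_ne_top y)
        (ENNReal.rpow_ne_top_of_nonneg hexp (measure_ne_top P _))))
  have e4 := ENNReal.toReal_mono hfin e3
  rw [← Lp.norm_def, ENNReal.toReal_mul, ENNReal.toReal_ofReal hK, ← ENNReal.toReal_rpow,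
    ENNReal.toReal_mul, ← Lp.norm_def, ← ENNReal.toReal_rpow, Real.mul_rpow (norm_nonneg _)
    (by positivity), ← Real.rpow_mul (by positivity)] at e4
  refine e4.trans_eq ?_
  have : (1 / ((2 : ENNReal) * ENNReal.ofReal α).toReal - 1 / (2 : ENNReal).toReal) * α =
      (1 - α) / 2 := by
    rw [ENNReal.toReal_mul, ENNReal.toReal_ofReal h0.le, ENNReal.toReal_ofNat]
    field_simp
  rw [this, Measure.real]; ring

/-- Bounded path-continuous processes are continuous in `L²`. -/
lemma L2.continuous_toLp [IsProbabilityMeasure P] {F : ℝ → Ω → Vec d}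
    (hm : ∀ r, AEStronglyMeasurable (F r) P) {M : ℝ} (hM : ∀ r ω, ‖F r ω‖ ≤ M)
    (hc : ∀ ω, Continuous fun r => F r ω) {G : ℝ → L2 d P} (hG : ∀ r, G r =ᵐ[P] F r) :
    Continuous G := by
  rw [continuous_iff_continuousAt]
  intro s
  rw [ContinuousAt, tendsto_iff_norm_sub_tendsto_zero]
  have e : ∀ r, ‖G r - G s‖ ^ 2 = ∫ ω, ‖F r ω - F s ω‖ ^ 2 ∂P := fun r => by
    rw [L2.norm_sq_eq]
    refine integral_congr_ae ?_
    filter_upwards [Lp.coeFn_sub (G r) (G s), hG r, hG s] with ω h1 h2 h3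
    rw [h1, Pi.sub_apply, h2, h3]
  have h0 : Tendsto (fun r => ∫ ω, ‖F r ω - F s ω‖ ^ 2 ∂P) (𝓝 s) (𝓝 (∫ _ : Ω, (0 : ℝ) ∂P)) := by
    refine tendsto_integral_filter_of_dominated_convergence (fun _ => (M + M) ^ 2)
      (Eventually.of_forall fun r => ?_) (Eventually.of_forall fun r => ae_of_all _ fun ω => ?_)
      (integrable_const _) (ae_of_all _ fun ω => ?_)
    · exact (((hm r).sub (hm s)).norm).pow 2
    · rw [Real.norm_of_nonneg (sq_nonneg _)]
      exact pow_le_pow_left₀ (norm_nonneg _) ((norm_sub_le _ _).trans (add_le_add (hM _ _) (hM _ _))) 2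
    · have : Continuous fun r => ‖F r ω - F s ω‖ ^ 2 := by
        have := hc ω
        fun_prop
      simpa using this.tendsto s
  simp only [integral_zero] at h0
  have := h0.sqrt
  rw [Real.sqrt_zero] at this
  refine this.congr fun r => ?_
  rw [← e, Real.sqrt_sq (norm_nonneg _)]

/-- The Bochner integral in `L²` is the pathwise integral. -/
lemma L2.intervalIntegral_ae_eq {F : Type*} [NormedAddCommGroup F] [InnerProductSpace ℝ F]
    [CompleteSpace F] {μ : Measure Ω} [IsFiniteMeasure μ]
    {a c : ℝ} (hac : a ≤ c) {Y : ℝ → Ω → F}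
    (hY : AEStronglyMeasurable (Function.uncurry Y) ((volume.restrict (Set.Ioc a c)).prod μ))
    {y : ℝ → Lp F 2 μ} (hy : ContinuousOn y (Set.Icc a c)) (hyY : ∀ r ∈ Set.Icc a c, y r =ᵐ[μ] Y r) :
    (∫ r in a..c, y r : Lp F 2 μ) =ᵐ[μ] fun ω => ∫ r in a..c, Y r ω := by
  have hyi : IntervalIntegrable y volume a c := (by
    rw [← Set.uIcc_of_le hac] at hy; exact hy.intervalIntegrable)
  obtain ⟨M, hM⟩ := isCompact_Icc.exists_bound_of_continuousOn hy
  have hYi : ∀ r ∈ Set.Icc a c, Integrable (Y r) μ := fun r hr =>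
    (((Lp.memLp (y r)).integrable (by norm_num)).congr (hyY r hr))
  have hint : Integrable (Function.uncurry Y) ((volume.restrict (Set.Ioc a c)).prod μ) := by
    rw [integrable_prod_iff hY]
    constructor
    · filter_upwards [ae_restrict_mem measurableSet_Ioc] with r hr
      exact hYi r (Set.Ioc_subset_Icc_self hr)
    · refine Integrable.of_bound (C := μ.real Set.univ ^ (1 / 2 : ℝ) * M)
        hY.norm.integral_prod_right' ?_
      filter_upwards [ae_restrict_mem measurableSet_Ioc] with r hr
      have hr' := Set.Ioc_subset_Icc_self hr
      have h2 : MemLp (fun ω => ‖y r ω‖) (ENNReal.ofReal 2) μ := by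
        simpa using (Lp.memLp (y r)).norm
      have hcs := integral_mul_le_Lp_mul_Lq_of_nonneg (μ := μ)
        Real.HolderConjugate.two_two (f := fun _ => (1 : ℝ)) (g := fun ω => ‖y r ω‖)
        (ae_of_all _ fun _ => zero_le_one) (ae_of_all _ fun _ => norm_nonneg _)
        (memLp_const 1) h2
      rw [Real.norm_of_nonneg (integral_nonneg fun _ => norm_nonneg _)]
      have e : ∫ ω, ‖Function.uncurry Y (r, ω)‖ ∂μ = ∫ ω, 1 * ‖y r ω‖ ∂μ :=
        integral_congr_ae ((hyY r hr').mono fun ω h => by simp [h])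
      rw [e]
      refine hcs.trans ?_
      simp only [integral_const, smul_eq_mul, Real.rpow_two, one_pow, mul_one]
      rw [← L2.norm_sq_eq, ← Real.sqrt_eq_rpow (‖y r‖ ^ 2), Real.sqrt_sq (norm_nonneg _)]
      gcongr
      exact hM r hr'
  have hsec : Integrable (fun ω => ∫ r in a..c, Y r ω) μ := by
    simp_rw [intervalIntegral.integral_of_le hac]
    exact hint.integral_prod_right
  -- Both sides are tested against an indicator times a fixed vector. The test is a continuous
  -- functional, hence commutes with the Bochner integral, and Fubini's theorem treats the pathwise
  -- integral.
  refine Integrable.ae_eq_of_forall_setIntegral_eq _ _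
    ((Lp.memLp (∫ r in a..c, y r)).integrable (by norm_num)) hsec fun s hs hμs => ?_
  refine ext_inner_left ℝ fun v => ?_
  rw [← L2.inner_indicatorConstLp_eq_inner_setIntegral ℝ hs hμs.ne v]
  have h1 := (innerSL ℝ (indicatorConstLp 2 hs hμs.ne v)).intervalIntegral_comp_comm hyi
  simp only [innerSL_apply_apply] at h1
  rw [← h1]
  have h2 : ∀ r ∈ Set.uIcc a c, inner ℝ (indicatorConstLp 2 hs hμs.ne v) (y r) =
      inner ℝ v (∫ ω in s, Y r ω ∂μ) := fun r hr => by
    rw [Set.uIcc_of_le hac] at hr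
    rw [L2.inner_indicatorConstLp_eq_inner_setIntegral,
      setIntegral_congr_ae hs ((hyY r hr).mono fun ω h _ => h)]
  rw [intervalIntegral.integral_congr h2]
  have hint' : Integrable (Function.uncurry Y)
      ((volume.restrict (Set.Ioc a c)).prod (μ.restrict s)) := by
    refine hint.mono_measure ?_
    exact Measure.prod_mono le_rfl Measure.restrict_le_self
  have hsw := integral_integral_swap (f := Y) hint'
  simp_rw [intervalIntegral.integral_of_le hac]
  rw [← hsw]
  exact integral_inner hint'.integral_prod_left v

end L2Tools

/-! ### Conditional expectations as projections, localised to events -/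

section CondExp
variable {Ω : Type*} [mΩ : MeasurableSpace Ω] {P : Measure Ω} {d : ℕ}

/-- Conditional expectation given `ℱ u`, as an operator on `L²`. -/
def condL2 (P : Measure Ω) (ℱ : Filtration ℝ mΩ) (u : ℝ) : L2 d P →L[ℝ] L2 d P :=
  (lpMeas (Vec d) ℝ (ℱ u) 2 P).subtypeL ∘L condExpL2 (Vec d) ℝ (ℱ.le u)

variable {ℱ : Filtration ℝ mΩ}

lemma aestronglyMeasurable_condL2 (u : ℝ) (x : L2 d P) :
    AEStronglyMeasurable[ℱ u] (condL2 P ℱ u x) P :=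
  lpMeas.aestronglyMeasurable _

lemma condL2_eq_self {u : ℝ} {x : L2 d P} (h : AEStronglyMeasurable[ℱ u] x P) :
    condL2 P ℱ u x = x := by
  have hx : x ∈ lpMeas (Vec d) ℝ (ℱ u) 2 P := mem_lpMeas_iff_aestronglyMeasurable.2 h
  have : Fact (ℱ u ≤ mΩ) := ⟨ℱ.le u⟩
  have := Submodule.orthogonalProjectionOnto_mem_subspace_eq_self
    (K := lpMeas (Vec d) ℝ (ℱ u) 2 P) ⟨x, hx⟩
  change ((condExpL2 (Vec d) ℝ (ℱ.le u) x : lpMeas (Vec d) ℝ (ℱ u) 2 P) : L2 d P) = x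
  rw [condExpL2, this]

lemma condL2_eq_self_iff {u : ℝ} {x : L2 d P} :
    condL2 P ℱ u x = x ↔ AEStronglyMeasurable[ℱ u] x P :=
  ⟨fun h => h ▸ aestronglyMeasurable_condL2 u x, condL2_eq_self⟩

lemma isProjFamily_condL2 : IsProjFamily (condL2 (d := d) P ℱ) := by
  have ge : ∀ u v (x : L2 d P), u ≤ v → condL2 P ℱ v (condL2 P ℱ u x) = condL2 P ℱ u x :=
    fun u v x h => condL2_eq_self ((aestronglyMeasurable_condL2 u x).mono (ℱ.mono h))
  have symm : ∀ u (x y : L2 d P), inner ℝ (condL2 P ℱ u x) y = inner ℝ x (condL2 P ℱ u y) :=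
    fun u x y => inner_condExpL2_left_eq_right (ℱ.le u)
  refine ⟨fun u x => norm_condExpL2_le (ℱ.le u) x, fun u v x h => ?_, ge, symm⟩
  -- E_u E_v = E_u is the adjoint of E_v E_u = E_u.
  refine ext_inner_right ℝ fun y => ?_
  rw [symm, symm, ge _ _ _ h, symm]

lemma condL2_ae_eq_condExp [IsFiniteMeasure P] (u : ℝ) (x : L2 d P) : condL2 P ℱ u x =ᵐ[P] P[x | ℱ u] := by
  have h := (Lp.memLp x).condExpL2_ae_eq_condExp (𝕜 := ℝ) (ℱ.le u)
  rwa [Lp.toLp_coeFn] at h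

/-- The restriction to an event. -/
def restrL2 (A : Set Ω) : L2 d P →L[ℝ] L2 d (P.restrict A) :=
  LpToLpRestrictCLM Ω (Vec d) ℝ P 2 A

lemma restrL2_ae_eq (A : Set Ω) (x : L2 d P) : restrL2 A x =ᵐ[P.restrict A] x :=
  LpToLpRestrictCLM_coeFn ℝ A x

/-- The truncation to an event. -/
def indL2 {A : Set Ω} (hA : MeasurableSet A) (x : L2 d P) : L2 d P :=
  ((Lp.memLp x).indicator hA).toLp _

lemma indL2_ae_eq {A : Set Ω} (hA : MeasurableSet A) (x : L2 d P) :
    indL2 hA x =ᵐ[P] A.indicator x := MemLp.coeFn_toLp _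

/-- Restriction is a continuous linear map, convenient for Bochner integrals; truncation stays in
L²(P), where conditional expectations act. The equality of norms allows switching between the two.
-/
lemma norm_indL2 {A : Set Ω} (hA : MeasurableSet A) (x : L2 d P) :
    ‖indL2 hA x‖ = ‖restrL2 A x‖ := by
  rw [Lp.norm_def, Lp.norm_def, eLpNorm_congr_ae (restrL2_ae_eq A x),
    eLpNorm_congr_ae (indL2_ae_eq hA x), eLpNorm_indicator_eq_eLpNorm_restrict hA]

lemma indL2_sub {A : Set Ω} (hA : MeasurableSet A) (x y : L2 d P) :
    indL2 hA (x - y) = indL2 hA x - indL2 hA y := by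
  ext1
  filter_upwards [indL2_ae_eq hA (x - y), indL2_ae_eq hA x, indL2_ae_eq hA y, Lp.coeFn_sub x y,
    Lp.coeFn_sub (indL2 hA x) (indL2 hA y)] with ω h1 h2 h3 h4 h5
  rw [h1, h5, Pi.sub_apply, h2, h3]
  by_cases h : ω ∈ A
  · simp only [Set.indicator_of_mem h, h4, Pi.sub_apply]
  · simp only [Set.indicator_of_notMem h, sub_zero]

variable [IsProbabilityMeasure P]

lemma condL2_indL2 {u : ℝ} {A : Set Ω} (hA : MeasurableSet[ℱ u] A) (x : L2 d P) :
    condL2 P ℱ u (indL2 (ℱ.le u A hA) x) = indL2 (ℱ.le u A hA) (condL2 P ℱ u x) := by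
  ext1
  have h1 := condL2_ae_eq_condExp (ℱ := ℱ) u (indL2 (ℱ.le u A hA) x)
  have h2 := condExp_congr_ae (m := ℱ u) (indL2_ae_eq (ℱ.le u A hA) x)
  have h3 := condExp_indicator (μ := P) ((Lp.memLp x).integrable (by norm_num)) hA
  filter_upwards [h1, h2, h3, condL2_ae_eq_condExp (ℱ := ℱ) u x,
    indL2_ae_eq (ℱ.le u A hA) (condL2 P ℱ u x)] with ω a1 a2 a3 a4 a5
  rw [a1, a2, a3, a5]
  by_cases h : ω ∈ A <;> simp [h, a4]

/-- Events of ℱ u also belong to ℱ v, so truncation commutes with the projection, which is a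
contraction. -/
lemma norm_restrL2_condL2_le {u v : ℝ} (huv : u ≤ v) {A : Set Ω} (hA : MeasurableSet[ℱ u] A)
    (x : L2 d P) : ‖restrL2 A (condL2 P ℱ v x)‖ ≤ ‖restrL2 A x‖ := by
  have hA' : MeasurableSet[ℱ v] A := ℱ.mono huv A hA
  rw [← norm_indL2 (ℱ.le v A hA'), ← condL2_indL2 hA', ← norm_indL2 (ℱ.le v A hA')]
  exact isProjFamily_condL2.norm_le _ _

lemma norm_sub_apply_le {K : Type*} [NormedAddCommGroup K] [InnerProductSpace ℝ K]
    {E : ℝ → K →L[ℝ] K} (hE : IsProjFamily E) (u : ℝ) (x : K) : ‖x - E u x‖ ≤ ‖x‖ := by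
  have h1 : inner ℝ (x - E u x) (E u x) = 0 := by
    rw [inner_sub_left, hE.symm, hE.comp_of_le _ _ _ le_rfl, sub_self]
  have h2 : ‖x‖ ^ 2 = ‖x - E u x‖ ^ 2 + ‖E u x‖ ^ 2 := by
    have := norm_add_sq_real (x - E u x) (E u x)
    rw [h1, sub_add_cancel] at this; linarith
  exact (pow_le_pow_iff_left₀ (norm_nonneg _) (norm_nonneg _) two_ne_zero).1
    (by nlinarith [sq_nonneg ‖E u x‖])

/-- The conditional expectation is the best approximation, locally on events of `ℱ u`. -/
lemma norm_restrL2_sub_condL2_le {u : ℝ} {A : Set Ω} (hA : MeasurableSet[ℱ u] A)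
    (x y : L2 d P) (hy : condL2 P ℱ u y = y) :
    ‖restrL2 A (x - condL2 P ℱ u x)‖ ≤ ‖restrL2 A (x - y)‖ := by
  have hA' := ℱ.le u A hA
  have e : indL2 hA' (x - condL2 P ℱ u x) =
      indL2 hA' (x - y) - condL2 P ℱ u (indL2 hA' (x - y)) := by
    rw [condL2_indL2 hA, ← indL2_sub]
    congr 1
    rw [map_sub, hy]; abel
  rw [← norm_indL2 hA', ← norm_indL2 hA', e]
  exact norm_sub_apply_le isProjFamily_condL2 u _

/-- A conditional `L²` bound on `a` given `ℱ u` bounds the product of `a` with any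
`ℱ u`-measurable vector. -/
lemma lintegral_mul_le_of_restrL2 {u : ℝ} {a z : L2 d P} {C : ℝ} (hC : 0 ≤ C)
    (ha : ∀ A, MeasurableSet[ℱ u] A → ‖restrL2 A a‖ ≤ C * Real.sqrt (P.real A))
    (hz : AEStronglyMeasurable[ℱ u] z P) :
    eLpNorm (fun ω => ‖z ω‖ * ‖a ω‖) 2 P ≤ ENNReal.ofReal (C * ‖z‖) := by
  set z' : Ω → Vec d := hz.mk z
  have hz'm : StronglyMeasurable[ℱ u] z' := hz.stronglyMeasurable_mk
  have hzz' : z =ᵐ[P] z' := hz.ae_eq_mk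
  have hzm : Measurable[ℱ u] (fun ω => ‖z' ω‖ₑ ^ (2 : ℝ)) :=
    (by fun_prop : Measurable fun v : Vec d => ‖v‖ₑ ^ (2 : ℝ)).comp hz'm.measurable
  set a' : Ω → Vec d := (Lp.aestronglyMeasurable a).mk a
  have ha'm : StronglyMeasurable a' := (Lp.aestronglyMeasurable a).stronglyMeasurable_mk
  have haa' : a =ᵐ[P] a' := (Lp.aestronglyMeasurable a).ae_eq_mk
  have sq : ∀ {F : Type _} [NormedAddCommGroup F] (f : Ω → F) (μ : Measure Ω),
      eLpNorm f 2 μ ^ (2 : ℝ) = ∫⁻ ω, ‖f ω‖ₑ ^ (2 : ℝ) ∂μ := by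
    intro F _ f μ
    rw [eLpNorm_eq_lintegral_rpow_enorm_toReal (by norm_num) (by norm_num), ENNReal.toReal_ofNat,
      ← ENNReal.rpow_mul]
    norm_num
  set ν : Measure Ω := P.withDensity (fun ω => ‖a' ω‖ₑ ^ (2 : ℝ))
  have hdm : Measurable (fun ω => ‖a' ω‖ₑ ^ (2 : ℝ)) := ha'm.measurable.enorm.pow_const _
  -- Read on all events of ℱ u, the hypothesis says that on ℱ u the measure ‖a‖² P is dominated by
  -- C² P. Since z is ℱ u-measurable, ‖z‖² may be integrated against this inequality.
  have hν : ν.trim (ℱ.le u) ≤ ENNReal.ofReal (C ^ 2) • P.trim (ℱ.le u) := by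
    refine Measure.le_iff.2 fun A hA => ?_
    have hA' := ℱ.le u A hA
    rw [trim_measurableSet_eq _ hA, Measure.smul_apply, trim_measurableSet_eq _ hA,
      withDensity_apply _ hA', smul_eq_mul, ← sq, ← eLpNorm_congr_ae (ae_restrict_of_ae haa'),
      ← eLpNorm_congr_ae (restrL2_ae_eq A a)]
    have h1 := ha A hA
    rw [Lp.norm_def] at h1
    have h2 : eLpNorm (restrL2 A a) 2 (P.restrict A) ≤ ENNReal.ofReal (C * Real.sqrt (P.real A)) :=
      (ENNReal.le_ofReal_iff_toReal_le (Lp.eLpNorm_ne_top _) (by positivity)).2 h1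
    refine (ENNReal.rpow_le_rpow h2 (by norm_num)).trans_eq ?_
    rw [ENNReal.ofReal_rpow_of_nonneg (by positivity) (by norm_num), Real.rpow_two, mul_pow,
      Real.sq_sqrt (by positivity), ENNReal.ofReal_mul (by positivity), ofReal_measureReal]
  have key : eLpNorm (fun ω => ‖z ω‖ * ‖a ω‖) 2 P ^ (2 : ℝ) ≤ ENNReal.ofReal (C * ‖z‖) ^ (2 : ℝ) := by
    rw [sq]
    calc ∫⁻ ω, ‖‖z ω‖ * ‖a ω‖‖ₑ ^ (2 : ℝ) ∂P
        = ∫⁻ ω, (‖a' ω‖ₑ ^ (2 : ℝ)) * (‖z' ω‖ₑ ^ (2 : ℝ)) ∂P := by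
          refine lintegral_congr_ae ?_
          filter_upwards [hzz', haa'] with ω h1 h2
          rw [enorm_mul, enorm_norm, enorm_norm, ENNReal.mul_rpow_of_nonneg _ _ (by norm_num),
            h1, h2, mul_comm]
      _ = ∫⁻ ω, ‖z' ω‖ₑ ^ (2 : ℝ) ∂ν := by
          rw [lintegral_withDensity_eq_lintegral_mul _ hdm
            (hzm.mono (ℱ.le u) le_rfl)]
          rfl
      _ = ∫⁻ ω, ‖z' ω‖ₑ ^ (2 : ℝ) ∂(ν.trim (ℱ.le u)) :=
          (lintegral_trim _ hzm).symm
      _ ≤ ∫⁻ ω, ‖z' ω‖ₑ ^ (2 : ℝ) ∂(ENNReal.ofReal (C ^ 2) • P.trim (ℱ.le u)) :=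
          lintegral_mono' hν le_rfl
      _ = ENNReal.ofReal (C ^ 2) * ∫⁻ ω, ‖z' ω‖ₑ ^ (2 : ℝ) ∂P := by
          rw [lintegral_smul_measure, lintegral_trim _ hzm,
            smul_eq_mul]
      _ = ENNReal.ofReal (C * ‖z‖) ^ (2 : ℝ) := by
          rw [← sq, ← eLpNorm_congr_ae hzz', ENNReal.ofReal_rpow_of_nonneg (by positivity)
            (by norm_num), Real.rpow_two, mul_pow, ENNReal.ofReal_mul (by positivity),
            Lp.norm_def, ← Real.rpow_two (eLpNorm z 2 P).toReal, ENNReal.toReal_rpow,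
            ENNReal.ofReal_toReal]
          exact ENNReal.rpow_ne_top_of_nonneg (by norm_num) (Lp.eLpNorm_ne_top z)
  exact (ENNReal.rpow_le_rpow_iff (by norm_num)).1 key

/-- Freezing: the conditional expectation of `b (Y + G)` given `ℱ u` when `Y` is `ℱ u`-measurable and
`G` is independent of `ℱ u`. -/
lemma condExp_freeze {u : ℝ} {b : Vec d → Vec d} (hb : Continuous b)
    {M : ℝ} (hM : ∀ x, ‖b x‖ ≤ M) {Y G : Ω → Vec d} (hY : Measurable[ℱ u] Y) (hG : Measurable G)
    (hind : Indep (MeasurableSpace.comap G inferInstance) (ℱ u) P) :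
    P[fun ω => b (Y ω + G ω) | ℱ u] =ᵐ[P] fun ω => ∫ y, b (Y ω + y) ∂(P.map G) := by
  have hm := ℱ.le u
  have hY' : Measurable Y := hY.mono hm le_rfl
  have : IsProbabilityMeasure (P.map G) := Measure.isProbabilityMeasure_map hG.aemeasurable
  have hsm : StronglyMeasurable fun x : Vec d => ∫ y, b (x + y) ∂(P.map G) :=
    StronglyMeasurable.integral_prod_right (f := fun x y => b (x + y))
      (Continuous.stronglyMeasurable (by fun_prop))
  have hbd : ∀ x : Vec d, ‖∫ y, b (x + y) ∂(P.map G)‖ ≤ M := fun x => by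
    have := norm_integral_le_of_norm_le_const (μ := P.map G) (f := fun y => b (x + y))
      (ae_of_all _ fun y => hM (x + y))
    simpa using this
  have hgm : StronglyMeasurable[ℱ u] fun ω => ∫ y, b (Y ω + y) ∂(P.map G) :=
    hsm.comp_measurable hY
  have hint : Integrable (fun ω => ∫ y, b (Y ω + y) ∂(P.map G)) P :=
    integrable_of_bdd (hgm.mono hm).aestronglyMeasurable fun ω => hbd _
  have hintb : Integrable (fun ω => b (Y ω + G ω)) P :=
    integrable_of_bdd (hb.measurable.comp (hY'.add hG)).aestronglyMeasurable fun ω => hM _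
  symm
  refine ae_eq_condExp_of_forall_setIntegral_eq hm hintb (fun _ _ _ => hint.integrableOn)
    (fun A hA _ => ?_) hgm.aestronglyMeasurable
  have hA' := hm A hA
  -- The test event becomes an extra coordinate next to Y. The pair is ℱ u-measurable, hence
  -- independent of G, and Fubini on the product law finishes.
  set X : Ω → ℝ × Vec d := fun ω => (A.indicator (fun _ => (1 : ℝ)) ω, Y ω)
  have hX : Measurable[ℱ u] X := (Measurable.indicator measurable_const hA).prodMk hY
  have hX' : Measurable X := hX.mono hm le_rfl
  have hXG : IndepFun X G P := by
    rw [IndepFun_iff_Indep]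
    exact (indep_of_indep_of_le_right hind hX.comap_le).symm
  have hmap := (indepFun_iff_map_prod_eq_prod_map_map hX'.aemeasurable hG.aemeasurable).1 hXG
  set F : (ℝ × Vec d) × Vec d → Vec d :=
    ({q : (ℝ × Vec d) × Vec d | q.1.1 = 1}).indicator fun q => b (q.1.2 + q.2)
  have hFm : StronglyMeasurable F := by
    refine StronglyMeasurable.indicator (Continuous.stronglyMeasurable (by fun_prop)) ?_
    exact (measurable_fst.comp measurable_fst) (measurableSet_singleton 1)
  have hFb : ∀ q, ‖F q‖ ≤ M := fun q => (norm_indicator_le_norm_self _ _).trans (hM _)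
  have hMpos : Integrable F ((P.map X).prod (P.map G)) := by
    have : IsProbabilityMeasure (P.map X) := Measure.isProbabilityMeasure_map hX'.aemeasurable
    exact integrable_of_bdd hFm.aestronglyMeasurable hFb
  have hFX : ∀ ω y, F (X ω, y) = A.indicator (fun ω => b (Y ω + y)) ω := fun ω y => by
    by_cases h : ω ∈ A <;> simp [F, X, h]
  rw [← integral_indicator hA', ← integral_indicator hA']
  have e1 : ∫ ω, A.indicator (fun ω => b (Y ω + G ω)) ω ∂P = ∫ ω, F (X ω, G ω) ∂P := by
    congr 1; ext1 ω; rw [hFX]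
    by_cases h : ω ∈ A <;> simp [h]
  have e2 : ∫ ω, F (X ω, G ω) ∂P = ∫ q, F q ∂((P.map X).prod (P.map G)) := by
    rw [← hmap, integral_map (hX'.prodMk hG).aemeasurable hFm.aestronglyMeasurable]
  rw [e1, e2, integral_prod _ hMpos, integral_map hX'.aemeasurable
    hFm.integral_prod_right'.aestronglyMeasurable]
  congr 1; ext1 ω
  simp only [hFX]
  by_cases h : ω ∈ A <;> simp [h]

end CondExp

/-! ### The superposition operator x ↦ b(z + x) -/

section Nemytskii
variable {Ω : Type*} [mΩ : MeasurableSpace Ω] {P : Measure Ω} {d : ℕ}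

/-- The superposition operator `x ↦ b (z + x)` on `L²`. -/
def nem (b : Vec d → Vec d) (z : Ω → Vec d) (x : L2 d P) : L2 d P :=
  open Classical in if h : MemLp (fun ω => b (z ω + x ω)) 2 P then h.toLp _ else 0

variable [IsProbabilityMeasure P] {ℱ : Filtration ℝ mΩ} {α K : ℝ} {b : Vec d → Vec d}

lemma BddHolder.continuous (hb : BddHolder α K b) (h0 : 0 < α) : Continuous b :=
  continuous_of_holder h0 hb.holder

lemma BddHolder.nonneg (hb : BddHolder α K b) : 0 ≤ K := (norm_nonneg _).trans (hb.bound 0)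

lemma nem_ae_eq {M : ℝ} (hbc : Continuous b) (hM : ∀ x, ‖b x‖ ≤ M) {z : Ω → Vec d}
    (hz : AEStronglyMeasurable z P) (x : L2 d P) : nem b z x =ᵐ[P] fun ω => b (z ω + x ω) := by
  have h : MemLp (fun ω => b (z ω + x ω)) 2 P :=
    MemLp.of_bound (hbc.comp_aestronglyMeasurable (hz.add (Lp.aestronglyMeasurable x))) M
      (ae_of_all _ fun _ => hM _)
  rw [nem, dif_pos h]
  exact h.coeFn_toLp

lemma norm_nem_le (hb : BddHolder α K b) (h0 : 0 < α) {z : Ω → Vec d}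
    (hz : AEStronglyMeasurable z P) (x : L2 d P) : ‖nem b z x‖ ≤ K :=
  L2.norm_le_of_ae_bound hb.nonneg
    ((nem_ae_eq (hb.continuous h0) hb.bound hz x).mono fun _ h => h ▸ hb.bound _)

lemma norm_nem_sub_nem_le {b' : Vec d → Vec d} {K' α' ε : ℝ} (hb : BddHolder α K b) (h0 : 0 < α)
    (hb' : BddHolder α' K' b') (h0' : 0 < α') (hε : 0 ≤ ε) (h : ∀ x, ‖b x - b' x‖ ≤ ε) {z : Ω → Vec d}
    (hz : AEStronglyMeasurable z P) (x : L2 d P) : ‖nem b z x - nem b' z x‖ ≤ ε := by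
  refine L2.norm_le_of_ae_bound hε ?_
  filter_upwards [nem_ae_eq (hb.continuous h0) hb.bound hz x,
    nem_ae_eq (hb'.continuous h0') hb'.bound hz x, Lp.coeFn_sub (nem b z x) (nem b' z x)]
    with ω h1 h2 h3
  rw [h3, Pi.sub_apply, h1, h2]
  exact h _

/-- The power of P(A) comes from Jensen's inequality on the event. It recombines with a bound of
size √P(A) on `g` into √P(A) again. -/
lemma norm_restrL2_nem_sub_le (hb : BddHolder α K b) (h0 : 0 < α) (h1 : α ≤ 1)
    {z z' : Ω → Vec d} (hz : AEStronglyMeasurable z P) (hz' : AEStronglyMeasurable z' P)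
    (x y g : L2 d P) (hg : ∀ᵐ ω ∂P, (z ω + x ω) - (z' ω + y ω) = g ω) (A : Set Ω) :
    ‖restrL2 A (nem b z x - nem b z' y)‖ ≤
      K * (P.real A ^ ((1 - α) / 2) * ‖restrL2 A g‖ ^ α) := by
  have key := L2.norm_le_rpow (P := P.restrict A) (x := restrL2 A (nem b z x - nem b z' y))
    (y := restrL2 A g) hb.nonneg h0 h1 ?_
  · simpa using key
  filter_upwards [restrL2_ae_eq A (nem b z x - nem b z' y), restrL2_ae_eq A g,
    ae_restrict_of_ae hg, ae_restrict_of_ae (Lp.coeFn_sub (nem b z x) (nem b z' y)),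
    ae_restrict_of_ae (nem_ae_eq (hb.continuous h0) hb.bound hz x),
    ae_restrict_of_ae (nem_ae_eq (hb.continuous h0) hb.bound hz' y)] with ω a1 a2 a3 a4 a5 a6
  rw [a1, a2, a4, Pi.sub_apply, a5, a6, ← a3]
  exact hb.holder _ _

lemma norm_nem_sub_le (hb : BddHolder α K b) (h0 : 0 < α) (h1 : α ≤ 1)
    {z z' : Ω → Vec d} (hz : AEStronglyMeasurable z P) (hz' : AEStronglyMeasurable z' P)
    (x y g : L2 d P) (hg : ∀ᵐ ω ∂P, (z ω + x ω) - (z' ω + y ω) = g ω) :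
    ‖nem b z x - nem b z' y‖ ≤ K * ‖g‖ ^ α := by
  have key := L2.norm_le_rpow (x := nem b z x - nem b z' y) (y := g) hb.nonneg h0 h1 ?_
  · simpa using key
  filter_upwards [hg, Lp.coeFn_sub (nem b z x) (nem b z' y),
    nem_ae_eq (hb.continuous h0) hb.bound hz x,
    nem_ae_eq (hb.continuous h0) hb.bound hz' y] with ω a3 a4 a5 a6
  rw [a4, Pi.sub_apply, a5, a6, ← a3]
  exact hb.holder _ _

lemma norm_nem_sub_same_le (hb : BddHolder α K b) (h0 : 0 < α) (h1 : α ≤ 1)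
    {z : Ω → Vec d} (hz : AEStronglyMeasurable z P) (x y : L2 d P) :
    ‖nem b z x - nem b z y‖ ≤ K * ‖x - y‖ ^ α :=
  norm_nem_sub_le hb h0 h1 hz hz x y (x - y) <| (Lp.coeFn_sub x y).mono fun ω h => by
    rw [h, Pi.sub_apply, add_sub_add_left_eq_sub]

lemma norm_restrL2_le_of_bound {x : L2 d P} {C : ℝ} (hC : 0 ≤ C) (h : ∀ᵐ ω ∂P, ‖x ω‖ ≤ C)
    (A : Set Ω) : ‖restrL2 A x‖ ≤ C * Real.sqrt (P.real A) := by
  have h1 : ∀ᵐ ω ∂(P.restrict A), ‖restrL2 A x ω‖ ≤ C := by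
    filter_upwards [restrL2_ae_eq A x, ae_restrict_of_ae h] with ω a1 a2
    rwa [a1]
  refine (Lp.norm_le_of_ae_bound hC h1).trans_eq ?_
  rw [Real.sqrt_eq_rpow, mul_comm]
  simp [measureUnivNNReal, Measure.real, ENNReal.coe_toNNReal_eq_toReal]

lemma aestronglyMeasurable_nem (hb : BddHolder α K b) (h0 : 0 < α) {u : ℝ} {z : Ω → Vec d}
    (hz : AEStronglyMeasurable[ℱ u] z P) {x : L2 d P} (hx : AEStronglyMeasurable[ℱ u] x P) :
    AEStronglyMeasurable[ℱ u] (nem b z x) P :=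
  ((hb.continuous h0).comp_aestronglyMeasurable (hz.add hx)).congr
    (nem_ae_eq (hb.continuous h0) hb.bound (hz.mono (ℱ.le u)) x).symm

/-- The dependence on x is Hölder uniformly in time. For fixed x, continuity in time follows from
path continuity by dominated convergence. -/
lemma continuousOn_nem (hb : BddHolder α K b) (h0 : 0 < α) (h1 : α ≤ 1) {Z : ℝ → Ω → Vec d}
    (hZm : ∀ t, Measurable (Z t)) (hZc : ∀ ω, Continuous fun t => Z t ω) {x : ℝ → L2 d P}
    {s : Set ℝ} (hx : ContinuousOn x s) : ContinuousOn (fun r => nem b (Z r) (x r)) s := by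
  intro r hr
  have hbc := hb.continuous h0
  have c1 : Continuous fun t => nem b (Z t) (x r) := by
    refine L2.continuous_toLp (F := fun t ω => b (Z t ω + x r ω)) (fun t => ?_) (M := K)
      (fun t ω => hb.bound _) (fun ω => ?_) fun t =>
        nem_ae_eq hbc hb.bound (hZm t).aestronglyMeasurable _
    · exact hbc.comp_aestronglyMeasurable
        ((hZm t).aestronglyMeasurable.add (Lp.aestronglyMeasurable _))
    · have := hZc ω
      fun_prop
  rw [ContinuousWithinAt, tendsto_iff_norm_sub_tendsto_zero]
  have l1 : Tendsto (fun t => K * ‖x t - x r‖ ^ α + ‖nem b (Z t) (x r) - nem b (Z r) (x r)‖)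
      (𝓝[s] r) (𝓝 (K * 0 ^ α + 0)) := by
    refine Tendsto.add (Tendsto.const_mul _ (Tendsto.rpow_const ?_ (Or.inr h0.le))) ?_
    · exact tendsto_iff_norm_sub_tendsto_zero.1 (hx r hr)
    · exact tendsto_iff_norm_sub_tendsto_zero.1 (c1.continuousAt.continuousWithinAt)
  rw [Real.zero_rpow h0.ne', mul_zero, add_zero] at l1
  refine squeeze_zero (fun _ => norm_nonneg _) (fun t => ?_) l1
  have e : nem b (Z t) (x t) - nem b (Z r) (x r) = (nem b (Z t) (x t) - nem b (Z t) (x r)) +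
      (nem b (Z t) (x r) - nem b (Z r) (x r)) := by abel
  rw [e]
  exact (norm_add_le _ _).trans (add_le_add_left
    (norm_nem_sub_same_le hb h0 h1 (hZm t).aestronglyMeasurable _ _) _)

end Nemytskii

/-! ### Regularisation by the conditional law of the noise -/

section SplitNoise
variable {Ω : Type*} [mΩ : MeasurableSpace Ω] {d : ℕ}

/-- A continuous adapted noise that, given the past up to time `u`, is at time `r` Gaussian with
covariance `c² (r - u)^{2H}` times the identity. -/
structure IsSplitNoise (P : Measure Ω) (ℱ : Filtration ℝ mΩ) (Z : ℝ → Ω → Vec d) (H c : ℝ) :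
    Prop where
  measurable : ∀ t, Measurable (Z t)
  adapted : ∀ t, 0 ≤ t → Measurable[ℱ t] (Z t)
  cont : ∀ ω, Continuous fun t => Z t ω
  split : ∀ u r, 0 ≤ u → u < r → r ≤ 1 → ∃ M G : Ω → Vec d, Measurable[ℱ u] M ∧ Measurable G ∧
    Z r =ᵐ[P] (fun ω => M ω + G ω) ∧ Indep (MeasurableSpace.comap G inferInstance) (ℱ u) P ∧
    P.map G = (stdGaussian (Vec d)).map (fun x => (c * (r - u) ^ H) • x)

variable {P : Measure Ω} [IsProbabilityMeasure P] {ℱ : Filtration ℝ mΩ} {Z : ℝ → Ω → Vec d}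
  {H c : ℝ}

/-- The two consequences of the independence used later: the innovation `g` has conditional second
moment of order (r - u)^(2H) given ℱ u, and integrating it out of b(Y + g) produces a Gaussian
average. -/
lemma IsSplitNoise.exists_split (hZ : IsSplitNoise P ℱ Z H c) (hc : 0 < c) {u r : ℝ} (hu : 0 ≤ u)
    (hur : u < r) (hr : r ≤ 1) : ∃ (M : Ω → Vec d) (g : L2 d P), Measurable[ℱ u] M ∧
    (∀ᵐ ω ∂P, Z r ω = M ω + g ω) ∧
    (∀ A, MeasurableSet[ℱ u] A →
      ‖restrL2 A g‖ ≤ gaussMoment d * (c * (r - u) ^ H) * Real.sqrt (P.real A)) ∧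
    ∀ b : Vec d → Vec d, Continuous b → ∀ C : ℝ, (∀ x, ‖b x‖ ≤ C) → ∀ Y : Ω → Vec d,
      Measurable[ℱ u] Y → P[fun ω => b (Y ω + g ω) | ℱ u] =ᵐ[P]
        fun ω => gaussAvg (c * (r - u) ^ H) b (Y ω) := by
  obtain ⟨M, G, hM, hG, hMG, hind, hlaw⟩ := hZ.split u r hu hur hr
  set σ := c * (r - u) ^ H
  have hσ : 0 < σ := mul_pos hc (Real.rpow_pos_of_pos (sub_pos.2 hur) _)
  have hGsq : Integrable (fun ω => ‖G ω‖ ^ 2) P ∧ ∫ ω, ‖G ω‖ ^ 2 ∂P ≤ (gaussMoment d * σ) ^ 2 := by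
    have hm : AEStronglyMeasurable (fun x : Vec d => ‖x‖ ^ 2) (P.map G) :=
      Continuous.aestronglyMeasurable (by fun_prop)
    have hmem : MemLp (fun x : Vec d => x) 2 (stdGaussian (Vec d)) :=
      IsGaussian.memLp_id (stdGaussian (Vec d)) 2 ENNReal.ofNat_ne_top
    have hsq : Integrable (fun x : Vec d => ‖x‖ ^ 2) (stdGaussian (Vec d)) :=
      (memLp_two_iff_integrable_sq_norm hmem.1).1 hmem
    have e : ∀ x : Vec d, ‖σ • x‖ ^ 2 = σ ^ 2 * ‖x‖ ^ 2 := fun x => by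
      rw [norm_smul, Real.norm_of_nonneg hσ.le, mul_pow]
    constructor
    · have : Integrable (fun x : Vec d => ‖x‖ ^ 2) (P.map G) := by
        rw [hlaw, integrable_map_measure (hlaw ▸ hm) (by fun_prop)]
        simp only [Function.comp_def, e]
        exact hsq.const_mul _
      exact (integrable_map_measure hm hG.aemeasurable).1 this
    · have : ∫ ω, ‖G ω‖ ^ 2 ∂P = ∫ x, ‖x‖ ^ 2 ∂(P.map G) :=
        (integral_map hG.aemeasurable hm).symm
      rw [this, hlaw, integral_map (by fun_prop) (hlaw ▸ hm)]
      simp only [e]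
      have hle : ∫ x : Vec d, ‖x‖ ^ 2 ∂(stdGaussian (Vec d)) ≤ gaussMoment d ^ 2 := by
        rw [gaussMoment, Real.sq_sqrt (integral_nonneg fun _ => sq_nonneg _)]
        refine integral_mono hsq integrable_one_add_norm_sq fun x => ?_
        exact pow_le_pow_left₀ (norm_nonneg x) (by linarith) 2
      rw [integral_const_mul]
      calc _ ≤ σ ^ 2 * gaussMoment d ^ 2 := by gcongr
        _ = _ := by ring
  have hGL : MemLp G 2 P :=
    (memLp_two_iff_integrable_sq_norm hG.aestronglyMeasurable).2 hGsq.1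
  have hg := hGL.coeFn_toLp
  refine ⟨M, hGL.toLp G, hM, ?_, fun A hA => ?_, fun b hb C hC Y hY => ?_⟩
  · filter_upwards [hMG, hg] with ω h1 h2
    rw [h1, h2]
  · have hA' := ℱ.le u A hA
    have hsm : StronglyMeasurable[MeasurableSpace.comap G inferInstance] (fun ω => ‖G ω‖ ^ 2) := by
      have h0 : Measurable[MeasurableSpace.comap G inferInstance] G := comap_measurable G
      exact ((by fun_prop : Measurable fun v : Vec d => ‖v‖ ^ 2).comp h0).stronglyMeasurable
    have h1 := condExp_indep_eq (μ := P) hG.comap_le (ℱ.le u) hsm hind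
    have h2 : ∫ ω in A, ‖G ω‖ ^ 2 ∂P = P.real A * ∫ ω, ‖G ω‖ ^ 2 ∂P := by
      rw [← setIntegral_condExp (ℱ.le u) hGsq.1 hA, setIntegral_congr_ae hA' (h1.mono fun ω h _ => h)]
      simp
    refine Real.le_sqrt_of_sq_le (x := ‖restrL2 A (hGL.toLp G)‖)
      (y := P.real A * (gaussMoment d * σ) ^ 2) ?_ |>.trans_eq ?_
    · rw [L2.norm_sq_eq]
      have : ∫ ω, ‖restrL2 A (hGL.toLp G) ω‖ ^ 2 ∂(P.restrict A) = ∫ ω in A, ‖G ω‖ ^ 2 ∂P := by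
        refine integral_congr_ae ?_
        filter_upwards [restrL2_ae_eq A (hGL.toLp G), ae_restrict_of_ae hg] with ω a1 a2
        rw [a1, a2]
      rw [this, h2]
      gcongr
      exact hGsq.2
    · have := one_le_gaussMoment (d := d)
      rw [Real.sqrt_mul (by positivity), Real.sqrt_sq (by positivity), mul_comm]
  · have h1 := condExp_freeze (ℱ := ℱ) hb hC hY hG hind
    have h2 : (fun ω => b (Y ω + hGL.toLp G ω)) =ᵐ[P] fun ω => b (Y ω + G ω) :=
      hg.mono fun ω h => by simp only [h]
    refine (condExp_congr_ae h2).trans (h1.trans (ae_of_all _ fun ω => ?_))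
    simp only [gaussAvg]
    rw [hlaw, integral_map (by fun_prop) (Continuous.aestronglyMeasurable (by fun_prop))]

variable {α K : ℝ} {b : Vec d → Vec d}

/-- The conditional expectation of the drift at an `ℱ u`-measurable position is a Gaussian
average. -/
lemma IsSplitNoise.exists_condL2_nem (hZ : IsSplitNoise P ℱ Z H c) (hc : 0 < c) {u r : ℝ}
    (hu : 0 ≤ u) (hur : u < r) (hr : r ≤ 1) (hb : BddHolder α K b) (h0 : 0 < α) :
    ∃ M : Ω → Vec d, ∀ x : L2 d P, AEStronglyMeasurable[ℱ u] x P →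
      condL2 P ℱ u (nem b (Z r) x) =ᵐ[P] fun ω => gaussAvg (c * (r - u) ^ H) b (M ω + x ω) := by
  obtain ⟨M, g, hM, hMg, -, hfr⟩ := hZ.exists_split hc hu hur hr
  refine ⟨M, fun x hx => ?_⟩
  have hbc := hb.continuous h0
  have hxe := hx.ae_eq_mk
  have h1 := hfr b hbc K hb.bound (fun ω => M ω + hx.mk x ω)
    (hM.add hx.stronglyMeasurable_mk.measurable)
  have h2 : nem b (Z r) x =ᵐ[P] fun ω => b (M ω + hx.mk x ω + g ω) := by
    filter_upwards [nem_ae_eq hbc hb.bound (hZ.measurable r).aestronglyMeasurable x, hMg, hxe]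
      with ω a1 a2 a3
    rw [a1, a2, ← a3]; congr 1; abel
  filter_upwards [condL2_ae_eq_condExp (ℱ := ℱ) u (nem b (Z r) x), condExp_congr_ae (m := ℱ u) h2,
    h1, hxe] with ω a1 a2 a3 a4
  rw [a1, a2, a3, a4]

/-- The gain of regularity: after conditioning, a Hölder drift acts as a Lipschitz map on ℱ
u-measurable positions. The price is (r - u)^(-H(1-α)), square integrable in r exactly when H(1 - α)
< 1/2. -/
lemma IsSplitNoise.norm_condL2_nem_sub_le (hZ : IsSplitNoise P ℱ Z H c) (hc : 0 < c) {u r : ℝ}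
    (hu : 0 ≤ u) (hur : u < r) (hr : r ≤ 1) (hb : BddHolder α K b) (h0 : 0 < α) (h1 : α ≤ 1)
    {x y : L2 d P} (hx : AEStronglyMeasurable[ℱ u] x P) (hy : AEStronglyMeasurable[ℱ u] y P) :
    ‖condL2 P ℱ u (nem b (Z r) x - nem b (Z r) y)‖ ≤
      2 * gaussMoment d * K * (c * (r - u) ^ H) ^ (α - 1) * ‖x - y‖ := by
  have hσ : 0 < c * (r - u) ^ H := mul_pos hc (Real.rpow_pos_of_pos (sub_pos.2 hur) _)
  obtain ⟨M, hM⟩ := hZ.exists_condL2_nem hc hu hur hr hb h0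
  refine L2.norm_le_of_ae_le ?_
  rw [map_sub]
  filter_upwards [hM x hx, hM y hy, Lp.coeFn_sub (condL2 P ℱ u (nem b (Z r) x))
    (condL2 P ℱ u (nem b (Z r) y)), Lp.coeFn_sub x y] with ω a1 a2 a3 a4
  rw [a3, Pi.sub_apply, a1, a2, a4, Pi.sub_apply]
  refine (norm_gaussAvg_sub_le h0 h1 hb.nonneg hb.bound hb.holder hσ _ _).trans_eq ?_
  rw [add_sub_add_left_eq_sub]

/-- The second-order term contains a product of two random norms, not controlled by their L² norms;
its size `B` is therefore left as a hypothesis, to be supplied by `lintegral_mul_le_of_restrL2`. -/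
lemma IsSplitNoise.norm_condL2_nem_four_le (hZ : IsSplitNoise P ℱ Z H c) (hc : 0 < c) {u r : ℝ}
    (hu : 0 ≤ u) (hur : u < r) (hr : r ≤ 1) (hb : BddHolder α K b) (h0 : 0 < α) (h1 : α ≤ 1)
    {x₁ y₁ x₂ y₂ : L2 d P} (hx₁ : AEStronglyMeasurable[ℱ u] x₁ P)
    (hy₁ : AEStronglyMeasurable[ℱ u] y₁ P) (hx₂ : AEStronglyMeasurable[ℱ u] x₂ P)
    (hy₂ : AEStronglyMeasurable[ℱ u] y₂ P) {B : ℝ} (hB0 : 0 ≤ B)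
    (hB : eLpNorm (fun ω => ‖(x₁ - y₁) ω‖ * ‖(x₂ - x₁) ω‖) 2 P ≤ ENNReal.ofReal B) :
    ‖condL2 P ℱ u ((nem b (Z r) x₂ - nem b (Z r) y₂) - (nem b (Z r) x₁ - nem b (Z r) y₁))‖ ≤
      16 * gaussMoment d * K * (c * (r - u) ^ H) ^ (α - 2) * B +
      2 * gaussMoment d * K * (c * (r - u) ^ H) ^ (α - 1) * ‖(x₂ - y₂) - (x₁ - y₁)‖ := by
  have hσ : 0 < c * (r - u) ^ H := mul_pos hc (Real.rpow_pos_of_pos (sub_pos.2 hur) _)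
  have hK := hb.nonneg
  have hgm := one_le_gaussMoment (d := d)
  obtain ⟨M, hM⟩ := hZ.exists_condL2_nem hc hu hur hr hb h0
  refine L2.norm_le_add_of_ae_le (f := fun ω => ‖(x₁ - y₁) ω‖ * ‖(x₂ - x₁) ω‖)
    (by positivity) (by positivity) ((Lp.aestronglyMeasurable _).norm.mul (Lp.aestronglyMeasurable _).norm) hB0 hB ?_
  rw [map_sub, map_sub, map_sub]
  filter_upwards [hM x₁ hx₁, hM y₁ hy₁, hM x₂ hx₂, hM y₂ hy₂,
    Lp.coeFn_sub (condL2 P ℱ u (nem b (Z r) x₁)) (condL2 P ℱ u (nem b (Z r) y₁)),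
    Lp.coeFn_sub (condL2 P ℱ u (nem b (Z r) x₂)) (condL2 P ℱ u (nem b (Z r) y₂)),
    Lp.coeFn_sub (condL2 P ℱ u (nem b (Z r) x₂) - condL2 P ℱ u (nem b (Z r) y₂))
      (condL2 P ℱ u (nem b (Z r) x₁) - condL2 P ℱ u (nem b (Z r) y₁)),
    Lp.coeFn_sub x₁ y₁, Lp.coeFn_sub x₂ y₂, Lp.coeFn_sub x₂ x₁,
    Lp.coeFn_sub (x₂ - y₂) (x₁ - y₁)] with ω a1 a2 a3 a4 a5 a6 a7 a8 a9 a10 a11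
  rw [a7, Pi.sub_apply, a5, a6, Pi.sub_apply, Pi.sub_apply, a1, a2, a3, a4, a11, Pi.sub_apply, a9,
    a8, a10]
  simp only [Pi.sub_apply]
  refine (norm_gaussAvg_four_le h0 h1 hb.nonneg hb.bound hb.holder hσ _ _ _ _).trans_eq ?_
  simp only [add_sub_add_left_eq_sub]

/-- Both quantities are close to b(M + E_u x), which is ℱ u-measurable and hence fixed by E_u. This
makes the germ converge to its limit. -/
lemma IsSplitNoise.norm_nem_sub_condL2_le (hZ : IsSplitNoise P ℱ Z H c) (hc : 0 < c) {u r : ℝ}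
    (hu : 0 ≤ u) (hur : u < r) (hr : r ≤ 1) (hb : BddHolder α K b) (h0 : 0 < α) (h1 : α ≤ 1)
    (x : L2 d P) :
    ‖nem b (Z r) x - condL2 P ℱ u (nem b (Z r) (condL2 P ℱ u x))‖ ≤
      K * ‖x - condL2 P ℱ u x‖ ^ α + K * (gaussMoment d * (c * (r - u) ^ H)) ^ α := by
  obtain ⟨M, g, hM, hMg, hgA, -⟩ := hZ.exists_split hc hu hur hr
  have hMm : AEStronglyMeasurable M P := (hM.mono (ℱ.le u) le_rfl).aestronglyMeasurable
  have hZm := (hZ.measurable r).aestronglyMeasurable (μ := P)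
  set E := condL2 (d := d) P ℱ u
  have hE : ∀ y : L2 d P, AEStronglyMeasurable[ℱ u] (E y) P := aestronglyMeasurable_condL2 u
  have hfix : E (nem b M (E x)) = nem b M (E x) :=
    condL2_eq_self (aestronglyMeasurable_nem hb h0 hM.aestronglyMeasurable (hE x))
  have hg : ‖g‖ ≤ gaussMoment d * (c * (r - u) ^ H) := by
    have := hgA Set.univ MeasurableSet.univ
    rw [← norm_indL2 MeasurableSet.univ] at this
    have e : indL2 MeasurableSet.univ g = g := by
      ext1; filter_upwards [indL2_ae_eq MeasurableSet.univ g] with ω h; simp [h]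
    simpa [e] using this
  have e : nem b (Z r) x - E (nem b (Z r) (E x)) = (nem b (Z r) x - nem b (Z r) (E x)) +
      ((nem b (Z r) (E x) - nem b M (E x)) - E (nem b (Z r) (E x) - nem b M (E x))) := by
    rw [map_sub, hfix]; abel
  rw [e]
  refine (norm_add_le _ _).trans (add_le_add (norm_nem_sub_same_le hb h0 h1 hZm _ _) ?_)
  refine (norm_sub_apply_le isProjFamily_condL2 u _).trans ?_
  refine (norm_nem_sub_le hb h0 h1 hZm hMm _ _ g (hMg.mono fun ω h => ?_)).trans ?_
  · rw [h]; abel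
  · have := hb.nonneg
    gcongr

end SplitNoise

/-! ### Predictability of solutions -/

section Apriori
variable {Ω : Type*} [mΩ : MeasurableSpace Ω] {d : ℕ}

/-- `φ` is the drift part of an adapted solution, seen as a path in `L²`. -/
structure IsL2Solution (P : Measure Ω) (ℱ : Filtration ℝ mΩ) (Z : ℝ → Ω → Vec d)
    (b : Vec d → Vec d) (φ : ℝ → L2 d P) : Prop where
  adapted : ∀ t ∈ Set.Icc (0 : ℝ) 1, condL2 P ℱ t (φ t) = φ t
  cont : ContinuousOn φ (Set.Icc 0 1)
  zero : φ 0 = 0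
  eqn : ∀ s t, 0 ≤ s → s ≤ t → t ≤ 1 → φ t - φ s = ∫ r in s..t, nem b (Z r) (φ r)

/-- Solutions are, conditionally on the past at time `u`, predicted up to an error of order `γ`. -/
def PredictionBound (P : Measure Ω) (ℱ : Filtration ℝ mΩ) (Z : ℝ → Ω → Vec d)
    (α K C γ : ℝ) : Prop :=
  ∀ b φ, BddHolder α K b → IsL2Solution P ℱ Z b φ → ∀ u r, 0 ≤ u → u < r → r ≤ 1 →
    ∀ A, MeasurableSet[ℱ u] A →
      ‖restrL2 A (φ r - condL2 P ℱ u (φ r))‖ ≤ C * (r - u) ^ γ * Real.sqrt (P.real A)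

variable {P : Measure Ω} [IsProbabilityMeasure P] {ℱ : Filtration ℝ mΩ} {Z : ℝ → Ω → Vec d}
  {H c α K : ℝ} {b : Vec d → Vec d} {φ : ℝ → L2 d P}

lemma norm_restrL2_nem_le (hb : BddHolder α K b) (h0 : 0 < α) {z : Ω → Vec d}
    (hz : AEStronglyMeasurable z P) (x : L2 d P) (A : Set Ω) :
    ‖restrL2 A (nem b z x)‖ ≤ K * Real.sqrt (P.real A) :=
  norm_restrL2_le_of_bound hb.nonneg
    ((nem_ae_eq (hb.continuous h0) hb.bound hz x).mono fun _ h => h ▸ hb.bound _) A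

lemma IsL2Solution.intervalIntegrable (hZ : IsSplitNoise P ℱ Z H c)
    (hb : BddHolder α K b) (h0 : 0 < α) (h1 : α ≤ 1) (hφ : IsL2Solution P ℱ Z b φ) {u r : ℝ}
    (hu : 0 ≤ u) (hur : u ≤ r) (hr : r ≤ 1) :
    IntervalIntegrable (fun v => nem b (Z v) (φ v)) volume u r :=
  intervalIntegrable_of_continuousOn
    (continuousOn_nem hb h0 h1 hZ.measurable hZ.cont hφ.cont) hu hur hr

/-- The value φ u is itself an ℱ u-measurable prediction of φ r, with error at most K (r - u), and
the conditional expectation is at least as good on every event of ℱ u. -/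
lemma predictionBound_one (hZ : IsSplitNoise P ℱ Z H c) (h0 : 0 < α) (h1 : α ≤ 1) :
    PredictionBound P ℱ Z α K K 1 := by
  intro b φ hb hφ u r hu hur hr A hA
  refine (norm_restrL2_sub_condL2_le hA (φ r) (φ u) (hφ.adapted u ⟨hu, by linarith⟩)).trans ?_
  rw [hφ.eqn u r hu hur.le hr, ← ContinuousLinearMap.intervalIntegral_comp_comm _
    (hφ.intervalIntegrable hZ hb h0 h1 hu hur.le hr)]
  refine (intervalIntegral.norm_integral_le_of_norm_le_const fun v _ =>
    norm_restrL2_nem_le hb h0 (hZ.measurable v).aestronglyMeasurable (φ v) A).trans_eq ?_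
  rw [abs_of_pos (sub_pos.2 hur), Real.rpow_one]; ring

/-- The drift at time v is predicted by b(M + E_u φ_v). The error in the argument is the innovation
of the noise plus that of φ, of order (v - u)^min(H, γ); Hölder continuity raises it to the power α
and the time integral adds one. -/
lemma predictionBound_step (hZ : IsSplitNoise P ℱ Z H c) (hc : 0 < c) (h0 : 0 < α) (h1 : α ≤ 1)
    (hH : 0 < H) {C γ : ℝ} (hC : 0 ≤ C) (hγ : 0 < γ) (h : PredictionBound P ℱ Z α K C γ) :
    PredictionBound P ℱ Z α K (K * (gaussMoment d * c + C) ^ α) (1 + α * min H γ) := by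
  intro b φ hb hφ u r hu hur hr A hA
  have hK := hb.nonneg
  have hgm := one_le_gaussMoment (d := d)
  set m := min H γ
  have hm : 0 < m := lt_min hH hγ
  have hi := hφ.intervalIntegrable hZ hb h0 h1 hu hur.le hr
  set x : ℝ → L2 d P := fun v => nem b (Z v) (φ v)
  have hiE : IntervalIntegrable (fun v => condL2 P ℱ u (x v)) volume u r :=
    (condL2 P ℱ u).integrable_comp hi.1 |> fun h => ⟨h, (condL2 P ℱ u).integrable_comp hi.2⟩
  have e : φ r - condL2 P ℱ u (φ r) = ∫ v in u..r, (x v - condL2 P ℱ u (x v)) := by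
    have e1 : φ r = φ u + ∫ v in u..r, x v := by rw [← hφ.eqn u r hu hur.le hr]; abel
    rw [e1, map_add, hφ.adapted u ⟨hu, by linarith⟩, intervalIntegral.integral_sub hi hiE,
      ContinuousLinearMap.intervalIntegral_comp_comm _ hi]
    abel
  rw [e, ← ContinuousLinearMap.intervalIntegral_comp_comm _ (hi.sub hiE)]
  have key : ∀ v ∈ Set.uIoc u r, ‖restrL2 A (x v - condL2 P ℱ u (x v))‖ ≤
      K * (gaussMoment d * c + C) ^ α * (r - u) ^ (α * m) * Real.sqrt (P.real A) := by
    intro v hv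
    rw [Set.uIoc_of_le hur.le] at hv
    have hv1 : v ≤ 1 := hv.2.trans hr
    have hvu : 0 < v - u := sub_pos.2 hv.1
    obtain ⟨M, g, hM, hMg, hgA, -⟩ := hZ.exists_split hc hu hv.1 hv1
    have hMm : AEStronglyMeasurable M P := (hM.mono (ℱ.le u) le_rfl).aestronglyMeasurable
    have hZm := (hZ.measurable v).aestronglyMeasurable (μ := P)
    have hfix : condL2 P ℱ u (nem b M (condL2 P ℱ u (φ v))) = nem b M (condL2 P ℱ u (φ v)) :=
      condL2_eq_self (aestronglyMeasurable_nem hb h0 hM.aestronglyMeasurable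
        (aestronglyMeasurable_condL2 u _))
    refine (norm_restrL2_sub_condL2_le hA _ _ hfix).trans ?_
    refine (norm_restrL2_nem_sub_le hb h0 h1 hZm hMm _ _ (g + (φ v - condL2 P ℱ u (φ v)))
      ?_ A).trans ?_
    · filter_upwards [hMg, Lp.coeFn_add g (φ v - condL2 P ℱ u (φ v)),
        Lp.coeFn_sub (φ v) (condL2 P ℱ u (φ v))] with ω a1 a2 a3
      rw [a2, Pi.add_apply, a3, Pi.sub_apply, a1]; abel
    have n1 : ‖restrL2 A (g + (φ v - condL2 P ℱ u (φ v)))‖ ≤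
        (gaussMoment d * c + C) * (r - u) ^ m * Real.sqrt (P.real A) := by
      rw [map_add]
      refine (norm_add_le _ _).trans ((add_le_add (hgA A hA) (h b φ hb hφ u v hu hv.1 hv1 A hA)).trans ?_)
      have p1 : (v - u) ^ H ≤ (r - u) ^ m :=
        (Real.rpow_le_rpow_of_exponent_ge hvu (by linarith) (min_le_left _ _)).trans
          (Real.rpow_le_rpow hvu.le (by linarith [hv.2]) hm.le)
      have p2 : (v - u) ^ γ ≤ (r - u) ^ m :=
        (Real.rpow_le_rpow_of_exponent_ge hvu (by linarith) (min_le_right _ _)).trans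
          (Real.rpow_le_rpow hvu.le (by linarith [hv.2]) hm.le)
      calc _ ≤ gaussMoment d * (c * (r - u) ^ m) * Real.sqrt (P.real A) +
            C * (r - u) ^ m * Real.sqrt (P.real A) := by gcongr
        _ = _ := by ring
    have hru : 0 < r - u := sub_pos.2 hur
    -- An event of measure zero is treated apart, because the addition rule for real powers is used
    -- for a positive base.
    have p3 : P.real A ^ ((1 - α) / 2) * Real.sqrt (P.real A) ^ α = Real.sqrt (P.real A) := by
      rcases eq_or_ne (P.real A) 0 with h0' | h0'
      · rw [h0', Real.sqrt_zero, Real.zero_rpow h0.ne', mul_zero]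
      · have : 0 < P.real A := lt_of_le_of_ne measureReal_nonneg (Ne.symm h0')
        rw [Real.sqrt_eq_rpow, ← Real.rpow_mul this.le, ← Real.rpow_add this]
        congr 1; ring
    calc K * (P.real A ^ ((1 - α) / 2) * ‖restrL2 A (g + (φ v - condL2 P ℱ u (φ v)))‖ ^ α)
        ≤ K * (P.real A ^ ((1 - α) / 2) *
          ((gaussMoment d * c + C) * (r - u) ^ m * Real.sqrt (P.real A)) ^ α) := by gcongr
      _ = K * (gaussMoment d * c + C) ^ α * ((r - u) ^ m) ^ α *
          (P.real A ^ ((1 - α) / 2) * Real.sqrt (P.real A) ^ α) := by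
          rw [Real.mul_rpow (by positivity) (by positivity),
            Real.mul_rpow (by positivity) (by positivity)]
          ring
      _ = _ := by rw [p3, ← Real.rpow_mul hru.le, mul_comm m α]
  refine (intervalIntegral.norm_integral_le_of_norm_le_const key).trans_eq ?_
  have hru : 0 < r - u := sub_pos.2 hur
  rw [abs_of_pos hru, Real.rpow_add hru, Real.rpow_one]; ring

/-- The exponents obtained by iterating the prediction bound. -/
def predExp (α H : ℝ) : ℕ → ℝ
  | 0 => 1
  | n + 1 => 1 + α * min H (predExp α H n)

lemma predExp_pos (h0 : 0 < α) (hH : 0 < H) (n : ℕ) : 0 < predExp α H n := by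
  induction n with
  | zero => simp [predExp]
  | succ n ih =>
    have : 0 < min H (predExp α H n) := lt_min hH ih
    simp only [predExp]; positivity

/-- The exponents follow the geometric sums of α until they reach H, and are then at least 1 + αH.
Both limits work: 1 + αH > H(2 - α) is 2H(1 - α) < 1, and 1/(1 - α) > H(2 - α) follows from H(1 - α)
< 1/2 and 2 - α < 2. -/
lemma exists_lt_predExp (h0 : 0 < α) (h1 : α < 1) (hH : 0 < H) (hp : H * (1 - α) < 1 / 2) :
    ∃ n, H * (2 - α) < predExp α H n := by
  have hlow : ∀ n, min (1 + α * H) (∑ i ∈ Finset.range (n + 1), α ^ i) ≤ predExp α H n := by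
    intro n
    induction n with
    | zero => simp [predExp]
    | succ n ih =>
      have hs : ∑ i ∈ Finset.range (n + 1 + 1), α ^ i =
          1 + α * ∑ i ∈ Finset.range (n + 1), α ^ i := by
        rw [Finset.sum_range_succ', Finset.mul_sum]
        simp only [pow_succ, pow_zero]
        rw [add_comm]; congr 1
        exact Finset.sum_congr rfl fun i _ => by ring
      rw [hs, predExp]
      set s := ∑ i ∈ Finset.range (n + 1), α ^ i
      rcases le_total H (predExp α H n) with h | h
      · rw [min_eq_left h]; exact min_le_left _ _
      · rw [min_eq_right h]
        rcases min_choice (1 + α * H) s with h' | h'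
        · rw [h'] at ih
          refine (min_le_left _ _).trans ?_
          have : H ≤ predExp α H n := by nlinarith
          nlinarith
        · rw [h'] at ih
          refine (min_le_right _ _).trans ?_
          nlinarith
  have hlim : Tendsto (fun n => ∑ i ∈ Finset.range (n + 1), α ^ i) atTop (𝓝 (1 - α)⁻¹) :=
    ((hasSum_geometric_of_lt_one h0.le h1).tendsto_sum_nat).comp (tendsto_add_atTop_nat 1)
  have hgt : H * (2 - α) < (1 - α)⁻¹ := by
    have h2 : 0 < 1 - α := by linarith
    rw [lt_inv_comm₀ (by nlinarith) h2, inv_eq_one_div, lt_div_iff₀ (by nlinarith)]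
    nlinarith
  obtain ⟨n, hn⟩ := (hlim.eventually (lt_mem_nhds hgt)).exists
  exact ⟨n, (lt_min (by nlinarith) hn).trans_le (hlow n)⟩

lemma exists_predictionBound (hZ : IsSplitNoise P ℱ Z H c) (hc : 0 < c) (h0 : 0 < α) (h1 : α < 1)
    (hH : 0 < H) (hp : H * (1 - α) < 1 / 2) (hK : 0 ≤ K) :
    ∃ C γ : ℝ, 0 ≤ C ∧ H * (2 - α) < γ ∧ PredictionBound P ℱ Z α K C γ := by
  obtain ⟨n, hn⟩ := exists_lt_predExp h0 h1 hH hp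
  suffices h : ∀ n, ∃ C, 0 ≤ C ∧ PredictionBound P ℱ Z α K C (predExp α H n) by
    obtain ⟨C, hC, h⟩ := h n
    exact ⟨C, _, hC, hn, h⟩
  intro n
  have hgm := one_le_gaussMoment (d := d)
  induction n with
  | zero => exact ⟨K, hK, predictionBound_one hZ h0 h1.le⟩
  | succ n ih =>
    obtain ⟨C, hC, h⟩ := ih
    exact ⟨_, by positivity, predictionBound_step hZ hc h0 h1.le hH hC (predExp_pos h0 hH n) h⟩

end Apriori

/-! ### Stability of solutions with respect to the drift -/

/-- Stability on a short time interval. -/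
lemma norm_sub_le_of_short {F : Type*} [NormedAddCommGroup F] {K D τ S T e p : ℝ} (hK : 0 ≤ K)
    {z : ℝ → F} (hD : 0 ≤ D)
    (hp : p < 1 / 2) (he : 0 ≤ e) (hST : T ≤ S + τ) (hτ : D * τ ^ (1 / 2 - p) ≤ 1 / 4)
    (hτ1 : τ ≤ 1)
    (hL : ∀ u r, S ≤ u → u < r → r ≤ T → ‖z r - z u‖ ≤ 2 * K * (r - u))
    (h : ∀ m q : ℝ, 0 ≤ m → 0 ≤ q → (∀ r, S ≤ r → r ≤ T → ‖z r‖ ≤ m) →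
      (∀ u r, S ≤ u → u < r → r ≤ T → ‖z r - z u‖ ≤ q * (r - u) ^ (1 / 2 : ℝ)) →
      ∀ u r, S ≤ u → u < r → r ≤ T → ‖z r - z u‖ ≤ D * (m + q) * (r - u) ^ (1 - p) + e * (r - u))
    {t : ℝ} (ht : S ≤ t) (ht' : t ≤ T) : ‖z t‖ + e ≤ 3 * (‖z S‖ + e) := by
  have half : ∀ {x : ℝ}, 0 < x → x ≤ τ → x ≤ x ^ (1 / 2 : ℝ) := fun {x} hx hx' => by
    simpa using Real.rpow_le_rpow_of_exponent_ge hx (hx'.trans hτ1) (by norm_num : (1 / 2 : ℝ) ≤ 1)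
  have hle1 : ∀ {x : ℝ}, 0 ≤ x → x ≤ τ → x ^ (1 / 2 : ℝ) ≤ 1 := fun {x} hx hx' =>
    Real.rpow_le_one hx (hx'.trans hτ1) (by norm_num)
  have bnd : ∀ q : ℝ, 0 ≤ q →
      (∀ u r, S ≤ u → u < r → r ≤ T → ‖z r - z u‖ ≤ q * (r - u) ^ (1 / 2 : ℝ)) →
      ∀ r, S ≤ r → r ≤ T → ‖z r‖ ≤ ‖z S‖ + q := by
    intro q hq hz r hr hr'
    rcases hr.eq_or_lt with rfl | hr1
    · linarith
    · have h1 := hz S r le_rfl hr1 hr'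
      have h2 := hle1 (x := r - S) (by linarith) (by linarith)
      have h3 := norm_sub_norm_le (z r) (z S)
      nlinarith
  -- The estimate improves a 1/2-Hölder constant q of z to q/2 + ‖z S‖/4 + e, whose fixed point is
  -- ‖z S‖/2 + 2e. Iteration starts from the Lipschitz constant 2K, whose contribution is halved
  -- each time and disappears in the limit.
  have iter : ∀ n : ℕ, ∀ u r, S ≤ u → u < r → r ≤ T →
      ‖z r - z u‖ ≤ (2 * K * (1 / 2) ^ n + (‖z S‖ / 2 + 2 * e)) * (r - u) ^ (1 / 2 : ℝ) := by
    intro n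
    induction n with
    | zero =>
      intro u r hu hur hr
      have hx : 0 < r - u := sub_pos.2 hur
      have hh := half hx (by linarith)
      refine (hL u r hu hur hr).trans ?_
      have : 0 ≤ ‖z S‖ := norm_nonneg _
      calc 2 * K * (r - u) ≤ 2 * K * (r - u) ^ (1 / 2 : ℝ) := by gcongr
        _ ≤ _ := by
          refine mul_le_mul_of_nonneg_right ?_ (Real.rpow_nonneg hx.le _)
          simp only [pow_zero, mul_one]; linarith
    | succ n ih =>
      set q := 2 * K * (1 / 2) ^ n + (‖z S‖ / 2 + 2 * e) with hqdef
      have hq : 0 ≤ q := by positivity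
      intro u r hu hur hr
      have hx : 0 < r - u := sub_pos.2 hur
      have hxτ : r - u ≤ τ := by linarith
      have hh := half hx hxτ
      refine (h (‖z S‖ + q) q (by positivity) hq (bnd q hq ih) ih u r hu hur hr).trans ?_
      have e1 : (r - u) ^ (1 - p) ≤ τ ^ (1 / 2 - p) * (r - u) ^ (1 / 2 : ℝ) := by
        have : (1 - p) = (1 / 2 - p) + 1 / 2 := by ring
        rw [this, Real.rpow_add hx]
        gcongr
      have hxx : 0 ≤ (r - u) ^ (1 / 2 : ℝ) := Real.rpow_nonneg hx.le _
      calc _ ≤ D * (‖z S‖ + q + q) * (τ ^ (1 / 2 - p) * (r - u) ^ (1 / 2 : ℝ)) +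
            e * (r - u) ^ (1 / 2 : ℝ) := by gcongr
        _ = (D * τ ^ (1 / 2 - p) * (‖z S‖ + q + q) + e) * (r - u) ^ (1 / 2 : ℝ) := by ring
        _ ≤ (1 / 4 * (‖z S‖ + q + q) + e) * (r - u) ^ (1 / 2 : ℝ) := by gcongr
        _ = _ := by rw [hqdef, pow_succ]; ring
  have lim : ∀ u r, S ≤ u → u < r → r ≤ T →
      ‖z r - z u‖ ≤ (‖z S‖ / 2 + 2 * e) * (r - u) ^ (1 / 2 : ℝ) := by
    intro u r hu hur hr
    have h1 := (tendsto_pow_atTop_nhds_zero_of_lt_one (r := (1 / 2 : ℝ)) (by norm_num)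
      (by norm_num)).const_mul (2 * K)
    have h2 := (h1.add_const (‖z S‖ / 2 + 2 * e)).mul_const ((r - u) ^ (1 / 2 : ℝ))
    rw [mul_zero, zero_add] at h2
    exact ge_of_tendsto' h2 fun n => iter n u r hu hur hr
  have := bnd _ (by positivity) lim t ht ht'
  have : 0 ≤ ‖z S‖ := norm_nonneg _
  linarith

section Stability
variable {Ω : Type*} [mΩ : MeasurableSpace Ω] {d : ℕ}
variable {P : Measure Ω} [IsProbabilityMeasure P] {ℱ : Filtration ℝ mΩ} {Z : ℝ → Ω → Vec d}
  {H c α K : ℝ} {b b₁ b₂ : Vec d → Vec d} {φ ψ : ℝ → L2 d P}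

lemma IsL2Solution.norm_sub_le (hZ : IsSplitNoise P ℱ Z H c) (hb : BddHolder α K b) (h0 : 0 < α)
    (hφ : IsL2Solution P ℱ Z b φ) {s t : ℝ} (hs : 0 ≤ s) (hst : s ≤ t) (ht : t ≤ 1) :
    ‖φ t - φ s‖ ≤ K * (t - s) := by
  rw [hφ.eqn s t hs hst ht]
  refine (intervalIntegral.norm_integral_le_of_norm_le_const fun v _ =>
    norm_nem_le hb h0 (hZ.measurable v).aestronglyMeasurable (φ v)).trans_eq ?_
  rw [abs_of_nonneg (sub_nonneg.2 hst)]

lemma IsL2Solution.norm_sub_condL2_le (hZ : IsSplitNoise P ℱ Z H c) (hb : BddHolder α K b)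
    (h0 : 0 < α) (hφ : IsL2Solution P ℱ Z b φ) {s t : ℝ} (hs : 0 ≤ s) (hst : s ≤ t) (ht : t ≤ 1) :
    ‖φ t - condL2 P ℱ s (φ t)‖ ≤ K * (t - s) := by
  have h := norm_sub_apply_le (isProjFamily_condL2 (P := P) (ℱ := ℱ)) s (φ t - φ s)
  rw [map_sub, hφ.adapted s ⟨hs, hst.trans ht⟩] at h
  refine le_trans (le_of_eq ?_) (h.trans (hφ.norm_sub_le hZ hb h0 hs hst ht))
  congr 1; abel

/-- The constant in the sewing estimate for the difference of two solutions. -/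
def stabConst (d : ℕ) (α K H c C : ℝ) : ℝ :=
  16 * gaussMoment d * K * c ^ (α - 2) * 4 ^ (H * (2 - α)) * C +
    2 * gaussMoment d * K * c ^ (α - 1) * 4 ^ (H * (1 - α))

lemma mul_rpow_rpow {c x H a : ℝ} (hc : 0 < c) (hx : 0 < x) :
    (c * x ^ H) ^ a = c ^ a * x ^ (H * a) := by
  rw [Real.mul_rpow hc.le (Real.rpow_nonneg hx.le _), ← Real.rpow_mul hx.le]

lemma rpow_neg_le_of_le_mul {x y a : ℝ} (hx : 0 < x) (hy : 0 < y) (h : y ≤ 4 * x) (ha : 0 ≤ a) :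
    x ^ (-a) ≤ 4 ^ a * y ^ (-a) := by
  have h1 : (4 * x) ^ (-a) ≤ y ^ (-a) := Real.rpow_le_rpow_of_nonpos hy h (by linarith)
  rw [Real.mul_rpow (by norm_num) hx.le, Real.rpow_neg (by norm_num)] at h1
  have h4 : (0 : ℝ) < 4 ^ a := Real.rpow_pos_of_pos (by norm_num) _
  calc x ^ (-a) = 4 ^ a * ((4 ^ a)⁻¹ * x ^ (-a)) := by field_simp
    _ ≤ _ := by gcongr

/-- The difference of the drifts along two solutions satisfies the hypotheses of the stochastic
sewing estimate. -/
lemma sewingData_sub (hZ : IsSplitNoise P ℱ Z H c) (hc : 0 < c) (h0 : 0 < α) (h1 : α < 1)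
    (hH : 0 < H) (hb₁ : BddHolder α K b₁) (hφ : IsL2Solution P ℱ Z b₁ φ)
    (hψ : IsL2Solution P ℱ Z b₂ ψ) {C γ : ℝ} (hC : 0 ≤ C) (hP : PredictionBound P ℱ Z α K C γ)
    {S T m q ε : ℝ} (hS : 0 ≤ S) (hT : T ≤ 1) (hm0 : 0 ≤ m) (hq0 : 0 ≤ q)
    (hm : ∀ r, S ≤ r → r ≤ T → ‖φ r - ψ r‖ ≤ m)
    (hq : ∀ u r, S ≤ u → u < r → r ≤ T →
      ‖(φ r - ψ r) - (φ u - ψ u)‖ ≤ q * (r - u) ^ (1 / 2 : ℝ))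
    (hε₁ : ε ≤ 1 / 2 - H * (1 - α)) (hε₂ : ε ≤ γ - H * (2 - α)) :
    SewingData (condL2 P ℱ) S T (fun r => nem b₁ (Z r) (φ r) - nem b₁ (Z r) (ψ r))
      (fun u r => condL2 P ℱ u (nem b₁ (Z r) (condL2 P ℱ u (φ r)) -
        nem b₁ (Z r) (condL2 P ℱ u (ψ r))))
      (fun u r => nem b₁ (Z r) (condL2 P ℱ u (φ r)) - nem b₁ (Z r) (condL2 P ℱ u (ψ r)))
      (H * (1 - α)) ε (stabConst d α K H c C * (m + q)) := by
  have hK := hb₁.nonneg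
  have hgm := one_le_gaussMoment (d := d)
  have hE := isProjFamily_condL2 (d := d) (P := P) (ℱ := ℱ)
  have hsub : Set.Icc S T ⊆ Set.Icc (0 : ℝ) 1 := Set.Icc_subset_Icc hS hT
  have hcY : ∀ u ∈ Set.Icc S T, ContinuousOn (fun r => nem b₁ (Z r) (condL2 P ℱ u (φ r)) -
      nem b₁ (Z r) (condL2 P ℱ u (ψ r))) (Set.Icc S T) := fun u _ =>
    (continuousOn_nem hb₁ h0 h1.le hZ.measurable hZ.cont
      ((condL2 P ℱ u).continuous.comp_continuousOn (hφ.cont.mono hsub))).sub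
    (continuousOn_nem hb₁ h0 h1.le hZ.measurable hZ.cont
      ((condL2 P ℱ u).continuous.comp_continuousOn (hψ.cont.mono hsub)))
  have hc1 : 0 < c ^ (α - 1) := Real.rpow_pos_of_pos hc _
  have hc2 : 0 < c ^ (α - 2) := Real.rpow_pos_of_pos hc _
  have hp : 0 ≤ H * (1 - α) := mul_nonneg hH.le (by linarith)
  have hp2 : 0 ≤ H * (2 - α) := mul_nonneg hH.le (by linarith)
  have h4 : (1 : ℝ) ≤ 4 ^ (H * (1 - α)) := Real.one_le_rpow (by norm_num) hp
  have h42 : (0 : ℝ) < 4 ^ (H * (2 - α)) := Real.rpow_pos_of_pos (by norm_num) _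
  set G₁ := 16 * gaussMoment d * K * c ^ (α - 2) * 4 ^ (H * (2 - α)) * C with hG₁
  set G₂ := 2 * gaussMoment d * K * c ^ (α - 1) * 4 ^ (H * (1 - α)) with hG₂
  have hG₁0 : 0 ≤ G₁ := by positivity
  have hG₂0 : 0 ≤ G₂ := by positivity
  have hst : stabConst d α K H c C = G₁ + G₂ := rfl
  have hmart : ∀ u₁ u₂ r, S ≤ u₁ → u₁ ≤ u₂ → u₂ < r → r ≤ T →
      ‖condL2 P ℱ u₂ (nem b₁ (Z r) (condL2 P ℱ u₁ (φ r)) -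
        nem b₁ (Z r) (condL2 P ℱ u₁ (ψ r)))‖ ≤
      stabConst d α K H c C * (m + q) * (r - u₂) ^ (-(H * (1 - α))) := by
    intro u₁ u₂ r hu₁ h12 h2r hr
    have hu₂ : 0 < r - u₂ := sub_pos.2 h2r
    refine (hZ.norm_condL2_nem_sub_le hc (by linarith) h2r (by linarith) hb₁ h0 h1.le
      ((aestronglyMeasurable_condL2 u₁ _).mono (ℱ.mono h12))
      ((aestronglyMeasurable_condL2 u₁ _).mono (ℱ.mono h12))).trans ?_
    rw [← map_sub, mul_rpow_rpow hc hu₂]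
    have e : H * (α - 1) = -(H * (1 - α)) := by ring
    rw [e]
    have hx : 0 ≤ (r - u₂) ^ (-(H * (1 - α))) := Real.rpow_nonneg hu₂.le _
    have hz : ‖condL2 P ℱ u₁ (φ r - ψ r)‖ ≤ m + q := by
      linarith [hE.norm_le u₁ (φ r - ψ r), hm r (by linarith) hr]
    calc _ ≤ 2 * gaussMoment d * K * (c ^ (α - 1) * (r - u₂) ^ (-(H * (1 - α)))) * (m + q) := by
          gcongr
      _ = (2 * gaussMoment d * K * c ^ (α - 1)) * 1 * ((m + q) * (r - u₂) ^ (-(H * (1 - α)))) := by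
          ring
      _ ≤ G₂ * ((m + q) * (r - u₂) ^ (-(H * (1 - α)))) := by
          rw [hG₂]; gcongr
      _ ≤ _ := by
          rw [hst, mul_assoc (G₁ + G₂)]
          exact mul_le_mul_of_nonneg_right (by linarith) (mul_nonneg (by positivity) hx)
  refine ⟨fun u hu => (condL2 P ℱ u).continuous.comp_continuousOn (hcY u hu), hcY,
    (continuousOn_nem hb₁ h0 h1.le hZ.measurable hZ.cont (hφ.cont.mono hsub)).sub
    (continuousOn_nem hb₁ h0 h1.le hZ.measurable hZ.cont (hψ.cont.mono hsub)),
    fun r hr hr' => hmart S S r le_rfl le_rfl hr hr', ?_,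
    fun u₁ u₂ r a1 a2 a3 a4 => hmart u₁ u₂ r a1 a2.le a3 a4⟩
  intro u₁ u₂ r hu₁ h12 h2r hr h4r
  have hx2 : 0 < r - u₂ := sub_pos.2 h2r
  have hx1 : 0 < r - u₁ := by linarith
  have hmeas : ∀ x : L2 d P, AEStronglyMeasurable[ℱ u₂] (condL2 P ℱ u₁ x) P := fun x =>
    (aestronglyMeasurable_condL2 u₁ x).mono (ℱ.mono h12.le)
  have eφ : condL2 P ℱ u₂ (φ r) - condL2 P ℱ u₁ (φ r) =
      condL2 P ℱ u₂ (φ r - condL2 P ℱ u₁ (φ r)) := by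
    rw [map_sub, hE.comp_of_ge _ _ _ h12.le]
  -- Conditionally on ℱ u₁, the increment E_{u₂} φ_r - E_{u₁} φ_r has second moment at most the
  -- square of the prediction bound, while the other factor is ℱ u₁-measurable. No moment of φ - ψ
  -- beyond the second is needed.
  have hB : eLpNorm (fun ω => ‖(condL2 P ℱ u₁ (φ r) - condL2 P ℱ u₁ (ψ r)) ω‖ *
      ‖(condL2 P ℱ u₂ (φ r) - condL2 P ℱ u₁ (φ r)) ω‖) 2 P ≤
      ENNReal.ofReal (C * (r - u₁) ^ γ * m) := by
    refine (lintegral_mul_le_of_restrL2 (ℱ := ℱ) (u := u₁) (C := C * (r - u₁) ^ γ)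
      (by positivity) (fun A hA => ?_) ?_).trans ?_
    · rw [eφ]
      exact (norm_restrL2_condL2_le h12.le hA _).trans
        (hP b₁ φ hb₁ hφ u₁ r (by linarith) (by linarith) (by linarith) A hA)
    · rw [← map_sub]; exact aestronglyMeasurable_condL2 u₁ _
    · refine ENNReal.ofReal_le_ofReal ?_
      rw [← map_sub]
      have := (hE.norm_le u₁ (φ r - ψ r)).trans (hm r (by linarith) hr)
      gcongr
  have key := hZ.norm_condL2_nem_four_le hc (by linarith : 0 ≤ u₂) h2r (by linarith) hb₁ h0 h1.le
    (hmeas (φ r)) (hmeas (ψ r)) (aestronglyMeasurable_condL2 u₂ (φ r))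
    (aestronglyMeasurable_condL2 u₂ (ψ r)) (by positivity) hB
  have hz : ‖(condL2 P ℱ u₂ (φ r) - condL2 P ℱ u₂ (ψ r)) -
      (condL2 P ℱ u₁ (φ r) - condL2 P ℱ u₁ (ψ r))‖ ≤ q * (r - u₁) ^ (1 / 2 : ℝ) := by
    refine le_trans ?_ (hq u₁ r hu₁ (by linarith) hr)
    have hu1 : u₁ ∈ Set.Icc (0 : ℝ) 1 := ⟨by linarith, by linarith⟩
    set z := φ r - ψ r
    have hzu : condL2 P ℱ u₁ (φ u₁ - ψ u₁) = φ u₁ - ψ u₁ := by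
      rw [map_sub, hφ.adapted u₁ hu1, hψ.adapted u₁ hu1]
    -- As z_{u₁} is fixed by both projections, (E_{u₂} - E_{u₁}) z_r = E_{u₂} (1 - E_{u₁}) (z_r -
    -- z_{u₁}): only the increment of z matters.
    have e : (condL2 P ℱ u₂ (φ r) - condL2 P ℱ u₂ (ψ r)) -
        (condL2 P ℱ u₁ (φ r) - condL2 P ℱ u₁ (ψ r)) =
        condL2 P ℱ u₂ ((z - (φ u₁ - ψ u₁)) - condL2 P ℱ u₁ (z - (φ u₁ - ψ u₁))) := by
      rw [map_sub (condL2 P ℱ u₁), hzu]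
      have : z - (φ u₁ - ψ u₁) - (condL2 P ℱ u₁ z - (φ u₁ - ψ u₁)) = z - condL2 P ℱ u₁ z := by abel
      rw [this, map_sub (condL2 P ℱ u₂), hE.comp_of_ge _ _ _ h12.le]
      simp only [z, map_sub]
    rw [e]
    exact (hE.norm_le _ _).trans (norm_sub_apply_le hE u₁ _)
  -- The remainder is E_{u₂} applied to Y_{u₂} - Y_{u₁}, a four-point difference of the drift.
  have ediff : condL2 P ℱ u₂ (nem b₁ (Z r) (condL2 P ℱ u₂ (φ r)) -
        nem b₁ (Z r) (condL2 P ℱ u₂ (ψ r))) -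
      condL2 P ℱ u₁ (nem b₁ (Z r) (condL2 P ℱ u₁ (φ r)) -
        nem b₁ (Z r) (condL2 P ℱ u₁ (ψ r))) -
      (condL2 P ℱ u₂ (nem b₁ (Z r) (condL2 P ℱ u₁ (φ r)) -
        nem b₁ (Z r) (condL2 P ℱ u₁ (ψ r))) -
      condL2 P ℱ u₁ (nem b₁ (Z r) (condL2 P ℱ u₁ (φ r)) -
        nem b₁ (Z r) (condL2 P ℱ u₁ (ψ r)))) =
      condL2 P ℱ u₂ ((nem b₁ (Z r) (condL2 P ℱ u₂ (φ r)) -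
        nem b₁ (Z r) (condL2 P ℱ u₂ (ψ r))) - (nem b₁ (Z r) (condL2 P ℱ u₁ (φ r)) -
        nem b₁ (Z r) (condL2 P ℱ u₁ (ψ r)))) := by
    rw [map_sub (condL2 P ℱ u₂) (_ - _) (_ - _)]; abel
  rw [ediff]
  refine key.trans ?_
  rw [mul_rpow_rpow hc hx2, mul_rpow_rpow hc hx2]
  have e1 : H * (α - 1) = -(H * (1 - α)) := by ring
  have e2 : H * (α - 2) = -(H * (2 - α)) := by ring
  have b1 := rpow_neg_le_of_le_mul hx2 hx1 h4r hp
  have b2 := rpow_neg_le_of_le_mul hx2 hx1 h4r hp2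
  have hle1 : r - u₁ ≤ 1 := by linarith
  -- The second-order singularity is paid by the prediction exponent γ, and the first-order one
  -- below by the 1/2-Hölder regularity of the difference.
  have p1 : (r - u₁) ^ (-(H * (2 - α))) * (r - u₁) ^ γ ≤ (r - u₁) ^ ε := by
    rw [← Real.rpow_add hx1]
    exact Real.rpow_le_rpow_of_exponent_ge hx1 hle1 (by linarith)
  have p2 : (r - u₁) ^ (-(H * (1 - α))) * (r - u₁) ^ (1 / 2 : ℝ) ≤ (r - u₁) ^ ε := by
    rw [← Real.rpow_add hx1]
    exact Real.rpow_le_rpow_of_exponent_ge hx1 hle1 (by linarith)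
  have hx1ε : 0 ≤ (r - u₁) ^ ε := Real.rpow_nonneg hx1.le _
  rw [e1, e2, hst]
  have t1 : 16 * gaussMoment d * K * (c ^ (α - 2) * (r - u₂) ^ (-(H * (2 - α)))) *
      (C * (r - u₁) ^ γ * m) ≤ G₁ * m * (r - u₁) ^ ε := by
    calc _ ≤ 16 * gaussMoment d * K * (c ^ (α - 2) *
          (4 ^ (H * (2 - α)) * (r - u₁) ^ (-(H * (2 - α))))) * (C * (r - u₁) ^ γ * m) := by gcongr
      _ = G₁ * m * ((r - u₁) ^ (-(H * (2 - α))) * (r - u₁) ^ γ) := by rw [hG₁]; ring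
      _ ≤ _ := by gcongr
  have t2 : 2 * gaussMoment d * K * (c ^ (α - 1) * (r - u₂) ^ (-(H * (1 - α)))) *
      ‖(condL2 P ℱ u₂ (φ r) - condL2 P ℱ u₂ (ψ r)) -
        (condL2 P ℱ u₁ (φ r) - condL2 P ℱ u₁ (ψ r))‖ ≤ G₂ * q * (r - u₁) ^ ε := by
    calc _ ≤ 2 * gaussMoment d * K * (c ^ (α - 1) *
          (4 ^ (H * (1 - α)) * (r - u₁) ^ (-(H * (1 - α))))) * (q * (r - u₁) ^ (1 / 2 : ℝ)) := by
            gcongr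
      _ = G₂ * q * ((r - u₁) ^ (-(H * (1 - α))) * (r - u₁) ^ (1 / 2 : ℝ)) := by rw [hG₂]; ring
      _ ≤ _ := by gcongr
  refine (add_le_add t1 t2).trans ?_
  rw [← add_mul]
  refine mul_le_mul_of_nonneg_right ?_ hx1ε
  nlinarith [mul_nonneg hG₁0 hq0, mul_nonneg hG₂0 hm0]

lemma stabConst_nonneg (hK : 0 ≤ K) (hc : 0 < c) {C : ℝ} (hC : 0 ≤ C) :
    0 ≤ stabConst d α K H c C := by
  have hgm := one_le_gaussMoment (d := d)
  unfold stabConst; positivity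

/-- Besides `sewingData_sub`, sewing needs the germ to converge at some positive rate. The crude
rate min(α, Hα) from the Lipschitz bound on solutions suffices, since it does not enter the final
constant. -/
lemma norm_integral_nem_sub_le (hZ : IsSplitNoise P ℱ Z H c) (hc : 0 < c) (h0 : 0 < α) (h1 : α < 1)
    (hH : 0 < H) (hp : H * (1 - α) < 1 / 2) (hb₁ : BddHolder α K b₁) (hb₂ : BddHolder α K b₂)
    (hφ : IsL2Solution P ℱ Z b₁ φ)
    (hψ : IsL2Solution P ℱ Z b₂ ψ) {C γ : ℝ} (hC : 0 ≤ C) (hγ : H * (2 - α) < γ)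
    (hP : PredictionBound P ℱ Z α K C γ)
    {S T m q : ℝ} (hS : 0 ≤ S) (hST : S < T) (hT : T ≤ 1) (hm0 : 0 ≤ m) (hq0 : 0 ≤ q)
    (hm : ∀ r, S ≤ r → r ≤ T → ‖φ r - ψ r‖ ≤ m)
    (hq : ∀ u r, S ≤ u → u < r → r ≤ T →
      ‖(φ r - ψ r) - (φ u - ψ u)‖ ≤ q * (r - u) ^ (1 / 2 : ℝ)) :
    ‖∫ r in S..T, (nem b₁ (Z r) (φ r) - nem b₁ (Z r) (ψ r))‖ ≤
      sewConst (H * (1 - α)) (min (1 / 2 - H * (1 - α)) (γ - H * (2 - α))) *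
        (stabConst d α K H c C * (m + q)) * (T - S) ^ (1 - H * (1 - α)) := by
  have hK := hb₁.nonneg
  have hgm := one_le_gaussMoment (d := d)
  have hμ : 0 < min α (H * α) := lt_min h0 (mul_pos hH h0)
  refine (sewingData_sub hZ hc h0 h1 hH hb₁ hφ hψ hC hP hS hT hm0 hq0 hm hq (min_le_left _ _)
    (min_le_right _ _)).norm_integral_le isProjFamily_condL2
    (mul_nonneg (stabConst_nonneg hK hc hC) (by positivity)) (mul_nonneg hH.le (by linarith)) hp
    (lt_min (by linarith) (by linarith)) hST (by linarith) hμ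
    (Γ' := 2 * (K * K ^ α + K * (gaussMoment d * c) ^ α)) (by positivity) ?_
  intro u r hu hur hr
  have hx : 0 < r - u := sub_pos.2 hur
  have one : ∀ {b' : Vec d → Vec d} {χ : ℝ → L2 d P}, BddHolder α K b' → IsL2Solution P ℱ Z b' χ →
      ‖nem b₁ (Z r) (χ r) - condL2 P ℱ u (nem b₁ (Z r) (condL2 P ℱ u (χ r)))‖ ≤
      (K * K ^ α + K * (gaussMoment d * c) ^ α) * (r - u) ^ (min α (H * α)) := by
    intro b' χ hb' hχ
    refine (hZ.norm_nem_sub_condL2_le hc (by linarith) hur (by linarith) hb₁ h0 h1.le _).trans ?_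
    have e1 : ‖χ r - condL2 P ℱ u (χ r)‖ ^ α ≤ K ^ α * (r - u) ^ (min α (H * α)) := by
      refine (Real.rpow_le_rpow (norm_nonneg _) (hχ.norm_sub_condL2_le hZ hb' h0 (by linarith)
        hur.le (by linarith)) h0.le).trans ?_
      rw [Real.mul_rpow hK hx.le]
      gcongr ?_ * ?_
      exact Real.rpow_le_rpow_of_exponent_ge hx (by linarith) (min_le_left _ _)
    have e2 : (gaussMoment d * (c * (r - u) ^ H)) ^ α ≤
        (gaussMoment d * c) ^ α * (r - u) ^ (min α (H * α)) := by
      rw [← mul_assoc, mul_rpow_rpow (by positivity) hx]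
      gcongr ?_ * ?_
      exact Real.rpow_le_rpow_of_exponent_ge hx (by linarith) (min_le_right _ _)
    calc _ ≤ K * (K ^ α * (r - u) ^ (min α (H * α))) +
        K * ((gaussMoment d * c) ^ α * (r - u) ^ (min α (H * α))) := by gcongr
      _ = _ := by ring
  rw [map_sub]
  refine le_trans (le_of_eq ?_) ((norm_sub_le _ _).trans (add_le_add (one hb₁ hφ) (one hb₂ hψ)))
    |>.trans (le_of_eq (by ring))
  congr 1; abel

/-- Solutions depend in a Lipschitz way on the drift, measured in the supremum norm, with a
constant that depends on the drift only through its Hölder norm. -/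
theorem exists_stability (hZ : IsSplitNoise P ℱ Z H c) (hc : 0 < c) (h0 : 0 < α) (h1 : α < 1)
    (hH : 0 < H) (hp : H * (1 - α) < 1 / 2) (hK : 0 ≤ K) :
    ∃ Q : ℝ, 0 ≤ Q ∧ ∀ (b₁ b₂ : Vec d → Vec d) (φ ψ : ℝ → L2 d P) (e : ℝ), 0 ≤ e →
      BddHolder α K b₁ → BddHolder α K b₂ → (∀ x, ‖b₁ x - b₂ x‖ ≤ e) →
      IsL2Solution P ℱ Z b₁ φ → IsL2Solution P ℱ Z b₂ ψ →
      ∀ t ∈ Set.Icc (0 : ℝ) 1, ‖φ t - ψ t‖ ≤ Q * e := by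
  obtain ⟨C, γ, hC, hγ, hP⟩ := exists_predictionBound hZ hc h0 h1 hH hp hK
  set p := H * (1 - α) with hpdef
  set D := sewConst p (min (1 / 2 - p) (γ - H * (2 - α))) * stabConst d α K H c C with hD
  have hD0 : 0 ≤ D := mul_nonneg (sewConst_nonneg hp (lt_min (by linarith) (by linarith)))
    (stabConst_nonneg hK hc hC)
  -- The interval length τ = 1/(N+1) is fixed by D alone, hence uniformly over drifts with Hölder
  -- bound K.
  obtain ⟨N, hN, hN0⟩ : ∃ N : ℕ, D * ((1 : ℝ) / ((N : ℝ) + 1)) ^ (1 / 2 - p) ≤ 1 / 4 ∧ 0 ≤ N := by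
    have : Tendsto (fun N : ℕ => D * ((1 : ℝ) / ((N : ℝ) + 1)) ^ (1 / 2 - p)) atTop (𝓝 0) := by
      have h := (tendsto_one_div_add_atTop_nhds_zero_nat (𝕜 := ℝ)).rpow_const
        (p := 1 / 2 - p) (Or.inr (by linarith))
      rw [Real.zero_rpow (by linarith)] at h
      simpa using h.const_mul D
    obtain ⟨N, hN⟩ := (this.eventually (ge_mem_nhds (by norm_num : (0 : ℝ) < 1 / 4))).exists
    exact ⟨N, hN, Nat.zero_le _⟩
  set τ := (1 : ℝ) / ((N : ℝ) + 1) with hτ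
  have hN1 : (0 : ℝ) < (N : ℝ) + 1 := by positivity
  have hτ0 : 0 < τ := by positivity
  have hτ1 : τ ≤ 1 := by rw [hτ, div_le_one hN1]; linarith [(Nat.cast_nonneg N : (0 : ℝ) ≤ N)]
  refine ⟨3 ^ (N + 1), by positivity, ?_⟩
  intro b₁ b₂ φ ψ e he hb₁ hb₂ hbe hφ hψ
  set z : ℝ → L2 d P := fun t => φ t - ψ t
  have hz0 : z 0 = 0 := by simp only [z, hφ.zero, hψ.zero, sub_zero]
  have hLip : ∀ u r, 0 ≤ u → u < r → r ≤ 1 → ‖z r - z u‖ ≤ 2 * K * (r - u) := by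
    intro u r hu hur hr
    have : z r - z u = (φ r - φ u) - (ψ r - ψ u) := by simp only [z]; abel
    rw [this]
    refine (norm_sub_le _ _).trans ?_
    linarith [hφ.norm_sub_le hZ hb₁ h0 hu hur.le hr, hψ.norm_sub_le hZ hb₂ h0 hu hur.le hr]
  have main : ∀ S T : ℝ, 0 ≤ S → T ≤ 1 → ∀ m q : ℝ, 0 ≤ m → 0 ≤ q →
      (∀ r, S ≤ r → r ≤ T → ‖z r‖ ≤ m) →
      (∀ u r, S ≤ u → u < r → r ≤ T → ‖z r - z u‖ ≤ q * (r - u) ^ (1 / 2 : ℝ)) →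
      ∀ u r, S ≤ u → u < r → r ≤ T →
        ‖z r - z u‖ ≤ D * (m + q) * (r - u) ^ (1 - p) + e * (r - u) := by
    intro S T hS hT m q hm0 hq0 hm hq u r hu hur hr
    have hu0 : 0 ≤ u := by linarith
    have hr1 : r ≤ 1 := by linarith
    have i1 := hφ.intervalIntegrable hZ hb₁ h0 h1.le hu0 hur.le hr1
    have i2 := hψ.intervalIntegrable hZ hb₂ h0 h1.le hu0 hur.le hr1
    have i3 : IntervalIntegrable (fun v => nem b₁ (Z v) (ψ v)) volume u r :=
      intervalIntegrable_of_continuousOn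
        (continuousOn_nem hb₁ h0 h1.le hZ.measurable hZ.cont hψ.cont) hu0 hur.le hr1
    -- The change of solution under the drift b₁ is separated from the change of drift along ψ;
    -- sewing handles the former and the supremum distance the latter.
    have ez : z r - z u = (∫ v in u..r, (nem b₁ (Z v) (φ v) - nem b₁ (Z v) (ψ v))) +
        ∫ v in u..r, (nem b₁ (Z v) (ψ v) - nem b₂ (Z v) (ψ v)) := by
      rw [intervalIntegral.integral_sub i1 i3, intervalIntegral.integral_sub i3 i2,
        ← hψ.eqn u r hu0 hur.le hr1, ← hφ.eqn u r hu0 hur.le hr1]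
      simp only [z]; abel
    rw [ez]
    refine (norm_add_le _ _).trans (add_le_add ?_ ?_)
    · refine (norm_integral_nem_sub_le hZ hc h0 h1 hH hp hb₁ hb₂ hφ hψ hC hγ hP hu0 hur hr1
        hm0 hq0 (fun v hv hv' => hm v (by linarith) (by linarith))
        (fun v w hv hvw hw => hq v w (by linarith) hvw (by linarith))).trans_eq ?_
      rw [hD]; ring
    · refine (intervalIntegral.norm_integral_le_of_norm_le_const fun v _ =>
        norm_nem_sub_nem_le hb₁ h0 hb₂ h0 he hbe
          (hZ.measurable v).aestronglyMeasurable (ψ v)).trans_eq ?_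
      rw [abs_of_pos (sub_pos.2 hur)]
  -- Each interval of length τ multiplies ‖z‖ + e by at most 3, starting from z 0 = 0; this yields Q
  -- = 3^(N+1).
  have step : ∀ k : ℕ, ∀ t : ℝ, 0 ≤ t → t ≤ k * τ → t ≤ 1 → ‖z t‖ + e ≤ 3 ^ k * e := by
    intro k
    induction k with
    | zero =>
      intro t ht ht' _
      have : t = 0 := le_antisymm (by simpa using ht') ht
      rw [this, hz0]; simp
    | succ k ih =>
      intro t ht ht' ht1
      by_cases hk : t ≤ k * τ
      · refine (ih t ht hk ht1).trans ?_
        rw [pow_succ]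
        have : (0 : ℝ) ≤ 3 ^ k * e := by positivity
        linarith
      · push Not at hk
        have hS : (0 : ℝ) ≤ k * τ := by positivity
        push_cast at ht'
        have := norm_sub_le_of_short (z := z) (S := k * τ) (T := t) (e := e) hK hD0 hp he
          (by linarith) hN hτ1
          (fun u r hu hur hr => hLip u r (by linarith) hur (by linarith))
          (main (k * τ) t hS ht1) hk.le le_rfl
        refine this.trans ?_
        rw [pow_succ]
        linarith [ih (k * τ) hS le_rfl (by linarith)]
  intro t ht
  have := step (N + 1) t ht.1 (by
    push_cast; rw [hτ, mul_one_div_cancel hN1.ne']; exact ht.2) ht.2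
  have h2 : ‖φ t - ψ t‖ = ‖z t‖ := rfl
  linarith

end Stability

/-! ### Existence of adapted solutions in L² -/

section Existence
variable {Ω : Type*} [mΩ : MeasurableSpace Ω] {d : ℕ}
variable {P : Measure Ω} [IsProbabilityMeasure P] {ℱ : Filtration ℝ mΩ} {Z : ℝ → Ω → Vec d}
  {H c α K : ℝ} {b : Vec d → Vec d} {φ : ℝ → L2 d P}

/-- Adapted solutions exist for Lipschitz drifts. -/
lemma exists_isL2Solution_of_lipschitz (hZ : IsSplitNoise P ℱ Z H c) (hb : BddHolder 1 K b) :
    ∃ φ : ℝ → L2 d P, IsL2Solution P ℱ Z b φ := by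
  have hK := hb.nonneg
  have hbl : ∀ t x y, ‖nem b (Z t) x - nem (P := P) b (Z t) y‖ ≤ K * ‖x - y‖ := fun t x y => by
    simpa using norm_nem_sub_same_le hb one_pos le_rfl
      (hZ.measurable t).aestronglyMeasurable x y
  -- The vector field is bounded by K, so over unit time a curve starting at 0 stays in the ball of
  -- radius K.
  have hpl : IsPicardLindelof (fun t x => nem (P := P) b (Z t) x) (tmin := 0) (tmax := 1)
      ⟨0, by simp⟩ 0 ⟨K, hK⟩ 0 ⟨K, hK⟩ ⟨K, hK⟩ := by
    refine ⟨fun t _ => LipschitzWith.lipschitzOnWith (LipschitzWith.of_dist_le_mul fun x y => ?_),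
      fun x _ => continuousOn_nem hb one_pos le_rfl hZ.measurable hZ.cont continuousOn_const,
      fun t _ x _ => norm_nem_le hb one_pos (hZ.measurable t).aestronglyMeasurable x, ?_⟩
    · rw [dist_eq_norm, dist_eq_norm]; exact hbl t x y
    · simp
  obtain ⟨φ, h0, hφ⟩ := hpl.exists_eq_forall_mem_Icc_hasDerivWithinAt₀
  replace h0 : φ 0 = 0 := h0
  have hc : ContinuousOn φ (Set.Icc 0 1) := fun t ht => (hφ t ht).continuousWithinAt
  have hcn := continuousOn_nem hb one_pos le_rfl hZ.measurable hZ.cont hc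
  have hd : ∀ t, 0 ≤ t → t < 1 → HasDerivWithinAt φ (nem b (Z t) (φ t)) (Set.Ici t) t :=
    fun t ht ht1 => (hφ t ⟨ht, ht1.le⟩).mono_of_mem_nhdsWithin (Icc_mem_nhdsGE_of_mem ⟨ht, ht1⟩)
  refine ⟨φ, fun T hT => ?_, hc, h0, fun s t hs hst ht => ?_⟩
  · have hE := isProjFamily_condL2 (d := d) (P := P) (ℱ := ℱ)
    -- Adaptedness at time T by Grönwall's inequality: the defect φ_t - E_T φ_t vanishes at 0, and
    -- its derivative is bounded by K times itself, because E_T fixes the drift at the adapted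
    -- position E_T φ_t.
    have := eq_zero_of_abs_deriv_le_mul_abs_self_of_eq_zero_right (a := 0) (b := T)
      (f := fun t => φ t - condL2 P ℱ T (φ t)) (K := K)
      (f' := fun t => nem b (Z t) (φ t) - condL2 P ℱ T (nem b (Z t) (φ t)))
      (((hc.mono (Set.Icc_subset_Icc_right hT.2))).sub
        ((condL2 P ℱ T).continuous.comp_continuousOn (hc.mono (Set.Icc_subset_Icc_right hT.2))))
      (fun t ht => (hd t ht.1 (ht.2.trans_le hT.2)).sub
        ((condL2 P ℱ T).hasFDerivAt.comp_hasDerivWithinAt t (hd t ht.1 (ht.2.trans_le hT.2))))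
      (by simp [h0]) (fun t ht => ?_) T ⟨hT.1, le_rfl⟩
    · exact (sub_eq_zero.1 this).symm
    · set y := nem b (Z t) (condL2 P ℱ T (φ t))
      have hy : condL2 P ℱ T y = y := condL2_eq_self (aestronglyMeasurable_nem hb one_pos
        ((hZ.adapted t ht.1).mono (ℱ.mono ht.2.le) le_rfl).aestronglyMeasurable
        (aestronglyMeasurable_condL2 T _))
      have h := norm_sub_apply_le hE T (nem b (Z t) (φ t) - y)
      rw [map_sub, hy] at h
      refine le_trans (le_of_eq ?_) (h.trans (hbl t _ _))
      congr 1; abel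
  · refine (intervalIntegral.integral_eq_sub_of_hasDeriv_right (f := φ) ?_ (fun r hr => ?_) ?_).symm
    · rw [Set.uIcc_of_le hst]; exact hc.mono (Set.Icc_subset_Icc hs ht)
    · rw [min_eq_left hst, max_eq_right hst] at hr
      exact (hd r (by linarith [hr.1]) (by linarith [hr.2])).mono Set.Ioi_subset_Ici_self
    · exact intervalIntegrable_of_continuousOn hcn hs hst ht

lemma BddHolder.gaussAvg (hb : BddHolder α K b) (h0 : 0 < α) (σ : ℝ) :
    BddHolder α K (gaussAvg σ b) :=
  ⟨norm_gaussAvg_le hb.bound, norm_gaussAvg_sub_le_holder h0 hb.bound hb.holder⟩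

lemma BddHolder.exists_gaussAvg_lipschitz (hb : BddHolder α K b) (h0 : 0 < α) (h1 : α ≤ 1) {σ : ℝ}
    (hσ : 0 < σ) : ∃ L, BddHolder 1 L (RegNoise.gaussAvg σ b) := by
  refine ⟨max K (2 * gaussMoment d * K * σ ^ (α - 1)),
    fun x => (norm_gaussAvg_le hb.bound x).trans (le_max_left _ _), fun x y => ?_⟩
  rw [Real.rpow_one]
  exact (norm_gaussAvg_sub_le h0 h1 hb.nonneg hb.bound hb.holder hσ x y).trans
    (mul_le_mul_of_nonneg_right (le_max_right _ _) (norm_nonneg _))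

/-- Adapted solutions exist. -/
theorem exists_isL2Solution (hZ : IsSplitNoise P ℱ Z H c) (hc : 0 < c) (h0 : 0 < α) (h1 : α < 1)
    (hH : 0 < H) (hp : H * (1 - α) < 1 / 2) (hb : BddHolder α K b) :
    ∃ φ : ℝ → L2 d P, IsL2Solution P ℱ Z b φ := by
  have hK := hb.nonneg
  have hgm := one_le_gaussMoment (d := d)
  obtain ⟨Q, hQ, hst⟩ := exists_stability (α := α) hZ hc h0 h1 hH hp hK
  have hσ : ∀ n : ℕ, (0 : ℝ) < 1 / ((n : ℝ) + 1) := fun n => by positivity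
  -- The Lipschitz constants of these averages may blow up, but their Hölder bound K does not, and
  -- stability uses only the latter.
  set bn : ℕ → Vec d → Vec d := fun n => gaussAvg (1 / ((n : ℝ) + 1)) b with hbn
  have hbnH : ∀ n, BddHolder α K (bn n) := fun n => hb.gaussAvg h0 _
  choose L hL using fun n => hb.exists_gaussAvg_lipschitz h0 h1.le (hσ n)
  choose φn hφn using fun n => exists_isL2Solution_of_lipschitz hZ (hL n)
  replace hφn : ∀ n, IsL2Solution P ℱ Z (bn n) (φn n) := hφn
  set e : ℕ → ℝ := fun n => K * (1 / ((n : ℝ) + 1)) ^ α * gaussMoment d with he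
  have he0 : ∀ n, 0 ≤ e n := fun n => by positivity
  have hbe : ∀ n x, ‖bn n x - b x‖ ≤ e n := fun n x =>
    norm_gaussAvg_sub_self_le h0 h1.le hK hb.bound hb.holder (hσ n) x
  have elim : Tendsto e atTop (𝓝 0) := by
    have h := (tendsto_one_div_add_atTop_nhds_zero_nat (𝕜 := ℝ)).rpow_const
      (p := α) (Or.inr h0.le)
    rw [Real.zero_rpow h0.ne'] at h
    have h' := (h.const_mul K).mul_const (gaussMoment d)
    rw [mul_zero, zero_mul] at h'
    exact h'
  have hdist : ∀ n m, ∀ t ∈ Set.Icc (0 : ℝ) 1, ‖φn n t - φn m t‖ ≤ Q * (e n + e m) := by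
    intro n m t ht
    refine hst (bn n) (bn m) _ _ _ (add_nonneg (he0 n) (he0 m)) (hbnH n) (hbnH m) (fun x => ?_)
      (hφn n) (hφn m) t ht
    have := norm_sub_le_norm_sub_add_norm_sub (bn n x) (b x) (bn m x)
    rw [norm_sub_rev (b x)] at this
    linarith [hbe n x, hbe m x]
  have hQe : Tendsto (fun p : ℕ × ℕ => Q * (e p.1 + e p.2)) atTop (𝓝 0) := by
    rw [← prod_atTop_atTop_eq]
    simpa using ((elim.comp tendsto_fst).add (elim.comp tendsto_snd)).const_mul Q
  have hlim : ∀ t : ℝ, ∃ x : L2 d P, t ∈ Set.Icc (0 : ℝ) 1 →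
      Tendsto (fun n => φn n t) atTop (𝓝 x) := by
    intro t
    by_cases ht : t ∈ Set.Icc (0 : ℝ) 1
    · have : CauchySeq fun n => φn n t := by
        rw [cauchySeq_iff_tendsto_dist_atTop_0]
        exact squeeze_zero (fun _ => dist_nonneg)
          (fun p => by rw [dist_eq_norm]; exact hdist p.1 p.2 t ht) hQe
      obtain ⟨x, hx⟩ := cauchySeq_tendsto_of_complete this
      exact ⟨x, fun _ => hx⟩
    · exact ⟨0, fun h => absurd h ht⟩
  choose φ hφ using hlim
  have hrate : ∀ n, ∀ t ∈ Set.Icc (0 : ℝ) 1, ‖φn n t - φ t‖ ≤ Q * e n := by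
    intro n t ht
    have h1 : Tendsto (fun m => ‖φn n t - φn m t‖) atTop (𝓝 ‖φn n t - φ t‖) :=
      ((hφ t ht).const_sub _).norm
    have h2 : Tendsto (fun m => Q * (e n + e m)) atTop (𝓝 (Q * (e n + 0))) :=
      (elim.const_add _).const_mul Q
    rw [add_zero] at h2
    exact le_of_tendsto_of_tendsto' h1 h2 fun m => hdist n m t ht
  have hunif : TendstoUniformlyOn φn φ atTop (Set.Icc 0 1) := by
    rw [Metric.tendstoUniformlyOn_iff]
    intro ε hε
    have hQe' : Tendsto (fun n => Q * e n) atTop (𝓝 0) := by simpa using elim.const_mul Q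
    filter_upwards [hQe'.eventually (gt_mem_nhds hε)] with n hn t ht
    rw [dist_comm, dist_eq_norm]
    exact (hrate n t ht).trans_lt hn
  have hcont : ContinuousOn φ (Set.Icc 0 1) :=
    hunif.continuousOn (Frequently.of_forall fun n => (hφn n).cont)
  refine ⟨φ, fun t ht => ?_, hcont, ?_, fun s t hs hst' ht => ?_⟩
  · have h1 := ((condL2 P ℱ t).continuous.tendsto _).comp (hφ t ht)
    refine tendsto_nhds_unique h1 ((hφ t ht).congr fun n => ?_)
    exact ((hφn n).adapted t ht).symm
  · refine tendsto_nhds_unique (hφ 0 (by simp)) ?_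
    simp only [(hφn _).zero]; exact tendsto_const_nhds
  · have hl := ((hφ t ⟨by linarith, ht⟩).sub (hφ s ⟨hs, by linarith⟩))
    refine tendsto_nhds_unique hl ?_
    have hr := intervalIntegral.tendsto_integral_filter_of_dominated_convergence (l := atTop)
      (μ := volume) (a := s) (b := t)
      (F := fun n r => nem (bn n) (Z r) (φn n r)) (f := fun r => nem b (Z r) (φ r)) (fun _ => K)
      (Eventually.of_forall fun n => ?_) (Eventually.of_forall fun n => ?_)
      intervalIntegrable_const ?_
    · exact hr.congr fun n => ((hφn n).eqn s t hs hst' ht).symm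
    · rw [Set.uIoc_of_le hst']
      exact ((continuousOn_nem (hbnH n) h0 h1.le hZ.measurable hZ.cont (hφn n).cont).mono
        (fun r hr => ⟨by linarith [hr.1], by linarith [hr.2]⟩)).aestronglyMeasurable
        measurableSet_Ioc
    · exact ae_of_all _ fun r _ =>
        norm_nem_le (hbnH n) h0 (hZ.measurable r).aestronglyMeasurable _
    · refine ae_of_all _ fun r hr => ?_
      rw [Set.uIoc_of_le hst'] at hr
      have hr' : r ∈ Set.Icc (0 : ℝ) 1 := ⟨by linarith [hr.1], by linarith [hr.2]⟩
      have hZr := (hZ.measurable r).aestronglyMeasurable (μ := P)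
      rw [tendsto_iff_norm_sub_tendsto_zero]
      have hb1 : ∀ n, ‖nem (bn n) (Z r) (φn n r) - nem b (Z r) (φ r)‖ ≤
          e n + K * ‖φn n r - φ r‖ ^ α := by
        intro n
        refine (norm_sub_le_norm_sub_add_norm_sub _ (nem b (Z r) (φn n r)) _).trans
          (add_le_add (norm_nem_sub_nem_le (hbnH n) h0 hb h0 (he0 n) (hbe n) hZr _)
            (norm_nem_sub_same_le hb h0 h1.le hZr _ _))
      refine squeeze_zero (fun _ => norm_nonneg _) hb1 ?_
      have h3 := (tendsto_iff_norm_sub_tendsto_zero.1 (hφ r hr')).rpow_const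
        (p := α) (Or.inr h0.le)
      rw [Real.zero_rpow h0.ne'] at h3
      simpa using elim.add (h3.const_mul K)

end Existence

/-! ### From L² solutions to processes and back -/

section Pathwise
variable {Ω : Type*} [mΩ : MeasurableSpace Ω] {d : ℕ}
variable {P : Measure Ω}

lemma exists_measurableSet_of_ae {p : Ω → Prop} (h : ∀ᵐ ω ∂P, p ω) :
    ∃ G, MeasurableSet G ∧ P Gᶜ = 0 ∧ ∀ ω ∈ G, p ω := by
  refine ⟨(toMeasurable P {ω | ¬ p ω})ᶜ, (measurableSet_toMeasurable _ _).compl, ?_, fun ω hω => ?_⟩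
  · rw [compl_compl, measure_toMeasurable]; exact h
  · by_contra hp
    exact hω (subset_toMeasurable _ _ hp)

variable {ℱ : Filtration ℝ mΩ} {Z : ℝ → Ω → Vec d} {H c α K : ℝ} {b : Vec d → Vec d}
  {φ : ℝ → L2 d P}

/-- Rounding down to the grid of mesh `1 / (n + 1)`. -/
def gridFloor (n : ℕ) (t : ℝ) : ℝ := ((⌊t * (n + 1)⌋₊ / (n + 1) : ℚ) : ℝ)

lemma gridFloor_le (n : ℕ) {t : ℝ} (ht : 0 ≤ t) : gridFloor n t ≤ t := by
  have hn : (0 : ℝ) < n + 1 := by positivity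
  have := Nat.floor_le (mul_nonneg ht hn.le)
  unfold gridFloor; push_cast
  rwa [div_le_iff₀ hn]

lemma gridFloor_nonneg (n : ℕ) (t : ℝ) : 0 ≤ gridFloor n t := by
  unfold gridFloor; positivity

lemma sub_gridFloor_le (n : ℕ) (t : ℝ) : t - gridFloor n t ≤ 1 / (n + 1) := by
  have hn : (0 : ℝ) < n + 1 := by positivity
  have := Nat.lt_floor_add_one (t * (n + 1))
  unfold gridFloor; push_cast
  rw [sub_le_iff_le_add, ← add_div, le_div_iff₀ hn]
  linarith

lemma gridFloor_mem (n : ℕ) {t : ℝ} (ht : t ∈ Set.Icc (0 : ℝ) 1) :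
    gridFloor n t ∈ Set.Icc (0 : ℝ) 1 :=
  ⟨gridFloor_nonneg n t, (gridFloor_le n ht.1).trans ht.2⟩

lemma abs_sub_gridFloor_le (n : ℕ) {t : ℝ} (ht : 0 ≤ t) : |t - gridFloor n t| ≤ 1 / (n + 1) := by
  rw [abs_of_nonneg (sub_nonneg.2 (gridFloor_le n ht))]; exact sub_gridFloor_le n t

lemma tendsto_gridFloor {t : ℝ} (ht : 0 ≤ t) : Tendsto (fun n => gridFloor n t) atTop (𝓝 t) := by
  rw [tendsto_iff_norm_sub_tendsto_zero]
  refine squeeze_zero (fun _ => norm_nonneg _) (fun n => ?_)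
    (tendsto_one_div_add_atTop_nhds_zero_nat (𝕜 := ℝ))
  rw [Real.norm_eq_abs, abs_sub_comm]; exact abs_sub_gridFloor_le n ht

/-- An adapted family in `L²` with almost surely Lipschitz increments has an adapted version with
continuous paths. -/
lemma exists_continuous_version (hcomp : ∀ t A, MeasurableSet A → P A = 0 → MeasurableSet[ℱ t] A)
    (hK : 0 ≤ K) (had : ∀ t ∈ Set.Icc (0 : ℝ) 1, condL2 P ℱ t (φ t) = φ t)
    (hlip : ∀ s ∈ Set.Icc (0 : ℝ) 1, ∀ t ∈ Set.Icc (0 : ℝ) 1,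
      ∀ᵐ ω ∂P, ‖φ t ω - φ s ω‖ ≤ K * |t - s|) :
    ∃ Y : ℝ → Ω → Vec d, (∀ t ∈ Set.Icc (0 : ℝ) 1, Measurable[ℱ t] (Y t)) ∧
      (∀ t, Measurable (Y t)) ∧ (∀ ω, Continuous fun t => Y t ω) ∧
      ∀ t ∈ Set.Icc (0 : ℝ) 1, φ t =ᵐ[P] Y t := by
  have hΦ : ∀ t : ℝ, ∃ f : Ω → Vec d, t ∈ Set.Icc (0 : ℝ) 1 →
      StronglyMeasurable[ℱ t] f ∧ φ t =ᵐ[P] f := by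
    intro t
    by_cases ht : t ∈ Set.Icc (0 : ℝ) 1
    · have h := condL2_eq_self_iff.1 (had t ht)
      exact ⟨h.mk _, fun _ => ⟨h.stronglyMeasurable_mk, h.ae_eq_mk⟩⟩
    · exact ⟨0, fun h => absurd h ht⟩
  choose Φ hΦ using hΦ
  have hlipΦ : ∀ s ∈ Set.Icc (0 : ℝ) 1, ∀ t ∈ Set.Icc (0 : ℝ) 1,
      ∀ᵐ ω ∂P, ‖Φ t ω - Φ s ω‖ ≤ K * |t - s| := by
    intro s hs t ht
    filter_upwards [hlip s hs t ht, (hΦ s hs).2, (hΦ t ht).2] with ω h1 h2 h3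
    rwa [h2, h3] at h1
  have hall : ∀ᵐ ω ∂P, ∀ p q : ℚ, (p : ℝ) ∈ Set.Icc (0 : ℝ) 1 → (q : ℝ) ∈ Set.Icc (0 : ℝ) 1 →
      ‖Φ q ω - Φ p ω‖ ≤ K * |(q : ℝ) - p| := by
    rw [ae_all_iff]; intro p
    rw [ae_all_iff]; intro q
    by_cases hp : (p : ℝ) ∈ Set.Icc (0 : ℝ) 1
    · by_cases hq : (q : ℝ) ∈ Set.Icc (0 : ℝ) 1
      · exact (hlipΦ p hp q hq).mono fun ω h _ _ => h
      · exact ae_of_all _ fun ω _ h => absurd h hq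
    · exact ae_of_all _ fun ω h => absurd h hp
  obtain ⟨G, hGm, hG0, hG⟩ := exists_measurableSet_of_ae hall
  -- Values of `gridFloor` are casts of rationals, so the countably many almost sure bounds apply to
  -- them.
  have hgrid : ∀ ω ∈ G, ∀ t ∈ Set.Icc (0 : ℝ) 1, ∀ s ∈ Set.Icc (0 : ℝ) 1, ∀ n m : ℕ,
      ‖Φ (gridFloor n t) ω - Φ (gridFloor m s) ω‖ ≤ K * |gridFloor n t - gridFloor m s| :=
    fun ω hω t ht s hs n m => hG ω hω _ _ (gridFloor_mem m hs) (gridFloor_mem n ht)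
  have hlim : ∀ t ω, ∃ y : Vec d, t ∈ Set.Icc (0 : ℝ) 1 →
      Tendsto (fun n => G.indicator (Φ (gridFloor n t)) ω) atTop (𝓝 y) := by
    intro t ω
    by_cases ht : t ∈ Set.Icc (0 : ℝ) 1
    · by_cases hω : ω ∈ G
      · have : CauchySeq fun n => G.indicator (Φ (gridFloor n t)) ω := by
          rw [cauchySeq_iff_tendsto_dist_atTop_0]
          have h1 : Tendsto (fun p : ℕ × ℕ => K * |gridFloor p.1 t - gridFloor p.2 t|) atTop
              (𝓝 (K * |t - t|)) := by
            rw [← prod_atTop_atTop_eq]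
            exact ((((tendsto_gridFloor ht.1).comp tendsto_fst).sub
              ((tendsto_gridFloor ht.1).comp tendsto_snd)).abs).const_mul K
          rw [sub_self, abs_zero, mul_zero] at h1
          refine squeeze_zero (fun _ => dist_nonneg) (fun p => ?_) h1
          simp only [Set.indicator_of_mem hω, dist_eq_norm]
          exact hgrid ω hω t ht t ht p.1 p.2
        obtain ⟨y, hy⟩ := cauchySeq_tendsto_of_complete this
        exact ⟨y, fun _ => hy⟩
      · refine ⟨0, fun _ => ?_⟩
        simp only [Set.indicator_of_notMem hω]; exact tendsto_const_nhds
    · exact ⟨0, fun h => absurd h ht⟩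
  choose Y₀ hY₀ using hlim
  have hYlip : ∀ ω, ∀ t ∈ Set.Icc (0 : ℝ) 1, ∀ s ∈ Set.Icc (0 : ℝ) 1,
      ‖Y₀ t ω - Y₀ s ω‖ ≤ K * |t - s| := by
    intro ω t ht s hs
    refine le_of_tendsto_of_tendsto' ((hY₀ t ω ht).sub (hY₀ s ω hs)).norm
      ((((tendsto_gridFloor ht.1).sub (tendsto_gridFloor hs.1)).abs).const_mul K) fun n => ?_
    by_cases hω : ω ∈ G
    · simp only [Set.indicator_of_mem hω]; exact hgrid ω hω t ht s hs n n
    · simp only [Set.indicator_of_notMem hω, sub_zero, norm_zero]; positivity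
  have hY₀m : ∀ t ∈ Set.Icc (0 : ℝ) 1, Measurable[ℱ t] (Y₀ t) := by
    intro t ht
    refine @measurable_of_tendsto_metrizable _ _ (ℱ t) _ _ _ _
      (fun n => G.indicator (Φ (gridFloor n t))) _ (fun n => ?_)
      (tendsto_pi_nhds.2 fun ω => hY₀ t ω ht)
    have hGt : MeasurableSet[ℱ t] G := by
      have := hcomp t Gᶜ hGm.compl hG0
      exact compl_compl G ▸ MeasurableSet.compl this
    -- Rounding down keeps the approximations ℱ t-measurable.
    exact Measurable.indicator (((hΦ _ (gridFloor_mem n ht)).1.measurable).mono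
      (ℱ.mono (gridFloor_le n ht.1)) le_rfl) hGt
  have hpr : ∀ t ∈ Set.Icc (0 : ℝ) 1, (Set.projIcc (0 : ℝ) 1 zero_le_one t : ℝ) = t :=
    fun t ht => by rw [Set.projIcc_of_mem _ ht]
  refine ⟨fun t => Y₀ (Set.projIcc (0 : ℝ) 1 zero_le_one t), fun t ht => ?_, fun t =>
    (hY₀m _ (Subtype.coe_prop _)).mono (ℱ.le _) le_rfl, fun ω => ?_, fun t ht => ?_⟩
  · simp only [hpr t ht]; exact hY₀m t ht
  · have h1 : LipschitzWith ⟨K, hK⟩ fun t : Set.Icc (0 : ℝ) 1 => Y₀ t ω :=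
      LipschitzWith.of_dist_le_mul fun x y => by
        rw [dist_eq_norm]; exact hYlip ω x x.2 y y.2
    exact h1.continuous.comp continuous_projIcc
  · simp only [hpr t ht]
    have h1 : ∀ᵐ ω ∂P, ∀ n, ‖φ t ω - Φ (gridFloor n t) ω‖ ≤ K * |t - gridFloor n t| := by
      rw [ae_all_iff]; intro n
      filter_upwards [hlip _ (gridFloor_mem n ht) t ht, (hΦ _ (gridFloor_mem n ht)).2] with ω h h'
      rwa [h'] at h
    filter_upwards [h1, mem_ae_iff.2 hG0] with ω hω hωG
    refine tendsto_nhds_unique ?_ (hY₀ t ω ht)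
    simp only [Set.indicator_of_mem hωG]
    rw [tendsto_iff_norm_sub_tendsto_zero]
    have h2 := (((tendsto_gridFloor ht.1).const_sub t).abs).const_mul K
    rw [sub_self, abs_zero, mul_zero] at h2
    exact squeeze_zero (fun _ => norm_nonneg _) (fun n => by rw [norm_sub_rev]; exact hω n) h2

variable [IsProbabilityMeasure P]

/-- Tested on the event ‖x‖ > C, the hypothesis contradicts this strict inequality unless the event
is null. -/
lemma ae_norm_le_of_norm_restrL2_le {x : L2 d P} {C : ℝ} (hC : 0 ≤ C)
    (h : ∀ A, MeasurableSet A → ‖restrL2 A x‖ ≤ C * Real.sqrt (P.real A)) :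
    ∀ᵐ ω ∂P, ‖x ω‖ ≤ C := by
  set A : Set Ω := {ω | C < ‖x ω‖} with hA
  have hAm : MeasurableSet A := measurableSet_lt measurable_const
    (Lp.stronglyMeasurable x).norm.measurable
  have hi : Integrable (fun ω => ‖x ω‖ ^ 2) P := (Lp.memLp x).integrable_norm_pow (by norm_num)
  have h1 : ∫ ω in A, (‖x ω‖ ^ 2 - C ^ 2) ∂P ≤ 0 := by
    rw [integral_sub hi.integrableOn (integrable_const _), setIntegral_const, smul_eq_mul]
    have h2 := h A hAm
    have h3 : ‖restrL2 A x‖ ^ 2 = ∫ ω in A, ‖x ω‖ ^ 2 ∂P := by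
      rw [L2.norm_sq_eq]
      exact integral_congr_ae ((restrL2_ae_eq A x).mono fun ω h => by simp only [h])
    have h4 : ‖restrL2 A x‖ ^ 2 ≤ (C * Real.sqrt (P.real A)) ^ 2 :=
      pow_le_pow_left₀ (norm_nonneg _) h2 2
    rw [h3, mul_pow, Real.sq_sqrt measureReal_nonneg] at h4
    linarith
  have h0 : ∀ᵐ ω ∂P.restrict A, 0 ≤ ‖x ω‖ ^ 2 - C ^ 2 := by
    filter_upwards [ae_restrict_mem hAm] with ω hω
    have : C ^ 2 ≤ ‖x ω‖ ^ 2 := pow_le_pow_left₀ hC (le_of_lt hω) 2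
    linarith
  have h5 := (integral_eq_zero_iff_of_nonneg_ae h0 ((hi.sub (integrable_const _)).integrableOn)).1
    (le_antisymm h1 (integral_nonneg_of_ae h0))
  have h6 : ∀ᵐ ω ∂P.restrict A, False := by
    filter_upwards [h5, ae_restrict_mem hAm] with ω hω hω'
    have : C ^ 2 < ‖x ω‖ ^ 2 := pow_lt_pow_left₀ hω' hC (by norm_num)
    simp only [Pi.zero_apply] at hω
    linarith
  rw [ae_restrict_iff' hAm] at h6
  filter_upwards [h6] with ω hω
  exact not_lt.1 fun h => hω h

/-- An L² bound on the whole space would not give Lipschitz paths; the bound by K (t - s) √P(A) on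
every event gives the almost sure one. -/
lemma IsL2Solution.ae_norm_sub_le (hZ : IsSplitNoise P ℱ Z H c) (hb : BddHolder α K b) (h0 : 0 < α)
    (h1 : α ≤ 1) (hφ : IsL2Solution P ℱ Z b φ) {s t : ℝ} (hs : s ∈ Set.Icc (0 : ℝ) 1)
    (ht : t ∈ Set.Icc (0 : ℝ) 1) : ∀ᵐ ω ∂P, ‖φ t ω - φ s ω‖ ≤ K * |t - s| := by
  wlog hst : s ≤ t generalizing s t
  · filter_upwards [this ht hs (le_of_not_ge hst)] with ω h
    rwa [norm_sub_rev, abs_sub_comm]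
  rw [abs_of_nonneg (sub_nonneg.2 hst)]
  have hK := hb.nonneg
  have key : ∀ᵐ ω ∂P, ‖(φ t - φ s) ω‖ ≤ K * (t - s) := by
    refine ae_norm_le_of_norm_restrL2_le (mul_nonneg hK (sub_nonneg.2 hst)) fun A _ => ?_
    rw [hφ.eqn s t hs.1 hst ht.2, ← ContinuousLinearMap.intervalIntegral_comp_comm _
      (hφ.intervalIntegrable hZ hb h0 h1 hs.1 hst ht.2)]
    refine (intervalIntegral.norm_integral_le_of_norm_le_const fun v _ =>
      norm_restrL2_nem_le hb h0 (hZ.measurable v).aestronglyMeasurable (φ v) A).trans_eq ?_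
    rw [abs_of_nonneg (sub_nonneg.2 hst)]; ring
  filter_upwards [key, Lp.coeFn_sub (φ t) (φ s)] with ω h1 h2
  rwa [h2, Pi.sub_apply] at h1

/-- Solutions in `L²` can be realised as strong solutions. -/
lemma exists_isStrongSolution
    (hcomp : ∀ t A, MeasurableSet A → P A = 0 → MeasurableSet[ℱ t] A)
    (hZ : IsSplitNoise P ℱ Z H c) (hb : BddHolder α K b) (h0 : 0 < α) (h1 : α ≤ 1)
    (hφ : IsL2Solution P ℱ Z b φ) : ∃ X, IsStrongSolution P ℱ b Z 1 X := by
  obtain ⟨Y, hYa, hYm, hYc, hYφ⟩ := exists_continuous_version hcomp hb.nonneg hφ.adapted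
    fun s hs t ht => hφ.ae_norm_sub_le hZ hb h0 h1 hs ht
  have hbc := hb.continuous h0
  have hint : ∀ ω, Continuous fun r => b (Y r ω + Z r ω) := fun ω =>
    hbc.comp ((hYc ω).add (hZ.cont ω))
  refine ⟨fun t ω => Y t ω + Z t ω, fun t ht => (hYa t ht).add (hZ.adapted t ht.1),
    ae_of_all _ fun ω => (hint ω).intervalIntegrable _ _, ?_⟩
  have hjm : Measurable (Function.uncurry fun r ω => b (Y r ω + Z r ω)) :=
    measurable_uncurry_of_continuous_of_measurable hint
      fun r => hbc.measurable.comp ((hYm r).add (hZ.measurable r))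
  have hone : ∀ t ∈ Set.Icc (0 : ℝ) 1,
      ∀ᵐ ω ∂P, Y t ω = ∫ r in (0 : ℝ)..t, b (Y r ω + Z r ω) := by
    intro t ht
    have h2 := L2.intervalIntegral_ae_eq (μ := P) ht.1 (Y := fun r ω => b (Y r ω + Z r ω))
      (y := fun r => nem b (Z r) (φ r)) hjm.aestronglyMeasurable
      ((continuousOn_nem hb h0 h1 hZ.measurable hZ.cont hφ.cont).mono
        (Set.Icc_subset_Icc_right ht.2))
      (fun r hr => by
        filter_upwards [nem_ae_eq hbc hb.bound (hZ.measurable r).aestronglyMeasurable (φ r),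
          hYφ r ⟨hr.1, hr.2.trans ht.2⟩] with ω e1 e2
        rw [e1, e2, add_comm])
    rw [← hφ.eqn 0 t le_rfl ht.1 ht.2, hφ.zero, sub_zero] at h2
    filter_upwards [h2, hYφ t ht] with ω e1 e2
    rw [← e2, e1]
  have hall : ∀ᵐ ω ∂P, ∀ q : ℚ, (q : ℝ) ∈ Set.Icc (0 : ℝ) 1 →
      Y q ω = ∫ r in (0 : ℝ)..q, b (Y r ω + Z r ω) := by
    rw [ae_all_iff]; intro q
    by_cases hq : (q : ℝ) ∈ Set.Icc (0 : ℝ) 1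
    · exact (hone q hq).mono fun ω h _ => h
    · exact ae_of_all _ fun ω h => absurd h hq
  filter_upwards [hall] with ω hω t ht
  congr 1
  -- Both sides of the equation are continuous in t, so the rational times suffice.
  have c1 := ((hYc ω).tendsto t).comp (tendsto_gridFloor ht.1)
  have c2 := ((intervalIntegral.continuous_primitive (μ := volume)
    (fun a b => (hint ω).intervalIntegrable a b)
    0).tendsto t).comp (tendsto_gridFloor ht.1)
  refine tendsto_nhds_unique c1 (c2.congr fun n => ?_)
  exact (hω _ (gridFloor_mem n ht)).symm

/-- The drift part of a strong solution is a solution in `L²`. -/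
lemma IsStrongSolution.exists_isL2Solution
    (hcomp : ∀ t A, MeasurableSet A → P A = 0 → MeasurableSet[ℱ t] A)
    (hZ : IsSplitNoise P ℱ Z H c) (hb : BddHolder α K b) (h0 : 0 < α) (h1 : α ≤ 1)
    {X : ℝ → Ω → Vec d} (hX : IsStrongSolution P ℱ b Z 1 X) :
    ∃ φ, IsL2Solution P ℱ Z b φ ∧ ∀ t ∈ Set.Icc (0 : ℝ) 1, ∀ᵐ ω ∂P, φ t ω = X t ω - Z t ω := by
  have hbc := hb.continuous h0
  have hK := hb.nonneg
  obtain ⟨G, hGm, hG0, hG⟩ := exists_measurableSet_of_ae (hX.integrable.and hX.eqn)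
  set pr : ℝ → ℝ := fun t => Set.projIcc (0 : ℝ) 1 zero_le_one t with hprdef
  have hprm : ∀ t, pr t ∈ Set.Icc (0 : ℝ) 1 := fun t => Subtype.coe_prop _
  have hpr : ∀ t ∈ Set.Icc (0 : ℝ) 1, pr t = t :=
    fun t ht => by simp only [pr, Set.projIcc_of_mem _ ht]
  -- The drift part, with time clamped to [0, 1] and set to zero off the event where the equation
  -- holds. This makes boundedness and continuity hold for every ω, while completeness of the
  -- filtration preserves adaptedness.
  set D : ℝ → Ω → Vec d := fun t => G.indicator fun ω => X (pr t) ω - Z (pr t) ω with hD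
  have hDG : ∀ t, ∀ ω ∈ G, D t ω = ∫ r in (0 : ℝ)..pr t, b (X r ω) := by
    intro t ω hω
    simp only [hD, Set.indicator_of_mem hω]
    rw [(hG ω hω).2 _ (hprm t), add_sub_cancel_right]
  have hDl : ∀ ω s t, ‖D t ω - D s ω‖ ≤ K * |pr t - pr s| := by
    intro ω s t
    by_cases hω : ω ∈ G
    · have i1 : ∀ t ∈ Set.Icc (0 : ℝ) 1, IntervalIntegrable (fun r => b (X r ω)) volume 0 t :=
        fun t ht => (hG ω hω).1.mono_set (by
          rw [Set.uIcc_of_le ht.1, Set.uIcc_of_le zero_le_one]; exact Set.Icc_subset_Icc_right ht.2)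
      rw [hDG t ω hω, hDG s ω hω, intervalIntegral.integral_interval_sub_left
        (i1 _ (hprm t)) (i1 _ (hprm s))]
      exact intervalIntegral.norm_integral_le_of_norm_le_const fun r _ => hb.bound _
    · simp only [hD, Set.indicator_of_notMem hω, sub_zero, norm_zero]; positivity
  have hDa : ∀ t ∈ Set.Icc (0 : ℝ) 1, Measurable[ℱ t] (D t) := by
    intro t ht
    have hGt : MeasurableSet[ℱ t] G := by
      have := hcomp t Gᶜ hGm.compl hG0
      exact compl_compl G ▸ MeasurableSet.compl this
    simp only [hD, hpr t ht]
    exact Measurable.indicator ((hX.adapted t ht).sub (hZ.adapted t ht.1)) hGt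
  have hprp : ∀ t, pr (pr t) = pr t := fun t => hpr _ (hprm t)
  have hDpr : ∀ t, D (pr t) = D t := fun t => by simp only [hD, hprp]
  have hDm : ∀ t, Measurable (D t) := fun t => by
    rw [← hDpr]; exact (hDa _ (hprm t)).mono (ℱ.le _) le_rfl
  have hDc : ∀ ω, Continuous fun t => D t ω := by
    intro ω
    have h1 : LipschitzWith ⟨K, hK⟩ fun t : Set.Icc (0 : ℝ) 1 => D t ω :=
      LipschitzWith.of_dist_le_mul fun x y => by
        rw [dist_eq_norm]
        refine (hDl ω y x).trans_eq ?_
        rw [hpr _ x.2, hpr _ y.2]; rfl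
    have h2 := h1.continuous.comp (continuous_projIcc (h := zero_le_one))
    exact h2.congr fun t => congrFun (hDpr t) ω
  have hD0 : ∀ ω, D 0 ω = 0 := by
    intro ω
    by_cases hω : ω ∈ G
    · rw [hDG 0 ω hω, hpr 0 (by simp), intervalIntegral.integral_same]
    · simp only [hD, Set.indicator_of_notMem hω]
  have hDb : ∀ t ω, ‖D t ω‖ ≤ K := by
    intro t ω
    have := hDl ω 0 t
    rw [hD0, sub_zero, hpr 0 (by simp), sub_zero] at this
    refine this.trans (mul_le_of_le_one_right hK ?_)
    rw [abs_of_nonneg (hprm t).1]; exact (hprm t).2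
  have hDL : ∀ t, MemLp (D t) 2 P := fun t =>
    MemLp.of_bound (hDm t).aestronglyMeasurable K (ae_of_all _ (hDb t))
  have hXD : ∀ ω ∈ G, ∀ r ∈ Set.Icc (0 : ℝ) 1, X r ω = D r ω + Z r ω := by
    intro ω hω r hr
    simp only [hD, Set.indicator_of_mem hω, hpr r hr, sub_add_cancel]
  have hφc : Continuous fun t => (hDL t).toLp :=
    L2.continuous_toLp (fun r => (hDm r).aestronglyMeasurable) hDb hDc fun r => (hDL r).coeFn_toLp
  have hint : ∀ ω, Continuous fun r => b (D r ω + Z r ω) := fun ω =>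
    hbc.comp ((hDc ω).add (hZ.cont ω))
  have hjm : Measurable (Function.uncurry fun r ω => b (D r ω + Z r ω)) :=
    measurable_uncurry_of_continuous_of_measurable hint
      fun r => hbc.measurable.comp ((hDm r).add (hZ.measurable r))
  refine ⟨fun t => (hDL t).toLp, ⟨fun t ht => ?_, hφc.continuousOn, ?_, fun s t hs hst ht => ?_⟩,
    fun t ht => ?_⟩
  · exact condL2_eq_self ((hDa t ht).aestronglyMeasurable.congr (hDL t).coeFn_toLp.symm)
  · refine Lp.ext ?_
    filter_upwards [(hDL 0).coeFn_toLp, Lp.coeFn_zero (Vec d) 2 P] with ω e1 e2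
    rw [e1, e2, hD0]; rfl
  · refine Lp.ext ?_
    have h2 := L2.intervalIntegral_ae_eq (μ := P) hst (Y := fun r ω => b (D r ω + Z r ω))
      (y := fun r => nem b (Z r) (hDL r).toLp) hjm.aestronglyMeasurable
      (continuousOn_nem hb h0 h1 hZ.measurable hZ.cont hφc.continuousOn)
      (fun r hr => by
        filter_upwards [nem_ae_eq hbc hb.bound (hZ.measurable r).aestronglyMeasurable (hDL r).toLp,
          (hDL r).coeFn_toLp] with ω e1 e2
        rw [e1, e2, add_comm])
    filter_upwards [h2, Lp.coeFn_sub (hDL t).toLp (hDL s).toLp, (hDL t).coeFn_toLp,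
      (hDL s).coeFn_toLp, mem_ae_iff.2 hG0] with ω e1 e2 e3 e4 hω
    have ht' : t ∈ Set.Icc (0 : ℝ) 1 := ⟨hs.trans hst, ht⟩
    have hs' : s ∈ Set.Icc (0 : ℝ) 1 := ⟨hs, hst.trans ht⟩
    have hcg : ∀ u ∈ Set.Icc (0 : ℝ) 1, D u ω = ∫ r in (0 : ℝ)..u, b (D r ω + Z r ω) := by
      intro u hu
      rw [hDG u ω hω, hpr u hu]
      refine intervalIntegral.integral_congr fun r hr => ?_
      rw [Set.uIcc_of_le hu.1] at hr
      simp only [hXD ω hω r ⟨hr.1, hr.2.trans hu.2⟩]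
    rw [e1, e2, Pi.sub_apply, e3, e4, hcg t ht', hcg s hs',
      intervalIntegral.integral_interval_sub_left ((hint ω).intervalIntegrable _ _)
        ((hint ω).intervalIntegrable _ _)]
  · filter_upwards [(hDL t).coeFn_toLp, mem_ae_iff.2 hG0] with ω e1 hω
    rw [e1, hXD ω hω t ht, add_sub_cancel_right]

/-- Strong existence and uniqueness for a noise whose increments over `[u, r]` split off an
independent Gaussian vector of size `(r - u) ^ H`. -/
theorem strong_existence_uniqueness
    (hcomp : ∀ t A, MeasurableSet A → P A = 0 → MeasurableSet[ℱ t] A)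
    (hZ : IsSplitNoise P ℱ Z H c) (hc : 0 < c) (h0 : 0 < α) (h1 : α < 1)
    (hH : 0 < H) (hp : H * (1 - α) < 1 / 2) (hb : BddHolder α K b) :
    (∃ X, IsStrongSolution P ℱ b Z 1 X) ∧ ∀ X Y, IsStrongSolution P ℱ b Z 1 X →
      IsStrongSolution P ℱ b Z 1 Y → ∀ᵐ ω ∂P, ∀ t ∈ Set.Icc (0 : ℝ) 1, X t ω = Y t ω := by
  refine ⟨?_, fun X Y hX hY => ?_⟩
  · obtain ⟨φ, hφ⟩ := exists_isL2Solution hZ hc h0 h1 hH hp hb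
    exact exists_isStrongSolution hcomp hZ hb h0 h1.le hφ
  obtain ⟨φ, hφ, hφX⟩ := hX.exists_isL2Solution hcomp hZ hb h0 h1.le
  obtain ⟨ψ, hψ, hψY⟩ := hY.exists_isL2Solution hcomp hZ hb h0 h1.le
  obtain ⟨Q, -, hQ⟩ := exists_stability (α := α) hZ hc h0 h1 hH hp hb.nonneg
  have heq : ∀ t ∈ Set.Icc (0 : ℝ) 1, φ t = ψ t := fun t ht => by
    -- Uniqueness is stability for two equal drifts.
    have := hQ b b φ ψ 0 le_rfl hb hb (fun x => by simp) hφ hψ t ht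
    rw [mul_zero] at this
    exact sub_eq_zero.1 (norm_le_zero_iff.1 this)
  have hall : ∀ᵐ ω ∂P, ∀ q : ℚ, (q : ℝ) ∈ Set.Icc (0 : ℝ) 1 → X q ω = Y q ω := by
    rw [ae_all_iff]; intro q
    by_cases hq : (q : ℝ) ∈ Set.Icc (0 : ℝ) 1
    · filter_upwards [hφX q hq, hψY q hq] with ω e1 e2 _
      rw [heq q hq, e2] at e1
      exact (sub_left_inj.1 e1).symm
    · exact ae_of_all _ fun ω h => absurd h hq
  have hcont : ∀ {X : ℝ → Ω → Vec d}, IsStrongSolution P ℱ b Z 1 X →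
      ∀ᵐ ω ∂P, ContinuousOn (fun t => X t ω) (Set.Icc 0 1) := by
    intro X hX
    filter_upwards [hX.integrable, hX.eqn] with ω hi he
    have h2 := intervalIntegral.continuousOn_primitive_interval (a := 0) (b := 1)
      (f := fun r => b (X r ω)) (μ := volume) (by
        rw [intervalIntegrable_iff_integrableOn_Icc_of_le zero_le_one] at hi
        rwa [Set.uIcc_of_le zero_le_one])
    rw [Set.uIcc_of_le zero_le_one] at h2
    exact (h2.add (hZ.cont ω).continuousOn).congr he
  filter_upwards [hall, hcont hX, hcont hY] with ω hω cX cY t ht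
  have lim : Tendsto (fun n => gridFloor n t) atTop (𝓝[Set.Icc 0 1] t) :=
    tendsto_nhdsWithin_iff.2 ⟨tendsto_gridFloor ht.1, Eventually.of_forall fun n =>
      gridFloor_mem n ht⟩
  exact tendsto_nhds_unique ((cX t ht).tendsto.comp lim)
    (((cY t ht).tendsto.comp lim).congr fun n => (hω _ (gridFloor_mem n ht)).symm)

end Pathwise

/-! ### Brownian increments as a Gaussian process -/

section Increments
variable {Ω : Type*} [mΩ : MeasurableSpace Ω] {d : ℕ}
variable {P : Measure Ω}

lemma hasGaussianLaw_of_map_eq {X : Ω → Vec d} {σ : ℝ}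
    (h : P.map X = (stdGaussian (Vec d)).map (fun x => σ • x)) : HasGaussianLaw X P := by
  refine ⟨?_⟩
  rw [h]
  exact isGaussian_map (σ • ContinuousLinearMap.id ℝ (Vec d))

variable [IsProbabilityMeasure P] {W : ℝ → Ω → Vec d}

/-- The increments of a Brownian motion are centred Gaussian vectors. -/
lemma IsTwoSidedBM.map_increment (hW : IsTwoSidedBM P W) {a b : ℝ} (hab : a ≤ b) :
    P.map (fun ω => W b ω - W a ω) =
      (stdGaussian (Vec d)).map (fun x => Real.sqrt (b - a) • x) := by
  have hm : Measurable fun ω => W b ω - W a ω := (hW.measurable b).sub (hW.measurable a)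
  have h1 : P.map (fun ω => W b ω - W a ω) =
      (Measure.pi (fun _ : Fin d => gaussianReal 0 (b - a).toNNReal)).map (WithLp.toLp 2) := by
    have hm' : Measurable fun ω (i : Fin d) => W b ω i - W a ω i := measurable_pi_lambda _ fun i =>
      (EuclideanSpace.proj (𝕜 := ℝ) i).continuous.measurable.comp hm
    rw [← hW.gauss a b hab, Measure.map_map (by fun_prop) hm']
    rfl
  have : IsProbabilityMeasure (P.map fun ω => W b ω - W a ω) :=
    Measure.isProbabilityMeasure_map hm.aemeasurable
  have : IsProbabilityMeasure ((stdGaussian (Vec d)).map (fun x => Real.sqrt (b - a) • x)) :=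
    Measure.isProbabilityMeasure_map (by fun_prop)
  refine Measure.ext_of_charFun ?_
  ext t
  rw [charFun_map_smul, charFun_stdGaussian, h1, charFun_pi]
  simp_rw [charFun_gaussianReal, ← Complex.exp_sum]
  congr 1
  rw [← Complex.ofReal_pow, norm_smul, mul_pow, Real.norm_eq_abs, sq_abs, Real.sq_sqrt (by linarith),
    EuclideanSpace.real_norm_sq_eq, Real.coe_toNNReal _ (by linarith)]
  push_cast
  simp only [mul_zero, zero_mul, zero_sub, Finset.sum_neg_distrib, Finset.mul_sum, Finset.sum_div,
    neg_div]

lemma IsTwoSidedBM.hasGaussianLaw_sub (hW : IsTwoSidedBM P W) {a b : ℝ} (hab : a ≤ b) :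
    HasGaussianLaw (fun ω => W b ω - W a ω) P :=
  hasGaussianLaw_of_map_eq (hW.map_increment hab)

lemma IsTwoSidedBM.integral_increment (hW : IsTwoSidedBM P W) {a b : ℝ} (hab : a ≤ b) :
    ∫ ω, (W b ω - W a ω) ∂P = 0 := by
  have hm : Measurable fun ω => W b ω - W a ω := (hW.measurable b).sub (hW.measurable a)
  have h := integral_map (μ := P) hm.aemeasurable (f := fun x : Vec d => x)
    (by fun_prop)
  rw [← h, hW.map_increment hab, integral_map (by fun_prop) (by fun_prop), integral_smul,
    integral_id_stdGaussian, smul_zero]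

lemma IsTwoSidedBM.integral_inner_mul_inner (hW : IsTwoSidedBM P W) {a b : ℝ} (hab : a ≤ b)
    (v w : Vec d) :
    ∫ ω, inner ℝ v (W b ω - W a ω) * inner ℝ w (W b ω - W a ω) ∂P = inner ℝ v w * (b - a) := by
  have hm : Measurable fun ω => W b ω - W a ω := (hW.measurable b).sub (hW.measurable a)
  have h := integral_map (μ := P) hm.aemeasurable
    (f := fun x : Vec d => inner ℝ v x * inner ℝ w x) (by fun_prop)
  rw [← h, hW.map_increment hab, integral_map (by fun_prop) (by fun_prop)]
  have hc := covarianceBilin_apply (μ := stdGaussian (Vec d)) IsGaussian.memLp_two_id v w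
  rw [covarianceBilin_stdGaussian] at hc
  simp only [id, integral_id_stdGaussian, sub_zero] at hc
  replace hc : inner ℝ v w = ∫ z, inner ℝ v z * inner ℝ w z ∂stdGaussian (Vec d) := hc
  simp only [inner_smul_right]
  rw [hc, ← integral_mul_const]
  refine integral_congr_ae (ae_of_all _ fun x => ?_)
  have := Real.mul_self_sqrt (sub_nonneg.2 hab)
  simp only
  linear_combination (inner ℝ v x * inner ℝ w x) * this

/-- The process of increments of a Brownian motion is Gaussian. -/
lemma IsTwoSidedBM.isGaussianProcess (hW : IsTwoSidedBM P W) :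
    IsGaussianProcess (fun (p : ℝ × ℝ) ω => W p.2 ω - W p.1 ω) P where
  hasGaussianLaw I := by
    classical
    -- A finite family of increments lives after some time m. From there on W - W_m starts at zero
    -- and has independent Gaussian increments, hence is a Gaussian process.
    obtain ⟨m, hm⟩ : ∃ m : ℝ, ∀ p ∈ I, m ≤ p.1 ∧ m ≤ p.2 := by
      obtain ⟨m, hm⟩ := (I.image fun p => min p.1 p.2).bddBelow
      refine ⟨m, fun p hp => le_min_iff.1 (hm ?_)⟩
      simpa using ⟨p.1, p.2, hp, rfl⟩
    let X : Set.Ici m → Ω → Vec d := fun t ω => W t ω - W m ω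
    have hX : IsGaussianProcess X P := by
      refine HasIndepIncrements.isGaussianProcess (fun t => hW.hasGaussianLaw_sub t.2)
        (ae_of_all _ fun ω => sub_self (W m ω)) fun n t ht => ?_
      have := hW.indep n (fun i => (t i : ℝ)) (fun i j hij => ht hij)
      simpa only [X, sub_sub_sub_cancel_right] using this
    have hY : IsGaussianProcess (fun (p : ℝ × ℝ) ω =>
        X ⟨max p.2 m, Set.mem_Ici.2 (le_max_right _ _)⟩ ω - X ⟨max p.1 m, Set.mem_Ici.2 (le_max_right _ _)⟩ ω) P := by
      refine hX.of_isGaussianProcess fun p =>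
        ⟨{⟨max p.2 m, Set.mem_Ici.2 (le_max_right _ _)⟩, ⟨max p.1 m, Set.mem_Ici.2 (le_max_right _ _)⟩},
          ContinuousLinearMap.proj ⟨⟨max p.2 m, Set.mem_Ici.2 (le_max_right _ _)⟩, by simp⟩ -
          ContinuousLinearMap.proj ⟨⟨max p.1 m, Set.mem_Ici.2 (le_max_right _ _)⟩, by simp⟩, fun ω => ?_⟩
      simp [X]
    have h := hY.hasGaussianLaw I
    have e : (fun ω => I.restrict fun p : ℝ × ℝ => X ⟨max p.2 m, Set.mem_Ici.2 (le_max_right _ _)⟩ ω -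
        X ⟨max p.1 m, Set.mem_Ici.2 (le_max_right _ _)⟩ ω) = fun ω => I.restrict fun p => W p.2 ω - W p.1 ω := by
      funext ω p
      have := hm p p.2
      simp [X, max_eq_left this.1, max_eq_left this.2]
    rwa [e] at h

end Increments

/-! ### The Wiener integral as a closed linear relation -/

section WienerRel
variable {Ω : Type*} [mΩ : MeasurableSpace Ω] {d : ℕ}

/-- Square integrable functions on the line. -/
abbrev L2R : Type := Lp ℝ 2 (volume : Measure ℝ)

/-- The indicator function of `(a, b]`. -/
def ivl (a b : ℝ) : L2R := indicatorConstLp 2 (measurableSet_Ioc (a := a) (b := b)) (by simp) (1 : ℝ)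

lemma ivl_ae_eq (a b : ℝ) : ivl a b =ᵐ[volume] (Set.Ioc a b).indicator fun _ => (1 : ℝ) :=
  indicatorConstLp_coeFn

lemma inner_ivl_self {a b : ℝ} (hab : a ≤ b) : inner ℝ (ivl a b) (ivl a b) = b - a := by
  rw [ivl, L2.real_inner_indicatorConstLp_one_indicatorConstLp_one _ _ _ _, Set.inter_self,
    Real.volume_real_Ioc_of_le hab]

lemma inner_ivl_of_le {a b c e : ℝ} (h : b ≤ c) : inner ℝ (ivl a b) (ivl c e) = 0 := by
  rw [ivl, ivl, L2.real_inner_indicatorConstLp_one_indicatorConstLp_one _ _ _ _,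
    Set.disjoint_iff_inter_eq_empty.1 (Set.disjoint_left.2 fun x hx hx' =>
      absurd (hx.2.trans h) (not_le.2 hx'.1)), measureReal_empty]

lemma ivl_add {a b c : ℝ} (hab : a ≤ b) (hbc : b ≤ c) : ivl a b + ivl b c = ivl a c := by
  refine Lp.ext ?_
  filter_upwards [Lp.coeFn_add (ivl a b) (ivl b c), ivl_ae_eq a b, ivl_ae_eq b c, ivl_ae_eq a c]
    with s h1 h2 h3 h4
  rw [h1, Pi.add_apply, h2, h3, h4, ← Set.Ioc_union_Ioc_eq_Ioc hab hbc,
    Set.indicator_union_of_disjoint]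
  exact Set.disjoint_left.2 fun x hx hx' => absurd hx.2 (not_le.2 hx'.1)

open Classical in
/-- The increment of a process, as an element of `L²`. -/
def incL2 (P : Measure Ω) (W : ℝ → Ω → Vec d) (a b : ℝ) : L2 d P :=
  if h : MemLp (fun ω => W b ω - W a ω) 2 P then h.toLp else 0

/-- The graph of the Wiener integral: the closed span of the pairs `(1_{(a, b]}, W_b - W_a)` over
the intervals in a given set. -/
def wienerRel (P : Measure Ω) (W : ℝ → Ω → Vec d) (s : Set (ℝ × ℝ)) : Submodule ℝ (L2R × L2 d P) :=
  (Submodule.span ℝ ((fun p : ℝ × ℝ => (ivl p.1 p.2, incL2 P W p.1 p.2)) ''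
    {p | p ∈ s ∧ p.1 ≤ p.2})).topologicalClosure

variable {P : Measure Ω} {W : ℝ → Ω → Vec d} {s : Set (ℝ × ℝ)}

lemma mem_wienerRel {a b : ℝ} (h : (a, b) ∈ s) (hab : a ≤ b) :
    (ivl a b, incL2 P W a b) ∈ wienerRel P W s :=
  Submodule.le_topologicalClosure _ (Submodule.subset_span ⟨(a, b), ⟨h, hab⟩, rfl⟩)

lemma isClosed_wienerRel : IsClosed (wienerRel P W s : Set (L2R × L2 d P)) :=
  Submodule.isClosed_topologicalClosure _

/-- A continuous linear map sends `wienerRel` to a closed subspace as soon as it does so on the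
generators. -/
lemma map_mem_of_wienerRel {F : Type*} [NormedAddCommGroup F] [NormedSpace ℝ F]
    (Φ : L2R × L2 d P →L[ℝ] F) {S : Submodule ℝ F} (hS : IsClosed (S : Set F))
    (h : ∀ a b, (a, b) ∈ s → a ≤ b → Φ (ivl a b, incL2 P W a b) ∈ S) {x : L2R × L2 d P}
    (hx : x ∈ wienerRel P W s) : Φ x ∈ S := by
  have hle : wienerRel P W s ≤ S.comap (Φ : L2R × L2 d P →ₗ[ℝ] F) := by
    refine Submodule.topologicalClosure_minimal _ (Submodule.span_le.2 ?_)
      (hS.preimage Φ.continuous)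
    rintro _ ⟨⟨a, b⟩, ⟨h1, h2⟩, rfl⟩
    exact h a b h1 h2
  exact hle hx

lemma wienerRel_mono {t : Set (ℝ × ℝ)} (h : s ⊆ t) : wienerRel P W s ≤ wienerRel P W t :=
  fun _ hx => map_mem_of_wienerRel (ContinuousLinearMap.id ℝ _) isClosed_wienerRel
    (fun _ _ h1 h2 => mem_wienerRel (h h1) h2) hx

/-- The component in direction `v` of a square integrable random vector. -/
def compL2 (P : Measure Ω) (v : Vec d) : L2 d P →L[ℝ] Lp ℝ 2 P := (innerSL ℝ v).compLpL 2 P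

lemma inner_compL2 (v w : Vec d) (ξ η : L2 d P) :
    inner ℝ (compL2 P v ξ) (compL2 P w η) = ∫ ω, inner ℝ v (ξ ω) * inner ℝ w (η ω) ∂P := by
  rw [L2.inner_def]
  refine integral_congr_ae ?_
  filter_upwards [(innerSL ℝ v).coeFn_compLpL (p := 2) (μ := P) ξ,
    (innerSL ℝ w).coeFn_compLpL (p := 2) (μ := P) η] with ω h1 h2
  simp only [compL2, h1, h2, innerSL_apply_apply, RCLike.inner_apply, conj_trivial]
  ring

lemma norm_sq_eq_sum_compL2 (ξ : L2 d P) :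
    ‖ξ‖ ^ 2 = ∑ i : Fin d, ‖compL2 P (EuclideanSpace.single i 1) ξ‖ ^ 2 := by
  have hi : ∀ i : Fin d, Integrable (fun ω => (ξ ω i) ^ 2) P := fun i => by
    have h := ((EuclideanSpace.proj (𝕜 := ℝ) i).comp_memLp' (Lp.memLp ξ)).integrable_sq
    exact h
  rw [L2.norm_sq_eq]
  simp_rw [EuclideanSpace.real_norm_sq_eq]
  rw [integral_finsetSum _ fun i _ => hi i]
  refine Finset.sum_congr rfl fun i _ => ?_
  rw [← real_inner_self_eq_norm_sq, inner_compL2]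
  refine integral_congr_ae (ae_of_all _ fun ω => ?_)
  simp [EuclideanSpace.inner_single_left, sq]

variable [IsProbabilityMeasure P]

lemma IsTwoSidedBM.incL2_ae_eq (hW : IsTwoSidedBM P W) {a b : ℝ} (hab : a ≤ b) :
    incL2 P W a b =ᵐ[P] fun ω => W b ω - W a ω := by
  have h := (hW.hasGaussianLaw_sub hab).memLp_two
  rw [incL2, dif_pos h]
  exact h.coeFn_toLp

lemma IsTwoSidedBM.incL2_add (hW : IsTwoSidedBM P W) {a b c : ℝ} (hab : a ≤ b) (hbc : b ≤ c) :
    incL2 P W a b + incL2 P W b c = incL2 P W a c := by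
  refine Lp.ext ?_
  filter_upwards [Lp.coeFn_add (incL2 P W a b) (incL2 P W b c), hW.incL2_ae_eq hab,
    hW.incL2_ae_eq hbc, hW.incL2_ae_eq (hab.trans hbc)] with s h1 h2 h3 h4
  rw [h1, Pi.add_apply, h2, h3, h4]; abel

lemma IsTwoSidedBM.inner_compL2_self (hW : IsTwoSidedBM P W) {a b : ℝ} (hab : a ≤ b) (v w : Vec d) :
    inner ℝ (compL2 P v (incL2 P W a b)) (compL2 P w (incL2 P W a b)) = inner ℝ v w * (b - a) := by
  rw [inner_compL2, ← hW.integral_inner_mul_inner hab v w]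
  refine integral_congr_ae ((hW.incL2_ae_eq hab).mono fun ω h => ?_)
  simp only [h]

lemma IsTwoSidedBM.integral_inner_sub (hW : IsTwoSidedBM P W) {a b : ℝ} (hab : a ≤ b) (v : Vec d) :
    ∫ ω, inner ℝ v (W b ω - W a ω) ∂P = 0 := by
  rw [integral_inner (hW.hasGaussianLaw_sub hab).integrable, hW.integral_increment hab, inner_zero_right]

lemma IsTwoSidedBM.inner_compL2_adjacent (hW : IsTwoSidedBM P W) {a b c : ℝ} (hab : a ≤ b)
    (hbc : b ≤ c) (v w : Vec d) :
    inner ℝ (compL2 P v (incL2 P W a b)) (compL2 P w (incL2 P W b c)) = 0 := by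
  have hind := hW.indep.indepFun_sub_sub hab hbc
  have h2 : IndepFun (fun ω => inner ℝ v (W b ω - W a ω)) (fun ω => inner ℝ w (W c ω - W b ω)) P :=
    hind.comp (φ := fun x => inner ℝ v x) (ψ := fun x => inner ℝ w x) (by fun_prop) (by fun_prop)
  have hm : ∀ a b (v : Vec d), Measurable fun ω => inner ℝ v (W b ω - W a ω) := fun a b v => by
    have := hW.measurable a
    have := hW.measurable b
    fun_prop
  have h3 := h2.integral_mul_eq_mul_integral (hm a b v).aestronglyMeasurable
    (hm b c w).aestronglyMeasurable
  rw [hW.integral_inner_sub hab, zero_mul] at h3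
  rw [inner_compL2, ← h3]
  refine integral_congr_ae ?_
  filter_upwards [hW.incL2_ae_eq hab, hW.incL2_ae_eq hbc] with ω h4 h5
  simp only [h4, h5, Pi.mul_apply]

/-- Increments from a common origin have covariance min(a, b) - m, which is also the inner product
of the indicators. Arbitrary pairs of intervals follow by subtraction. -/
lemma IsTwoSidedBM.inner_compL2_base (hW : IsTwoSidedBM P W) {m a b : ℝ} (ha : m ≤ a) (hb : m ≤ b)
    (v w : Vec d) :
    inner ℝ (compL2 P v (incL2 P W m a)) (compL2 P w (incL2 P W m b)) =
      inner ℝ v w * inner ℝ (ivl m a) (ivl m b) := by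
  have key : ∀ {a b : ℝ} (v w : Vec d), m ≤ a → a ≤ b →
      inner ℝ (compL2 P v (incL2 P W m a)) (compL2 P w (incL2 P W m b)) =
        inner ℝ v w * inner ℝ (ivl m a) (ivl m b) := by
    intro a b v w ha h
    rw [← hW.incL2_add ha h, ← ivl_add ha h, map_add, inner_add_right, inner_add_right,
      hW.inner_compL2_self ha, hW.inner_compL2_adjacent ha h, inner_ivl_self ha,
      inner_ivl_of_le le_rfl]
    ring
  rcases le_total a b with h | h
  · exact key v w ha h
  · rw [real_inner_comm, key w v hb h, real_inner_comm v w, real_inner_comm (ivl m a)]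

lemma IsTwoSidedBM.inner_compL2_incL2 (hW : IsTwoSidedBM P W) {a b a' b' : ℝ} (h : a ≤ b)
    (h' : a' ≤ b') (v w : Vec d) :
    inner ℝ (compL2 P v (incL2 P W a b)) (compL2 P w (incL2 P W a' b')) =
      inner ℝ v w * inner ℝ (ivl a b) (ivl a' b') := by
  obtain ⟨m, hm, hm'⟩ : ∃ m, m ≤ a ∧ m ≤ a' := ⟨min a a', min_le_left _ _, min_le_right _ _⟩
  have e1 := hW.incL2_add hm h
  have e2 := hW.incL2_add hm' h'
  have e3 := ivl_add hm h
  have e4 := ivl_add hm' h'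
  rw [← eq_sub_iff_add_eq'] at e1 e2 e3 e4
  rw [e1, e2, e3, e4]
  rw [map_sub (compL2 P v), map_sub (compL2 P w)]
  simp only [inner_sub_left, inner_sub_right]
  rw [hW.inner_compL2_base (hm.trans h) (hm'.trans h'), hW.inner_compL2_base hm (hm'.trans h'),
    hW.inner_compL2_base (hm.trans h) hm', hW.inner_compL2_base hm hm']
  ring

/-- The Wiener integral is isometric, and integrals of scalar functions are isotropic. -/
lemma IsTwoSidedBM.inner_compL2_eq (hW : IsTwoSidedBM P W) {x y : L2R × L2 d P}
    (hx : x ∈ wienerRel P W Set.univ) (hy : y ∈ wienerRel P W Set.univ) (v w : Vec d) :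
    inner ℝ (compL2 P v x.2) (compL2 P w y.2) = inner ℝ v w * inner ℝ x.1 y.1 := by
  -- Bilinear identities extend from generators to the closure one variable at a time.
  have key : ∀ a b, a ≤ b → inner ℝ (compL2 P v x.2) (compL2 P w (incL2 P W a b)) =
      inner ℝ v w * inner ℝ x.1 (ivl a b) := by
    intro a b hab
    have := map_mem_of_wienerRel (S := ⊥)
      ((innerSL ℝ (compL2 P w (incL2 P W a b))) ∘L (compL2 P v) ∘L ContinuousLinearMap.snd ℝ _ _ -
        (inner ℝ v w : ℝ) • (innerSL ℝ (ivl a b)) ∘L ContinuousLinearMap.fst ℝ _ _)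
      isClosed_singleton (fun a' b' _ h' => ?_) hx
    · simp only [Submodule.mem_bot, _root_.sub_apply, _root_.smul_apply,
        ContinuousLinearMap.comp_apply, ContinuousLinearMap.coe_snd', ContinuousLinearMap.coe_fst',
        innerSL_apply_apply, smul_eq_mul, sub_eq_zero] at this
      rw [real_inner_comm, this, real_inner_comm x.1]
    · simp only [Submodule.mem_bot, _root_.sub_apply, _root_.smul_apply,
        ContinuousLinearMap.comp_apply, ContinuousLinearMap.coe_snd', ContinuousLinearMap.coe_fst',
        innerSL_apply_apply, smul_eq_mul, sub_eq_zero]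
      rw [hW.inner_compL2_incL2 hab h', real_inner_comm v w]
  have := map_mem_of_wienerRel (S := ⊥)
    ((innerSL ℝ (compL2 P v x.2)) ∘L (compL2 P w) ∘L ContinuousLinearMap.snd ℝ _ _ -
      (inner ℝ v w : ℝ) • (innerSL ℝ x.1) ∘L ContinuousLinearMap.fst ℝ _ _)
    isClosed_singleton (fun a' b' _ h' => ?_) hy
  · simpa only [Submodule.mem_bot, _root_.sub_apply, _root_.smul_apply,
      ContinuousLinearMap.comp_apply, ContinuousLinearMap.coe_snd', ContinuousLinearMap.coe_fst',
      innerSL_apply_apply, smul_eq_mul, sub_eq_zero] using this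
  · simp only [Submodule.mem_bot, _root_.sub_apply, _root_.smul_apply,
      ContinuousLinearMap.comp_apply, ContinuousLinearMap.coe_snd', ContinuousLinearMap.coe_fst',
      innerSL_apply_apply, smul_eq_mul, sub_eq_zero]
    exact key a' b' h'

lemma IsTwoSidedBM.norm_sq_eq (hW : IsTwoSidedBM P W) {x : L2R × L2 d P}
    (hx : x ∈ wienerRel P W Set.univ) : ‖x.2‖ ^ 2 = d * ‖x.1‖ ^ 2 := by
  rw [norm_sq_eq_sum_compL2]
  simp_rw [← real_inner_self_eq_norm_sq, hW.inner_compL2_eq hx hx]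
  simp

end WienerRel

/-! ### Gaussian law of Wiener integrals -/

section WienerLaw
variable {Ω : Type*} [mΩ : MeasurableSpace Ω] {d : ℕ}
variable {P : Measure Ω} [IsProbabilityMeasure P] {W : ℝ → Ω → Vec d}

lemma integral_norm_le_norm (ξ : L2 d P) : ∫ ω, ‖ξ ω‖ ∂P ≤ ‖ξ‖ := by
  have h2 : Integrable (fun ω => ‖ξ ω‖ ^ 2) P := (Lp.memLp ξ).integrable_norm_pow (by norm_num)
  have h1 : Integrable (fun ω => ‖ξ ω‖) P := ((Lp.memLp ξ).integrable (by norm_num)).norm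
  set m := ∫ ω, ‖ξ ω‖ ∂P
  have h3 : 0 ≤ ∫ ω, (‖ξ ω‖ - m) ^ 2 ∂P := integral_nonneg fun ω => sq_nonneg _
  have h4 : ∫ ω, (‖ξ ω‖ - m) ^ 2 ∂P = ‖ξ‖ ^ 2 - m ^ 2 := by
    have e : ∀ ω, (‖ξ ω‖ - m) ^ 2 = ‖ξ ω‖ ^ 2 - 2 * m * ‖ξ ω‖ + m ^ 2 := fun ω => by ring
    simp_rw [e]
    have h5 : Integrable (fun ω => ‖ξ ω‖ ^ 2 - 2 * m * ‖ξ ω‖) P := h2.sub (h1.const_mul _)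
    rw [integral_add h5 (integrable_const _), integral_sub h2 (h1.const_mul _), integral_const_mul, integral_const, L2.norm_sq_eq]
    simp only [probReal_univ, smul_eq_mul]
    ring
  refine abs_le_of_sq_le_sq' (by linarith) (norm_nonneg _) |>.2

lemma norm_exp_mul_I_sub_le (a b : ℝ) :
    ‖Complex.exp (a * Complex.I) - Complex.exp (b * Complex.I)‖ ≤ |a - b| := by
  have e : Complex.exp (a * Complex.I) - Complex.exp (b * Complex.I) =
      Complex.exp (b * Complex.I) * (Complex.exp (Complex.I * ((a - b : ℝ) : ℂ)) - 1) := by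
    rw [mul_sub, ← Complex.exp_add, mul_one]
    congr 2
    push_cast; ring
  rw [e, norm_mul, Complex.norm_exp_ofReal_mul_I, one_mul]
  exact Real.norm_exp_I_mul_ofReal_sub_one_le

lemma integrable_exp_inner_mul_I {X : Ω → Vec d} (hX : AEStronglyMeasurable X P) (v : Vec d) :
    Integrable (fun ω => Complex.exp (inner ℝ (X ω) v * Complex.I)) P :=
  Integrable.of_bound (C := 1) (by fun_prop) (ae_of_all _ fun ω => by
    rw [Complex.norm_exp_ofReal_mul_I])

/-- The characteristic function is continuous in the random vector. -/
lemma continuous_integral_exp_inner (v : Vec d) :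
    Continuous fun ξ : L2 d P => ∫ ω, Complex.exp (inner ℝ (ξ ω) v * Complex.I) ∂P := by
  refine (LipschitzWith.of_dist_le_mul (K := ⟨‖v‖, norm_nonneg v⟩) fun ξ η => ?_).continuous
  rw [dist_eq_norm, dist_eq_norm, ← integral_sub
    (integrable_exp_inner_mul_I (Lp.aestronglyMeasurable ξ) v)
    (integrable_exp_inner_mul_I (Lp.aestronglyMeasurable η) v)]
  refine (norm_integral_le_integral_norm _).trans ?_
  have h1 : Integrable (fun ω => ‖(ξ - η) ω‖) P :=
    ((Lp.memLp (ξ - η)).integrable (by norm_num)).norm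
  calc _ ≤ ∫ ω, ‖v‖ * ‖(ξ - η) ω‖ ∂P := by
        refine integral_mono_ae ((integrable_exp_inner_mul_I (Lp.aestronglyMeasurable ξ) v).sub
          (integrable_exp_inner_mul_I (Lp.aestronglyMeasurable η) v)).norm (h1.const_mul _) ?_
        filter_upwards [Lp.coeFn_sub ξ η] with ω hω
        refine (norm_exp_mul_I_sub_le _ _).trans ?_
        rw [hω, Pi.sub_apply, ← inner_sub_left, mul_comm]
        exact abs_real_inner_le_norm _ _
    _ = ‖v‖ * ∫ ω, ‖(ξ - η) ω‖ ∂P := integral_const_mul _ _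
    _ ≤ ‖v‖ * ‖ξ - η‖ := mul_le_mul_of_nonneg_left (integral_norm_le_norm _) (norm_nonneg _)

lemma IsTwoSidedBM.integral_inner_eq_zero (hW : IsTwoSidedBM P W) {x : L2R × L2 d P}
    (hx : x ∈ wienerRel P W Set.univ) (v : Vec d) : ∫ ω, inner ℝ v (x.2 ω) ∂P = 0 := by
  let Φ : L2R × L2 d P →L[ℝ] ℝ :=
    innerSL ℝ (indicatorConstLp 2 MeasurableSet.univ (measure_ne_top P _) (1 : ℝ)) ∘L
      compL2 P v ∘L ContinuousLinearMap.snd ℝ _ _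
  have hΦ : ∀ y, Φ y = ∫ ω, inner ℝ v (y.2 ω) ∂P := by
    intro y
    have : Φ y = inner ℝ (indicatorConstLp 2 MeasurableSet.univ (measure_ne_top P _) (1 : ℝ))
      (compL2 P v y.2) := rfl
    rw [this, L2.inner_indicatorConstLp_one, setIntegral_univ]
    exact integral_congr_ae (((innerSL ℝ v).coeFn_compLpL (p := 2) (μ := P) y.2).mono fun ω h => h)
  have h := map_mem_of_wienerRel (S := ⊥) Φ isClosed_singleton (fun a b _ hab => ?_) hx
  · rwa [Submodule.mem_bot, hΦ] at h
  · rw [Submodule.mem_bot, hΦ, ← hW.integral_inner_sub hab v]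
    exact integral_congr_ae ((hW.incL2_ae_eq hab).mono fun ω h => by simp only [h])

lemma IsTwoSidedBM.hasGaussianLaw_of_mem_span (hW : IsTwoSidedBM P W) {x : L2R × L2 d P}
    (hx : x ∈ Submodule.span ℝ ((fun p : ℝ × ℝ => (ivl p.1 p.2, incL2 P W p.1 p.2)) ''
      {p | p ∈ Set.univ ∧ p.1 ≤ p.2})) : HasGaussianLaw x.2 P := by
  obtain ⟨t, ht, c, rfl⟩ := (Submodule.mem_span_image_iff_exists_fun ℝ).1 hx
  have h1 := ((hW.isGaussianProcess.comp_right (fun p : t => (p : ℝ × ℝ))).smul c).hasGaussianLaw_fun_sum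
    (I := Finset.univ)
  refine h1.congr ?_
  have h2 : ∀ᵐ ω ∂P, ∀ p : t, incL2 P W (p : ℝ × ℝ).1 (p : ℝ × ℝ).2 ω =
      W (p : ℝ × ℝ).2 ω - W (p : ℝ × ℝ).1 ω := by
    rw [ae_all_iff]; intro p
    exact hW.incL2_ae_eq (ht p.2).2
  have h4 : ∀ p : t, c p • incL2 P W (p : ℝ × ℝ).1 (p : ℝ × ℝ).2 =ᵐ[P]
      fun ω => c p • incL2 P W (p : ℝ × ℝ).1 (p : ℝ × ℝ).2 ω := fun p => Lp.coeFn_smul _ _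
  have h5 := ae_all_iff.2 h4
  rw [Prod.snd_sum]
  filter_upwards [Lp.coeFn_fun_finsetSum Finset.univ (fun p : t =>
    c p • incL2 P W (p : ℝ × ℝ).1 (p : ℝ × ℝ).2), h2, h5] with ω e1 e2 e3
  simp only [Prod.smul_mk]
  rw [e1]
  exact Finset.sum_congr rfl fun p _ => by rw [e3 p, e2 p]; rfl

/-- Wiener integrals of scalar functions are isotropic Gaussian vectors. -/
lemma IsTwoSidedBM.map_wienerRel (hW : IsTwoSidedBM P W) {x : L2R × L2 d P}
    (hx : x ∈ wienerRel P W Set.univ) :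
    P.map x.2 = (stdGaussian (Vec d)).map (fun y => ‖x.1‖ • y) := by
  have key : ∀ v : Vec d, ∫ ω, Complex.exp (inner ℝ (x.2 ω) v * Complex.I) ∂P =
      Complex.exp (-(‖x.1‖ * ‖v‖ : ℝ) ^ 2 / 2) := by
    intro v
    -- The formula for the characteristic function is a closed condition on the pair, so it needs
    -- checking only on finite combinations of increments, which are Gaussian.
    have hcl : IsClosed {y : L2R × L2 d P |
        ∫ ω, Complex.exp (inner ℝ (y.2 ω) v * Complex.I) ∂P =
          Complex.exp (-(‖y.1‖ * ‖v‖ : ℝ) ^ 2 / 2)} := by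
      refine isClosed_eq ((continuous_integral_exp_inner v).comp continuous_snd) ?_
      fun_prop
    refine closure_minimal ?_ hcl hx
    intro y hy
    have hy' : y ∈ wienerRel P W Set.univ := Submodule.le_topologicalClosure _ hy
    have hg := (hW.hasGaussianLaw_of_mem_span hy)
    have h := hg.charFun_map_eq v
    have hm : AEMeasurable (fun ω => inner ℝ v (y.2 ω)) P := by
      have := hg.aemeasurable
      fun_prop
    rw [variance_of_integral_eq_zero hm (hW.integral_inner_eq_zero hy' v),
      hW.integral_inner_eq_zero hy' v, charFun_apply, integral_map hg.aemeasurable (by fun_prop)] at h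
    simp only [Set.mem_ofPred_eq]
    rw [h]
    have h2 := hW.inner_compL2_eq hy' hy' v v
    rw [inner_compL2] at h2
    have h3 : ∫ ω, inner ℝ v (y.2 ω) ^ 2 ∂P = (‖y.1‖ * ‖v‖) ^ 2 := by
      simp_rw [sq]
      rw [h2, real_inner_self_eq_norm_sq, real_inner_self_eq_norm_sq]; ring
    rw [h3]
    push_cast
    simp [neg_div]
  have hm : AEMeasurable x.2 P := (Lp.aestronglyMeasurable x.2).aemeasurable
  have : IsProbabilityMeasure (P.map x.2) := Measure.isProbabilityMeasure_map hm
  have : IsProbabilityMeasure ((stdGaussian (Vec d)).map (fun y => ‖x.1‖ • y)) :=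
    Measure.isProbabilityMeasure_map (by fun_prop)
  refine Measure.ext_of_charFun ?_
  ext v
  rw [charFun_map_smul, charFun_stdGaussian, charFun_apply, integral_map hm (by fun_prop), key v,
    norm_smul, norm_norm]

end WienerLaw

/-! ### Cutting an integrand at a time -/

section TailIndicator

lemma memLp_indicator_Ioi (u : ℝ) (f : L2R) : MemLp ((Set.Ioi u).indicator f) 2 volume :=
  (Lp.memLp f).indicator measurableSet_Ioi

/-- Restriction of a function to `(u, ∞)`, extended by zero. -/
def tailR (u : ℝ) : L2R →L[ℝ] L2R :=
  LinearMap.mkContinuous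
    { toFun := fun f => (memLp_indicator_Ioi u f).toLp
      map_add' := fun f g => by
        rw [← MemLp.toLp_add]
        refine MemLp.toLp_congr _ _ ?_
        filter_upwards [Lp.coeFn_add f g] with s hs
        by_cases h : s ∈ Set.Ioi u
        · simp only [Set.indicator_of_mem h, Pi.add_apply, hs]
        · simp only [Set.indicator_of_notMem h, Pi.add_apply, add_zero]
      map_smul' := fun c f => by
        rw [RingHom.id_apply, ← MemLp.toLp_const_smul]
        refine MemLp.toLp_congr _ _ ?_
        filter_upwards [Lp.coeFn_smul c f] with s hs
        by_cases h : s ∈ Set.Ioi u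
        · simp only [Set.indicator_of_mem h, Pi.smul_apply, hs]
        · simp only [Set.indicator_of_notMem h, Pi.smul_apply, smul_zero] }
    1 fun f => by
      rw [one_mul]
      refine Lp.norm_le_norm_of_ae_le ?_
      filter_upwards [(memLp_indicator_Ioi u f).coeFn_toLp] with s hs
      exact hs ▸ norm_indicator_le_norm_self _ _

lemma tailR_ae_eq (u : ℝ) (f : L2R) : tailR u f =ᵐ[volume] (Set.Ioi u).indicator f :=
  (memLp_indicator_Ioi u f).coeFn_toLp

lemma tailR_ivl_of_le {u a b : ℝ} (h : b ≤ u) : tailR u (ivl a b) = 0 := by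
  refine Lp.ext ?_
  filter_upwards [tailR_ae_eq u (ivl a b), ivl_ae_eq a b, Lp.coeFn_zero ℝ 2 volume] with s h1 h2 h3
  rw [h1, h3]
  by_cases hs : s ∈ Set.Ioi u
  · rw [Set.indicator_of_mem hs, h2, Set.indicator_of_notMem fun hs' =>
      absurd (hs'.2.trans h) (not_le.2 hs)]
    rfl
  · rw [Set.indicator_of_notMem hs]; rfl

lemma tailR_ivl_of_ge {u a b : ℝ} (h : u ≤ a) : tailR u (ivl a b) = ivl a b := by
  refine Lp.ext ?_
  filter_upwards [tailR_ae_eq u (ivl a b), ivl_ae_eq a b] with s h1 h2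
  rw [h1]
  by_cases hs : s ∈ Set.Ioi u
  · rw [Set.indicator_of_mem hs]
  · rw [Set.indicator_of_notMem hs, h2, Set.indicator_of_notMem fun hs' =>
      hs (h.trans_lt hs'.1)]

end TailIndicator

/-! ### Splitting Wiener integrals into past and future -/

section Independence

/-- The σ-algebra generated by the increments after time `u`. -/
abbrev futureSigma {Ω : Type*} {d : ℕ} (W : ℝ → Ω → Vec d) (u : ℝ) : MeasurableSpace Ω :=
  MeasurableSpace.comap (fun ω (p : {p : ℝ × ℝ // u ≤ p.1 ∧ p.1 ≤ p.2}) =>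
    W (p : ℝ × ℝ).2 ω - W (p : ℝ × ℝ).1 ω) inferInstance

lemma measurable_increment_futureSigma {Ω : Type*} {d : ℕ} {W : ℝ → Ω → Vec d} {u a b : ℝ} (hu : u ≤ a) (hab : a ≤ b) :
    Measurable[futureSigma W u] fun ω => W b ω - W a ω := by
  let p : {p : ℝ × ℝ // u ≤ p.1 ∧ p.1 ≤ p.2} := ⟨(a, b), hu, hab⟩
  intro B hB
  exact ⟨(fun x : {p : ℝ × ℝ // u ≤ p.1 ∧ p.1 ≤ p.2} → Vec d => x p) ⁻¹' B,
    measurable_pi_apply p hB, rfl⟩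

variable {Ω : Type*} [mΩ : MeasurableSpace Ω] {d : ℕ}
variable {P : Measure Ω} {W : ℝ → Ω → Vec d}

/-- Changing an event on a null set alters no probability; this accounts for the null events
contained in the complete filtration. -/
lemma indep_eventuallyMeasurableSpace {m₁ m₂ : MeasurableSpace Ω} (h : Indep m₁ m₂ P) :
    Indep m₁ (eventuallyMeasurableSpace m₂ (ae P)) P := by
  rw [Indep_iff] at h ⊢
  rintro A B hA ⟨B', hB', hBB⟩
  rw [measure_congr hBB, ← h A B' hA hB']
  exact measure_congr ((EventuallyEq.refl _ A).inter hBB)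

lemma IsTwoSidedBM.futureSigma_le (hW : IsTwoSidedBM P W) (u : ℝ) : futureSigma W u ≤ mΩ :=
  (measurable_pi_lambda _ fun _ => (hW.measurable _).sub (hW.measurable _)).comap_le

lemma incrFiltration_complete (hW : ∀ t, Measurable (W t)) (t : ℝ) (A : Set Ω)
    (hA : MeasurableSet A) (h : P A = 0) : MeasurableSet[incrFiltration P W hW t] A := by
  have h1 : MeasurableSpace.generateFrom {A : Set Ω | MeasurableSet[mΩ] A ∧ P A = 0} ≤
      incrFiltration P W hW t := le_sup_right
  exact h1 _ (MeasurableSpace.measurableSet_generateFrom ⟨hA, h⟩)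

lemma measurable_increment_incrFiltration (hW : ∀ t, Measurable (W t)) {u a b : ℝ} (hab : a ≤ b)
    (hb : b ≤ u) : Measurable[incrFiltration P W hW u] fun ω => W b ω - W a ω := by
  refine Measurable.of_comap_le (le_trans ?_ le_sup_left)
  exact le_iSup_of_le b (le_iSup_of_le a (le_iSup_of_le ⟨hab, hb⟩ le_rfl))

/-- With respect to a complete σ-algebra, a function that agrees almost
everywhere with a measurable one is measurable. -/
lemma measurable_of_ae_eq {m : MeasurableSpace Ω} (hm : m ≤ mΩ)
    (hcomp : ∀ A, MeasurableSet[mΩ] A → P A = 0 → MeasurableSet[m] A) {X Y : Ω → Vec d}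
    (hX : Measurable[mΩ] X) (hY : Measurable[m] Y) (h : X =ᵐ[P] Y) : Measurable[m] X := by
  intro B hB
  have h1 := hX hB
  have h2 := hY hB
  have h3 : P (X ⁻¹' B \ Y ⁻¹' B) = 0 := by
    refine measure_mono_null (fun ω hω => ?_) h
    exact fun e : X ω = Y ω => hω.2 (by rw [Set.mem_preimage, ← e]; exact hω.1)
  have h4 : P (Y ⁻¹' B \ X ⁻¹' B) = 0 := by
    refine measure_mono_null (fun ω hω => ?_) h
    exact fun e : X ω = Y ω => hω.2 (by rw [Set.mem_preimage, e]; exact hω.1)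
  have e : X ⁻¹' B = (Y ⁻¹' B \ (Y ⁻¹' B \ X ⁻¹' B)) ∪ (X ⁻¹' B \ Y ⁻¹' B) := by
    ext ω; simp only [Set.mem_union, Set.mem_sdiff]; tauto
  rw [e]
  have h5 : MeasurableSet[mΩ] (Y ⁻¹' B \ X ⁻¹' B) := @MeasurableSet.diff Ω mΩ _ _ (hm _ h2) h1
  have h6 : MeasurableSet[mΩ] (X ⁻¹' B \ Y ⁻¹' B) := @MeasurableSet.diff Ω mΩ _ _ h1 (hm _ h2)
  exact (h2.diff (hcomp _ h5 h4)).union (hcomp _ h6 h3)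

variable [IsProbabilityMeasure P]

lemma IsTwoSidedBM.integral_inner_mul_inner_of_le (hW : IsTwoSidedBM P W) {a b c e : ℝ}
    (hab : a ≤ b) (hbc : b ≤ c) (hce : c ≤ e) (v w : Vec d) :
    ∫ ω, inner ℝ v (W e ω - W c ω) * inner ℝ w (W b ω - W a ω) ∂P = 0 := by
  have h := hW.inner_compL2_incL2 hce hab v w
  rw [real_inner_comm (ivl a b), inner_ivl_of_le hbc, mul_zero, inner_compL2] at h
  rw [← h]
  refine integral_congr_ae ?_
  filter_upwards [hW.incL2_ae_eq hab, hW.incL2_ae_eq hce] with ω h1 h2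
  rw [h1, h2]

/-- The increments after time `u` are independent of the complete past at time `u`. -/
lemma IsTwoSidedBM.indep_future_past (hW : IsTwoSidedBM P W) (u : ℝ) :
    Indep (futureSigma W u) (incrFiltration P W hW.measurable u) P := by
  let X : {p : ℝ × ℝ // u ≤ p.1 ∧ p.1 ≤ p.2} → Ω → Vec d :=
    fun p ω => W (p : ℝ × ℝ).2 ω - W (p : ℝ × ℝ).1 ω
  let Y : {p : ℝ × ℝ // p.1 ≤ p.2 ∧ p.2 ≤ u} → Ω → Vec d :=
    fun p ω => W (p : ℝ × ℝ).2 ω - W (p : ℝ × ℝ).1 ω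
  have hm : ∀ p : ℝ × ℝ, Measurable fun ω => W p.2 ω - W p.1 ω := fun p =>
    (hW.measurable _).sub (hW.measurable _)
  have hXY : IsGaussianProcess (Sum.elim X Y) P := by
    have h := hW.isGaussianProcess.comp_right
      (Sum.elim (fun p : {p : ℝ × ℝ // u ≤ p.1 ∧ p.1 ≤ p.2} => (p : ℝ × ℝ))
        (fun p : {p : ℝ × ℝ // p.1 ≤ p.2 ∧ p.2 ≤ u} => (p : ℝ × ℝ)))
    have e : (fun (p : ℝ × ℝ) ω => W p.2 ω - W p.1 ω) ∘
      (Sum.elim (fun p : {p : ℝ × ℝ // u ≤ p.1 ∧ p.1 ≤ p.2} => (p : ℝ × ℝ))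
        (fun p : {p : ℝ × ℝ // p.1 ≤ p.2 ∧ p.2 ≤ u} => (p : ℝ × ℝ))) = Sum.elim X Y := by
      funext s
      rcases s with s | s <;> rfl
    rwa [e] at h
  -- Past and future increments are jointly Gaussian, so vanishing covariances already give
  -- independence.
  have hind := hXY.indepFun_of_covariance_inner (fun s => (hm s).aemeasurable)
    (fun t => (hm t).aemeasurable) fun s t x y => by
      have mx : MemLp (fun ω => inner ℝ x (X s ω)) 2 P :=
        (hW.hasGaussianLaw_sub s.2.2).memLp_two.const_inner x
      have my : MemLp (fun ω => inner ℝ y (Y t ω)) 2 P :=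
        (hW.hasGaussianLaw_sub t.2.1).memLp_two.const_inner y
      rw [covariance_eq_sub mx my]
      have h1 : ∫ ω, inner ℝ x (X s ω) ∂P = 0 := hW.integral_inner_sub s.2.2 x
      have h2 : ∫ ω, ((fun ω => inner ℝ x (X s ω)) * fun ω => inner ℝ y (Y t ω)) ω ∂P = 0 :=
        hW.integral_inner_mul_inner_of_le t.2.1 (t.2.2.trans s.2.1) s.2.2 x y
      rw [h1, h2]; simp
  rw [IndepFun_iff_Indep] at hind
  refine indep_of_indep_of_le_right (indep_eventuallyMeasurableSpace hind) ?_
  refine sup_le (iSup_le fun a => iSup_le fun b => iSup_le fun hab => ?_) ?_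
  · let p : {p : ℝ × ℝ // p.1 ≤ p.2 ∧ p.2 ≤ u} := ⟨(b, a), hab⟩
    rintro _ ⟨B, hB, rfl⟩
    exact ⟨_, ⟨(fun x : {p : ℝ × ℝ // p.1 ≤ p.2 ∧ p.2 ≤ u} → Vec d => x p) ⁻¹' B,
      measurable_pi_apply p hB, rfl⟩, EventuallyEq.rfl⟩
  · refine MeasurableSpace.generateFrom_le fun A hA => ?_
    exact ⟨∅, @MeasurableSet.empty Ω (MeasurableSpace.comap (fun ω t => Y t ω) MeasurableSpace.pi), ae_eq_empty.2 hA.2⟩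

lemma IsTwoSidedBM.condL2_incL2_of_le (hW : IsTwoSidedBM P W) {u a b : ℝ} (hab : a ≤ b)
    (hb : b ≤ u) : condL2 P (incrFiltration P W hW.measurable) u (incL2 P W a b) = incL2 P W a b :=
  condL2_eq_self
    ((measurable_increment_incrFiltration hW.measurable hab hb).stronglyMeasurable.aestronglyMeasurable.congr
      (hW.incL2_ae_eq hab).symm)

lemma IsTwoSidedBM.condL2_incL2_of_ge (hW : IsTwoSidedBM P W) {u a b : ℝ} (hab : a ≤ b)
    (ha : u ≤ a) : condL2 P (incrFiltration P W hW.measurable) u (incL2 P W a b) = 0 := by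
  refine Lp.ext ?_
  have h1 := condL2_ae_eq_condExp (P := P) (ℱ := incrFiltration P W hW.measurable) u (incL2 P W a b)
  have h2 := condExp_congr_ae (m := incrFiltration P W hW.measurable u) (hW.incL2_ae_eq hab)
  have h3 := condExp_indep_eq (hW.futureSigma_le u) ((incrFiltration P W hW.measurable).le u)
    (measurable_increment_futureSigma (W := W) ha hab).stronglyMeasurable (hW.indep_future_past u)
  filter_upwards [h1, h2, h3, Lp.coeFn_zero (Vec d) 2 P] with ω e1 e2 e3 e4
  rw [e1, e2, e3, e4, hW.integral_increment hab]; rfl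

/-- The part of a Wiener integral that is unpredictable at time `u` is the integral of the tail. -/
lemma IsTwoSidedBM.tail_mem_wienerRel (hW : IsTwoSidedBM P W) {x : L2R × L2 d P}
    (hx : x ∈ wienerRel P W Set.univ) (u : ℝ) :
    (tailR u x.1, x.2 - condL2 P (incrFiltration P W hW.measurable) u x.2) ∈
      wienerRel P W {p | u ≤ p.1} := by
  let E := condL2 P (d := d) (incrFiltration P W hW.measurable) u
  refine map_mem_of_wienerRel (S := wienerRel P W {p | u ≤ p.1})
    ((tailR u ∘L ContinuousLinearMap.fst ℝ _ _).prod
      (ContinuousLinearMap.snd ℝ _ _ - E ∘L ContinuousLinearMap.snd ℝ L2R _)) isClosed_wienerRel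
      (fun a b _ hab => ?_) hx
  change (tailR u (ivl a b), incL2 P W a b - E (incL2 P W a b)) ∈ _
  rcases le_total b u with hb | hb
  · rw [tailR_ivl_of_le hb, hW.condL2_incL2_of_le hab hb, sub_self]
    exact zero_mem _
  rcases le_total u a with ha | ha
  · rw [tailR_ivl_of_ge ha, hW.condL2_incL2_of_ge hab ha, sub_zero]
    exact mem_wienerRel (show u ≤ a from ha) hab
  -- An interval straddling u is cut there, and only its right part survives.
  · rw [← ivl_add ha hb, ← hW.incL2_add ha hb, map_add, map_add, tailR_ivl_of_le le_rfl,
      tailR_ivl_of_ge le_rfl, hW.condL2_incL2_of_le ha le_rfl, hW.condL2_incL2_of_ge hb le_rfl,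
      zero_add, add_zero, add_sub_cancel_left]
    exact mem_wienerRel (show u ≤ u from le_rfl) hb

/-- A Wiener integral splits, at time `u`, into a part known at time `u` and an independent
isotropic Gaussian vector. -/
lemma IsTwoSidedBM.exists_split (hW : IsTwoSidedBM P W) {x : L2R × L2 d P}
    (hx : x ∈ wienerRel P W Set.univ) (u : ℝ) :
    ∃ M G : Ω → Vec d, Measurable[incrFiltration P W hW.measurable u] M ∧ Measurable G ∧
      x.2 =ᵐ[P] (fun ω => M ω + G ω) ∧
      Indep (MeasurableSpace.comap G inferInstance) (incrFiltration P W hW.measurable u) P ∧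
      P.map G = (stdGaussian (Vec d)).map (fun y => ‖tailR u x.1‖ • y) := by
  set E := condL2 P (d := d) (incrFiltration P W hW.measurable) u with hE
  have hmem := hW.tail_mem_wienerRel hx u
  have hM := aestronglyMeasurable_condL2 (P := P) (ℱ := incrFiltration P W hW.measurable) u x.2
  -- The unpredictable part lies in the closed span of increments after u, and measurability with
  -- respect to the future is a closed condition.
  have hG : AEStronglyMeasurable[futureSigma W u] (x.2 - E x.2 : L2 d P) P := by
    have := map_mem_of_wienerRel (S := lpMeas (Vec d) ℝ (futureSigma W u) 2 P)
      (ContinuousLinearMap.snd ℝ L2R (L2 d P))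
      (isClosed_aestronglyMeasurable (hW.futureSigma_le u)) (fun a b ha hab => ?_) hmem
    · exact this
    · exact (measurable_increment_futureSigma (W := W) ha
        hab).stronglyMeasurable.aestronglyMeasurable.congr (hW.incL2_ae_eq hab).symm
  have hGm := hG.stronglyMeasurable_mk.measurable
  refine ⟨hM.mk _, hG.mk _, hM.stronglyMeasurable_mk.measurable,
    hGm.mono (hW.futureSigma_le u) le_rfl, ?_, ?_, ?_⟩
  · filter_upwards [hM.ae_eq_mk, hG.ae_eq_mk, Lp.coeFn_sub x.2 (E x.2)] with ω h1 h2 h3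
    rw [← h1, ← h2, h3, Pi.sub_apply, add_sub_cancel]
  · exact indep_of_indep_of_le_left (hW.indep_future_past u) hGm.comap_le
  · rw [← Measure.map_congr hG.ae_eq_mk]
    exact hW.map_wienerRel (wienerRel_mono (Set.subset_univ _) hmem)

/-- The unpredictable part has squared norm d times that of the tail of the integrand, so it
vanishes with the tail. -/
lemma IsTwoSidedBM.aestronglyMeasurable_of_tailR_eq_zero (hW : IsTwoSidedBM P W)
    {x : L2R × L2 d P} (hx : x ∈ wienerRel P W Set.univ) {u : ℝ} (hu : tailR u x.1 = 0) :
    AEStronglyMeasurable[incrFiltration P W hW.measurable u] x.2 P := by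
  have h := hW.norm_sq_eq (wienerRel_mono (Set.subset_univ _) (hW.tail_mem_wienerRel hx u))
  simp only [hu, norm_zero] at h
  have h2 : x.2 - condL2 P (incrFiltration P W hW.measurable) u x.2 = 0 := by
    rw [← norm_eq_zero]; exact pow_eq_zero_iff (two_ne_zero) |>.1 (by rw [h]; simp)
  exact condL2_eq_self_iff.1 (sub_eq_zero.1 h2).symm

end Independence

/-! ### Wiener integrals defined by step functions -/

section WienerIntegral
variable {Ω : Type*} [mΩ : MeasurableSpace Ω] {d : ℕ}
variable {P : Measure Ω} {W : ℝ → Ω → Vec d}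

/-- A step function as an element of `L²(ℝ)`. -/
def Step.toL2 (g : Step) : L2R := ∑ i, g.coef i • ivl (g.left i) (g.right i)

/-- The vector-valued elementary integral of a step function. -/
def Step.vecIntegral (P : Measure Ω) (W : ℝ → Ω → Vec d) (g : Step) : L2 d P :=
  ∑ i, g.coef i • incL2 P W (g.left i) (g.right i)

lemma Lp.coeFn_sum_smul {E Ω' : Type*} [MeasurableSpace Ω'] {μ : Measure Ω'}
    [NormedAddCommGroup E] [NormedSpace ℝ E] {ι : Type*} (s : Finset ι) (c : ι → ℝ)
    (f : ι → Lp E 2 μ) : (∑ i ∈ s, c i • f i : Lp E 2 μ) =ᵐ[μ] fun x => ∑ i ∈ s, c i • f i x := by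
  classical
  induction s using Finset.induction_on with
  | empty => simp only [Finset.sum_empty]; exact Lp.coeFn_zero E 2 μ
  | insert a s ha ih =>
    simp only [Finset.sum_insert ha]
    filter_upwards [ih, Lp.coeFn_add (c a • f a) (∑ i ∈ s, c i • f i), Lp.coeFn_smul (c a) (f a)]
      with x h1 h2 h3
    rw [h2, Pi.add_apply, h1, h3, Pi.smul_apply]

lemma Step.toL2_ae_eq (g : Step) : g.toL2 =ᵐ[volume] g.toFun := by
  have h : ∀ᵐ s, ∀ i, ivl (g.left i) (g.right i) s =
      (Set.Ioc (g.left i) (g.right i)).indicator (fun _ => (1 : ℝ)) s :=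
    ae_all_iff.2 fun i => ivl_ae_eq _ _
  filter_upwards [Lp.coeFn_sum_smul Finset.univ g.coef fun i => ivl (g.left i) (g.right i), h]
    with s h1 h2
  rw [Step.toL2, h1, Step.toFun]
  refine Finset.sum_congr rfl fun i _ => ?_
  rw [h2 i]
  by_cases hs : s ∈ Set.Ioc (g.left i) (g.right i)
  · simp [Set.indicator_of_mem hs]
  · simp [Set.indicator_of_notMem hs]

lemma Step.mem_wienerRel (g : Step) : (g.toL2, g.vecIntegral P W) ∈ wienerRel P W Set.univ := by
  have h : (g.toL2, g.vecIntegral P W) = ∑ i, g.coef i •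
      ((ivl (g.left i) (g.right i), incL2 P W (g.left i) (g.right i)) : L2R × L2 d P) := by
    refine Prod.ext ?_ ?_
    · simp [Step.toL2, Prod.fst_sum]
    · simp [Step.vecIntegral, Prod.snd_sum]
  rw [h]
  exact Submodule.sum_mem _ fun i _ => Submodule.smul_mem _ _
    (RegNoise.mem_wienerRel (Set.mem_univ _) (g.le i))

lemma compL2_single_ae_eq (i : Fin d) (ξ : L2 d P) :
    compL2 P (EuclideanSpace.single i 1) ξ =ᵐ[P] fun ω => ξ ω i := by
  filter_upwards [(innerSL ℝ (EuclideanSpace.single i (1 : ℝ) : Vec d)).coeFn_compLpL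
    (p := 2) (μ := P) ξ] with ω h1
  rw [compL2, h1]
  simp [EuclideanSpace.inner_single_left]

variable [IsProbabilityMeasure P]

lemma IsTwoSidedBM.vecIntegral_ae_eq (hW : IsTwoSidedBM P W) (g : Step) (i : Fin d) :
    (fun ω => g.vecIntegral P W ω i) =ᵐ[P] g.integral fun s ω => W s ω i := by
  have h : ∀ᵐ ω ∂P, ∀ j, incL2 P W (g.left j) (g.right j) ω =
      W (g.right j) ω - W (g.left j) ω := ae_all_iff.2 fun j => hW.incL2_ae_eq (g.le j)
  filter_upwards [Lp.coeFn_sum_smul Finset.univ g.coef fun j => incL2 P W (g.left j) (g.right j), h]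
    with ω h1 h2
  rw [Step.vecIntegral, h1, Step.integral]
  simp [h2]

lemma IsTwoSidedBM.norm_snd_eq (hW : IsTwoSidedBM P W) {x : L2R × L2 d P}
    (hx : x ∈ wienerRel P W Set.univ) : ‖x.2‖ = Real.sqrt d * ‖x.1‖ := by
  rw [← Real.sqrt_sq (norm_nonneg x.2), hW.norm_sq_eq hx, Real.sqrt_mul (by positivity),
    Real.sqrt_sq (norm_nonneg _)]

lemma IsTwoSidedBM.snd_eq_of_fst_eq (hW : IsTwoSidedBM P W) {x y : L2R × L2 d P}
    (hx : x ∈ wienerRel P W Set.univ) (hy : y ∈ wienerRel P W Set.univ) (h : x.1 = y.1) :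
    x.2 = y.2 := by
  have := hW.norm_snd_eq (sub_mem hx hy)
  rwa [Prod.fst_sub, h, sub_self, norm_zero, mul_zero, norm_eq_zero, Prod.snd_sub,
    sub_eq_zero] at this

/-- A Wiener integral against one coordinate is the coordinate of a vector-valued one. -/
lemma IsTwoSidedBM.exists_mem_wienerRel (hW : IsTwoSidedBM P W) {i : Fin d} {f : ℝ → ℝ}
    {J : Ω → ℝ} (h : IsWienerIntegral P (fun s ω => W s ω i) f J) :
    ∃ ξ : L2 d P, (h.1.toLp f, ξ) ∈ wienerRel P W Set.univ ∧ (fun ω => ξ ω i) =ᵐ[P] J := by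
  obtain ⟨hf, hJ, g, hg, hgJ⟩ := h
  have h1 : Tendsto (fun n => (g n).toL2) atTop (𝓝 (hf.toLp f)) := by
    rw [Lp.tendsto_Lp_iff_tendsto_eLpNorm']
    refine hg.congr fun n => eLpNorm_congr_ae ?_
    filter_upwards [(g n).toL2_ae_eq, hf.coeFn_toLp] with s h2 h3
    rw [Pi.sub_apply, h2, h3]
  -- Only coordinate i of the elementary integrals is known to converge. The isometry turns
  -- convergence of the integrands into convergence of the whole vector.
  have h2 : CauchySeq fun n => (g n).vecIntegral P W := by
    rw [cauchySeq_iff_tendsto_dist_atTop_0]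
    have h3 := (cauchySeq_iff_tendsto_dist_atTop_0.1 h1.cauchySeq).const_mul (Real.sqrt d)
    rw [mul_zero] at h3
    refine h3.congr fun p => ?_
    have := hW.norm_snd_eq (sub_mem (g p.1).mem_wienerRel (g p.2).mem_wienerRel)
    rw [dist_eq_norm, dist_eq_norm]
    exact this.symm
  obtain ⟨ξ, hξ⟩ := cauchySeq_tendsto_of_complete h2
  refine ⟨ξ, isClosed_wienerRel.mem_of_tendsto (h1.prodMk_nhds hξ)
    (Eventually.of_forall fun n => (g n).mem_wienerRel), ?_⟩
  have h4 := ((compL2 P (EuclideanSpace.single i (1 : ℝ))).continuous.tendsto ξ).comp hξ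
  have h5 : Tendsto (fun n => compL2 P (EuclideanSpace.single i (1 : ℝ)) ((g n).vecIntegral P W))
      atTop (𝓝 (hJ.toLp J)) := by
    rw [Lp.tendsto_Lp_iff_tendsto_eLpNorm']
    refine hgJ.congr fun n => eLpNorm_congr_ae ?_
    filter_upwards [compL2_single_ae_eq i ((g n).vecIntegral P W), hW.vecIntegral_ae_eq (g n) i,
      hJ.coeFn_toLp] with ω e1 e2 e3
    rw [Pi.sub_apply, e1, e3]
    exact congrArg (· - J ω) e2.symm
  have h6 := tendsto_nhds_unique h4 h5
  filter_upwards [compL2_single_ae_eq i ξ, hJ.coeFn_toLp] with ω e1 e2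
  rw [← e1, h6, e2]

/-- Fractional Brownian motion is the vector-valued Wiener integral of the kernel. -/
lemma IsFBM.exists_mem_wienerRel {h : ℝ} {B : ℝ → Ω → Vec d} (hB : IsFBM P W h B)
    (hW : IsTwoSidedBM P W) (hd : d ≠ 0) {t : ℝ} (ht : 0 ≤ t) :
    ∃ x ∈ wienerRel P W Set.univ, x.1 =ᵐ[volume] mvnKernel h t ∧ x.2 =ᵐ[P] B t := by
  have key := fun i => hW.exists_mem_wienerRel (hB.eq_integral t ht i)
  choose ξ hξ hξB using key
  let i₀ : Fin d := ⟨0, Nat.pos_of_ne_zero hd⟩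
  refine ⟨_, hξ i₀, (hB.eq_integral t ht i₀).1.coeFn_toLp, ?_⟩
  have hall : ∀ᵐ ω ∂P, ∀ i, ξ i ω i = B t ω i := ae_all_iff.2 hξB
  filter_upwards [hall] with ω hω
  ext i
  -- All coordinates of B share one kernel, so their vector-valued integrals coincide. The common
  -- integrand is read off from one coordinate, whence the need for d ≠ 0.
  have e : ξ i₀ = ξ i := hW.snd_eq_of_fst_eq (hξ i₀) (hξ i) rfl
  rw [← hω i, e]

end WienerIntegral

/-! ### Time integration of Wiener integrals and their kernels -/

section WienerPaths
variable {Ω : Type*} [mΩ : MeasurableSpace Ω] {d : ℕ}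
variable {P : Measure Ω} {W : ℝ → Ω → Vec d}

/-- A process with continuous paths that consists of Wiener integrals, together with an
`L²`-continuous choice of their integrands. -/
structure IsWienerPath (P : Measure Ω) (W : ℝ → Ω → Vec d) (y : ℝ → L2R × L2 d P)
    (Y : ℝ → Ω → Vec d) : Prop where
  continuous : Continuous y
  mem : ∀ t, y t ∈ wienerRel P W Set.univ
  measurable : ∀ t, Measurable (Y t)
  cont : ∀ ω, Continuous fun t => Y t ω
  ae_eq : ∀ t, 0 ≤ t → (y t).2 =ᵐ[P] Y t

/-- The Riemann–Liouville kernel. -/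
def rlKernel (c γ t s : ℝ) : ℝ := if s < t then c * (t - s) ^ γ else 0

lemma measurable_rlKernel (c γ : ℝ) : Measurable (Function.uncurry (rlKernel c γ)) :=
  Measurable.ite (measurableSet_lt measurable_snd measurable_fst) (by fun_prop) measurable_const

lemma integral_rlKernel {c γ t s : ℝ} (hγ : -1 < γ) (hs : 0 < s) (ht : 0 ≤ t) :
    ∫ r in (0 : ℝ)..t, rlKernel c γ r s = rlKernel (c / (γ + 1)) (γ + 1) t s := by
  have h0 : ∀ x, 0 ≤ x → x ≤ s → ∫ r in (0 : ℝ)..x, rlKernel c γ r s = 0 := fun x h0 hx => by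
    rw [intervalIntegral.integral_congr (g := fun _ => (0 : ℝ)), intervalIntegral.integral_zero]
    intro r hr
    rw [Set.uIcc_of_le h0] at hr
    exact if_neg (not_lt.2 (hr.2.trans hx))
  rcases le_or_gt t s with hts | hts
  · rw [h0 t ht hts, rlKernel, if_neg (not_lt.2 hts)]
  have e1 : ∀ᵐ r, r ∈ Set.uIoc s t → rlKernel c γ r s = c * (r - s) ^ γ := ae_of_all _ fun r hr => by
    rw [Set.uIoc_of_le hts.le] at hr
    exact if_pos hr.1
  have i1 : IntervalIntegrable (fun r => c * (r - s) ^ γ) volume s t := by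
    have := (intervalIntegral.intervalIntegrable_rpow' hγ (a := s - s) (b := t - s)).comp_sub_right s
    simpa using this.const_mul c
  have i2 : IntervalIntegrable (fun r => rlKernel c γ r s) volume s t :=
    i1.congr_ae (by
      rw [Filter.EventuallyEq, ae_restrict_iff' measurableSet_uIoc]
      exact e1.mono fun r hr h => (hr h).symm)
  have i3 : IntervalIntegrable (fun r => rlKernel c γ r s) volume 0 s :=
    (intervalIntegrable_const (c := (0 : ℝ))).congr fun r hr => by
      rw [Set.uIoc_of_le hs.le] at hr
      exact (if_neg (not_lt.2 hr.2)).symm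
  rw [← intervalIntegral.integral_add_adjacent_intervals i3 i2, h0 s hs.le le_rfl, zero_add,
    intervalIntegral.integral_congr_ae e1, intervalIntegral.integral_const_mul,
    intervalIntegral.integral_comp_sub_right (fun r => r ^ γ), integral_rpow (Or.inl hγ), sub_self,
    Real.zero_rpow (by linarith), rlKernel, if_pos hts]
  ring

/-- The Bochner integral in L²(ℝ) is identified pointwise on each (0, N], where the measure is
finite. Negative s is ignored: that part of the kernel belongs to the past at any time u ≥ 0 and
does not affect the conditional variance. -/
lemma timeIntegral_kernel {y : ℝ → L2R × L2 d P} (hy : Continuous y) {c γ : ℝ} (hγ : -1 < γ)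
    (h : ∀ t ∈ Set.Icc (0 : ℝ) 1, (y t).1 =ᵐ[volume.restrict (Set.Ioi 0)] rlKernel c γ t)
    {t : ℝ} (ht : t ∈ Set.Icc (0 : ℝ) 1) :
    (∫ r in (0 : ℝ)..t, y r).1 =ᵐ[volume.restrict (Set.Ioi 0)]
      rlKernel (c / (γ + 1)) (γ + 1) t := by
  have key : ∀ N : ℕ, (∫ r in (0 : ℝ)..t, y r).1 =ᵐ[volume.restrict (Set.Ioc (0 : ℝ) N)]
      rlKernel (c / (γ + 1)) (γ + 1) t := by
    intro N
    let R := LpToLpRestrictCLM ℝ ℝ ℝ volume 2 (Set.Ioc (0 : ℝ) N)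
    have e := (R ∘L ContinuousLinearMap.fst ℝ L2R (L2 d P)).intervalIntegral_comp_comm
      (hy.intervalIntegrable (μ := volume) 0 t)
    have h1 := L2.intervalIntegral_ae_eq (μ := volume.restrict (Set.Ioc (0 : ℝ) N)) ht.1
      (measurable_rlKernel c γ).aestronglyMeasurable (y := fun r => R (y r).1)
      (R.continuous.comp (continuous_fst.comp hy)).continuousOn fun r hr => by
        have hr' : r ∈ Set.Icc (0 : ℝ) 1 := ⟨hr.1, hr.2.trans ht.2⟩
        refine (LpToLpRestrictCLM_coeFn ℝ (Set.Ioc (0 : ℝ) N) (y r).1).trans ?_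
        exact ae_mono (Measure.restrict_mono_set _ Set.Ioc_subset_Ioi_self) (h r hr')
    have h2 := LpToLpRestrictCLM_coeFn ℝ (Set.Ioc (0 : ℝ) N) (∫ r in (0 : ℝ)..t, y r).1
    have e' : (∫ r in (0 : ℝ)..t, R (y r).1) = R (∫ r in (0 : ℝ)..t, y r).1 := e
    rw [e'] at h1
    filter_upwards [h1, h2, ae_restrict_mem measurableSet_Ioc] with s h3 h4 h5
    rw [← h4, h3, integral_rlKernel hγ h5.1 ht.1]
  have hU : Set.Ioi (0 : ℝ) = ⋃ N : ℕ, Set.Ioc (0 : ℝ) N := by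
    ext s
    simp only [Set.mem_Ioi, Set.mem_iUnion, Set.mem_Ioc]
    exact ⟨fun h => ⟨_, h, Nat.le_ceil s⟩, fun ⟨N, h⟩ => h.1⟩
  rw [hU, Filter.EventuallyEq, ae_restrict_iUnion_eq]
  exact eventually_iSup.2 key

variable [IsProbabilityMeasure P]

lemma IsTwoSidedBM.integral_exp_inner (hW : IsTwoSidedBM P W) {x : L2R × L2 d P}
    (hx : x ∈ wienerRel P W Set.univ) (v : Vec d) :
    ∫ ω, Complex.exp (inner ℝ (x.2 ω) v * Complex.I) ∂P =
      (Real.exp (-(‖x.1‖ * ‖v‖) ^ 2 / 2) : ℝ) := by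
  have hm : AEMeasurable x.2 P := (Lp.aestronglyMeasurable x.2).aemeasurable
  have h := congrArg (fun μ => charFun μ v) (hW.map_wienerRel hx)
  simp only [charFun_map_smul, charFun_stdGaussian] at h
  rw [charFun_apply, integral_map hm (by fun_prop)] at h
  rw [h, norm_smul, norm_norm]
  push_cast
  ring_nf

/-- Path continuity of a family of Wiener integrals forces `L²`-continuity. -/
lemma IsTwoSidedBM.continuous_of_paths (hW : IsTwoSidedBM P W) (hd : d ≠ 0)
    {y : ℝ → L2R × L2 d P} {Y : ℝ → Ω → Vec d} (hy : ∀ t, y t ∈ wienerRel P W Set.univ)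
    (hm : ∀ t, Measurable (Y t)) (hc : ∀ ω, Continuous fun t => Y t ω)
    (hyY : ∀ t, (y t).2 =ᵐ[P] Y t) : Continuous y := by
  let v : Vec d := EuclideanSpace.single ⟨0, Nat.pos_of_ne_zero hd⟩ 1
  have hv : ‖v‖ = 1 := by simp [v]
  have h1 : ∀ s, Tendsto (fun t => ‖(y t).1 - (y s).1‖) (𝓝 s) (𝓝 0) := by
    intro s
    -- For Gaussian differences this expectation determines the distance of the integrands. It is
    -- continuous by dominated convergence, and a logarithm recovers the distance.
    have e : ∀ t, ∫ ω, Complex.exp (inner ℝ (Y t ω - Y s ω) v * Complex.I) ∂P =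
        (Real.exp (-‖(y t).1 - (y s).1‖ ^ 2 / 2) : ℝ) := fun t => by
      have := hW.integral_exp_inner (sub_mem (hy t) (hy s)) v
      rw [hv, mul_one] at this
      refine Eq.trans (integral_congr_ae ?_) this
      filter_upwards [hyY t, hyY s, Lp.coeFn_sub (y t).2 (y s).2] with ω e1 e2 e3
      rw [Prod.snd_sub, e3, Pi.sub_apply, e1, e2]
    have hcont : Continuous fun t => ∫ ω, Complex.exp (inner ℝ (Y t ω - Y s ω) v * Complex.I) ∂P := by
      refine continuous_of_dominated (bound := fun _ => 1) (fun t => ?_) (fun t => ?_)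
        (integrable_const _) (ae_of_all _ fun ω => ?_)
      · exact (integrable_exp_inner_mul_I ((hm t).sub (hm s)).aestronglyMeasurable v).1
      · exact ae_of_all _ fun ω => by rw [Complex.norm_exp_ofReal_mul_I]
      · have := hc ω
        fun_prop
    simp_rw [e] at hcont
    have h2 : Continuous fun t => Real.exp (-‖(y t).1 - (y s).1‖ ^ 2 / 2) := by
      have := Complex.continuous_re.comp hcont
      exact this
    have h3 := ((h2.log fun t => (Real.exp_pos _).ne').const_mul (-2)).sqrt
    have h4 : (fun t => Real.sqrt (-2 * Real.log (Real.exp (-‖(y t).1 - (y s).1‖ ^ 2 / 2)))) =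
        fun t => ‖(y t).1 - (y s).1‖ := by
      funext t
      rw [Real.log_exp, show -2 * (-‖(y t).1 - (y s).1‖ ^ 2 / 2) = ‖(y t).1 - (y s).1‖ ^ 2 by ring,
        Real.sqrt_sq (norm_nonneg _)]
    rw [h4] at h3
    simpa using h3.tendsto s
  rw [continuous_iff_continuousAt]
  intro s
  refine ContinuousAt.prodMk (f := fun t => (y t).1) (g := fun t => (y t).2) ?_ ?_
  · rw [ContinuousAt, tendsto_iff_norm_sub_tendsto_zero]
    exact h1 s
  · rw [ContinuousAt, tendsto_iff_norm_sub_tendsto_zero]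
    have := (h1 s).const_mul (Real.sqrt d)
    rw [mul_zero] at this
    exact this.congr fun t => (hW.norm_snd_eq (sub_mem (hy t) (hy s))).symm

lemma intervalIntegral_mem_of_isClosed {F : Type*} [NormedAddCommGroup F] [NormedSpace ℝ F]
    [CompleteSpace F] {S : Submodule ℝ F} (hS : IsClosed (S : Set F)) {y : ℝ → F}
    (hy : Continuous y) (hmem : ∀ t, y t ∈ S) (a c : ℝ) : ∫ r in a..c, y r ∈ S := by
  have : CompleteSpace S := hS.completeSpace_coe
  let z : ℝ → S := fun t => ⟨y t, hmem t⟩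
  have hz : Continuous z := hy.subtype_mk _
  have h := S.subtypeL.intervalIntegral_comp_comm (hz.intervalIntegrable (μ := volume) a c)
  have e : (fun r => S.subtypeL (z r)) = y := rfl
  rw [show (∫ r in a..c, y r) = ∫ r in a..c, S.subtypeL (z r) from rfl, h]
  exact (∫ r in a..c, z r).2

lemma measurable_timeIntegral {Y : ℝ → Ω → Vec d} (hm : ∀ t, Measurable (Y t))
    (hc : ∀ ω, Continuous fun t => Y t ω) (t : ℝ) :
    Measurable fun ω => timeIntegral (fun r => Y r ω) t := by
  have h : StronglyMeasurable (Function.uncurry fun ω r => Y r ω) :=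
    (stronglyMeasurable_uncurry_of_continuous_of_stronglyMeasurable hc
      fun t => (hm t).stronglyMeasurable).comp_measurable measurable_swap
  have h2 : ∀ s : Set ℝ, Measurable fun ω => ∫ r in s, Y r ω := fun s =>
    (h.integral_prod_right (ν := volume.restrict s)).measurable
  unfold timeIntegral intervalIntegral
  exact (h2 _).sub (h2 _)

/-- Time integration preserves Wiener paths. -/
lemma IsWienerPath.timeIntegral {y : ℝ → L2R × L2 d P} {Y : ℝ → Ω → Vec d}
    (h : IsWienerPath P W y Y) : IsWienerPath P W (fun t => ∫ r in (0 : ℝ)..t, y r)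
      (fun t ω => timeIntegral (fun r => Y r ω) t) where
  continuous := intervalIntegral.continuous_primitive
    (fun a c => h.continuous.intervalIntegrable a c) 0
  mem t := intervalIntegral_mem_of_isClosed isClosed_wienerRel h.continuous h.mem 0 t
  measurable := measurable_timeIntegral h.measurable h.cont
  cont ω := intervalIntegral.continuous_primitive (fun a c => (h.cont ω).intervalIntegrable a c) 0
  ae_eq t ht := by
    have e := (ContinuousLinearMap.snd ℝ L2R (L2 d P)).intervalIntegral_comp_comm
      (h.continuous.intervalIntegrable (μ := volume) 0 t)
    rw [show (∫ r in (0 : ℝ)..t, y r).2 = ∫ r in (0 : ℝ)..t, (y r).2 from e.symm]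
    exact L2.intervalIntegral_ae_eq ht
      (stronglyMeasurable_uncurry_of_continuous_of_stronglyMeasurable h.cont
        fun t => (h.measurable t).stronglyMeasurable).aestronglyMeasurable
      (continuous_snd.comp h.continuous).continuousOn fun r hr => h.ae_eq r hr.1

lemma tailR_eq_zero_of_kernel {f : L2R} {c γ t : ℝ} (ht : 0 ≤ t)
    (h : f =ᵐ[volume.restrict (Set.Ioi 0)] rlKernel c γ t) : tailR t f = 0 := by
  rw [Filter.EventuallyEq, ae_restrict_iff' measurableSet_Ioi] at h
  refine Lp.ext ?_
  filter_upwards [h, tailR_ae_eq t f, Lp.coeFn_zero ℝ 2 volume] with s h1 h2 h3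
  rw [h2, h3, Pi.zero_apply]
  by_cases hs : s ∈ Set.Ioi t
  · rw [Set.indicator_of_mem hs, h1 (ht.trans_lt hs), rlKernel, if_neg (not_lt.2 (le_of_lt hs))]
  · rw [Set.indicator_of_notMem hs]

/-- The squared norm is the integral of c² (t - s)^(2γ) over (u, t). With γ = H - 1/2 the exponent γ
+ 1/2 is H, the size required of the innovation. -/
lemma norm_tailR_of_kernel {f : L2R} {c γ u t : ℝ} (hc : 0 ≤ c) (hγ : -1 < 2 * γ) (hu : 0 ≤ u)
    (hut : u < t) (h : f =ᵐ[volume.restrict (Set.Ioi 0)] rlKernel c γ t) :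
    ‖tailR u f‖ = c / Real.sqrt (2 * γ + 1) * (t - u) ^ (γ + 1 / 2) := by
  have hpos : 0 < t - u := sub_pos.2 hut
  have e : ‖tailR u f‖ ^ 2 = (c / Real.sqrt (2 * γ + 1) * (t - u) ^ (γ + 1 / 2)) ^ 2 := by
    rw [L2.norm_sq_eq]
    have h1 : ∫ s, ‖tailR u f s‖ ^ 2 = ∫ s, (Set.Ioc u t).indicator
        (fun s => c ^ 2 * (t - s) ^ (2 * γ)) s := by
      rw [Filter.EventuallyEq, ae_restrict_iff' measurableSet_Ioi] at h
      have hne : ∀ᵐ s : ℝ, s ≠ t := by simp [ae_iff]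
      refine integral_congr_ae ?_
      filter_upwards [h, tailR_ae_eq u f, hne] with s h1 h2 h3
      rw [h2]
      by_cases hs : s ∈ Set.Ioi u
      · rw [Set.indicator_of_mem hs, h1 (hu.trans_lt hs), rlKernel]
        rcases lt_or_ge s t with hst | hst
        · have hp : 0 < t - s := sub_pos.2 hst
          rw [if_pos hst, Set.indicator_of_mem (show s ∈ Set.Ioc u t from ⟨hs, hst.le⟩), Real.norm_eq_abs, sq_abs, mul_pow,
            ← Real.rpow_natCast ((t - s) ^ γ), ← Real.rpow_mul hp.le]
          congr 2
          push_cast; ring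
        · rw [if_neg (not_lt.2 hst), Set.indicator_of_notMem fun h => h3 (le_antisymm h.2 hst)]
          simp
      · rw [Set.indicator_of_notMem hs, Set.indicator_of_notMem fun h => hs h.1]
        simp
    rw [h1, integral_indicator measurableSet_Ioc, ← intervalIntegral.integral_of_le hut.le,
      intervalIntegral.integral_const_mul,
      intervalIntegral.integral_comp_sub_left (fun r => r ^ (2 * γ)), integral_rpow (Or.inl hγ),
      sub_self, Real.zero_rpow (by linarith), mul_pow, div_pow, Real.sq_sqrt (by linarith),
      ← Real.rpow_natCast ((t - u) ^ (γ + 1 / 2)), ← Real.rpow_mul hpos.le,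
      show (γ + 1 / 2) * ((2 : ℕ) : ℝ) = 2 * γ + 1 by push_cast; ring]
    ring
  exact (pow_left_inj₀ (norm_nonneg _) (by positivity) two_ne_zero).1 e

end WienerPaths

/-! ### The integrated fractional Brownian motion as a split noise -/

section Noise
variable {Ω : Type*} [mΩ : MeasurableSpace Ω] {d : ℕ}
variable {P : Measure Ω} [IsProbabilityMeasure P] {W : ℝ → Ω → Vec d}

/-- Truncation of the time to `[0, 1]`. -/
def clampTime (t : ℝ) : ℝ := max 0 (min t 1)

lemma clampTime_mem (t : ℝ) : clampTime t ∈ Set.Icc (0 : ℝ) 1 :=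
  ⟨le_max_left _ _, max_le zero_le_one (min_le_right _ _)⟩

lemma clampTime_of_mem {t : ℝ} (ht : t ∈ Set.Icc (0 : ℝ) 1) : clampTime t = t := by
  rw [clampTime, min_eq_left ht.2, max_eq_right ht.1]

lemma clampTime_le {t : ℝ} (ht : 0 ≤ t) : clampTime t ≤ t := max_le ht (min_le_left _ _)

lemma continuous_clampTime : Continuous clampTime := by
  unfold clampTime; fun_prop

lemma mvnKernel_ae_eq (h t : ℝ) :
    mvnKernel h t =ᵐ[volume.restrict (Set.Ioi 0)] rlKernel 1 (h - 1 / 2) t := by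
  have hne : ∀ᵐ s : ℝ, s ≠ t := by simp [ae_iff]
  filter_upwards [ae_restrict_mem measurableSet_Ioi, ae_restrict_of_ae hne] with s hs hst
  rw [mvnKernel, if_neg (not_lt.2 (le_of_lt hs)), rlKernel]
  rcases lt_or_gt_of_ne hst with h1 | h1
  · rw [if_pos h1.le, if_pos h1, one_mul, abs_of_pos (sub_pos.2 h1)]
  · rw [if_neg (not_le.2 h1), if_neg (not_lt.2 h1.le)]

/-- Clamping time to [0, 1] and discarding the event of discontinuous paths makes every path
continuous on the whole line, at no cost on [0, 1]. -/
lemma IsFBM.exists_isWienerPath {h : ℝ} {B : ℝ → Ω → Vec d} (hB : IsFBM P W h B)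
    (hW : IsTwoSidedBM P W) (hd : d ≠ 0) :
    ∃ y Y, IsWienerPath P W y Y ∧
      (∀ t ∈ Set.Icc (0 : ℝ) 1,
        (y t).1 =ᵐ[volume.restrict (Set.Ioi 0)] rlKernel 1 (h - 1 / 2) t) ∧
      ∀ᵐ ω ∂P, ∀ t ∈ Set.Icc (0 : ℝ) 1, Y t ω = B t ω := by
  obtain ⟨G, hG, hG0, hGc⟩ := exists_measurableSet_of_ae hB.cont
  have hx := fun t => hB.exists_mem_wienerRel hW hd (clampTime_mem t).1
  choose y hy hy1 hy2 using hx
  let Y : ℝ → Ω → Vec d := fun t => G.indicator (B (clampTime t))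
  have hGae : ∀ᵐ ω ∂P, ω ∈ G := by
    rw [ae_iff]; exact hG0
  have hYm : ∀ t, Measurable (Y t) := fun t => (hB.measurable _ (clampTime_mem t).1).indicator hG
  have hYc : ∀ ω, Continuous fun t => Y t ω := fun ω => by
    by_cases hω : ω ∈ G
    · have : (fun t => Y t ω) = fun t => B (clampTime t) ω := by
        funext t; exact Set.indicator_of_mem hω _
      rw [this]
      exact (hGc ω hω).comp_continuous continuous_clampTime fun t => (clampTime_mem t).1
    · have : (fun t => Y t ω) = fun _ => 0 := by
        funext t; exact Set.indicator_of_notMem hω _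
      rw [this]
      exact continuous_const
  have hyY : ∀ t, (y t).2 =ᵐ[P] Y t := fun t => by
    filter_upwards [hy2 t, hGae] with ω h1 h2
    rw [h1]; exact (Set.indicator_of_mem h2 _).symm
  refine ⟨y, Y, ⟨hW.continuous_of_paths hd hy hYm hYc hyY, hy, hYm, hYc, fun t _ => hyY t⟩,
    fun t ht => ?_, ?_⟩
  · have h1 := ae_restrict_of_ae (s := Set.Ioi 0) (hy1 t)
    have h2 := mvnKernel_ae_eq h t
    rw [clampTime_of_mem ht] at h1
    exact EventuallyEq.trans h1 h2
  · filter_upwards [hGae] with ω hω t ht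
    change G.indicator (B (clampTime t)) ω = _
    rw [Set.indicator_of_mem hω, clampTime_of_mem ht]

/-- Iterated time integrals of fractional Brownian motion are Wiener paths. -/
lemma IsFBM.exists_isWienerPath_iterate {h : ℝ} (h0 : 0 < h) {B : ℝ → Ω → Vec d}
    (hB : IsFBM P W h B) (hW : IsTwoSidedBM P W) (hd : d ≠ 0) (n : ℕ) :
    ∃ y Y c, 0 < c ∧ IsWienerPath P W y Y ∧
      (∀ t ∈ Set.Icc (0 : ℝ) 1,
        (y t).1 =ᵐ[volume.restrict (Set.Ioi 0)] rlKernel c (n + (h - 1 / 2)) t) ∧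
      ∀ᵐ ω ∂P, ∀ t ∈ Set.Icc (0 : ℝ) 1, Y t ω = (timeIntegral^[n] fun r => B r ω) t := by
  induction n with
  | zero =>
    obtain ⟨y, Y, h1, h2, h3⟩ := hB.exists_isWienerPath hW hd
    refine ⟨y, Y, 1, one_pos, h1, fun t ht => ?_, h3⟩
    simpa using h2 t ht
  | succ n ih =>
    obtain ⟨y, Y, c, hc, h1, h2, h3⟩ := ih
    have hn : (0 : ℝ) ≤ n := n.cast_nonneg
    refine ⟨_, _, c / (n + (h - 1 / 2) + 1), div_pos hc (by linarith), h1.timeIntegral,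
      fun t ht => ?_, ?_⟩
    · have := timeIntegral_kernel h1.continuous (by linarith) h2 ht
      have e : ((n + 1 : ℕ) : ℝ) + (h - 1 / 2) = n + (h - 1 / 2) + 1 := by push_cast; ring
      rwa [e]
    · filter_upwards [h3] with ω hω t ht
      rw [Function.iterate_succ_apply']
      refine intervalIntegral.integral_congr fun r hr => hω r ?_
      rw [Set.uIcc_of_le ht.1] at hr
      exact ⟨hr.1, hr.2.trans ht.2⟩

/-- On `[0, 1]`, the noise agrees with a process that splits at every time into its past and an
independent Gaussian vector of the right size. -/
lemma IsFBM.exists_isSplitNoise {h : ℝ} (h0 : 0 < h) {B : ℝ → Ω → Vec d}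
    (hB : IsFBM P W h B) (hW : IsTwoSidedBM P W) (hd : d ≠ 0) (n : ℕ) :
    ∃ Z c, 0 < c ∧ IsSplitNoise P (incrFiltration P W hW.measurable) Z (n + h) c ∧
      ∀ᵐ ω ∂P, ∀ t ∈ Set.Icc (0 : ℝ) 1, Z t ω = (timeIntegral^[n] fun r => B r ω) t := by
  obtain ⟨y, Y, c, hc, h1, h2, h3⟩ := hB.exists_isWienerPath_iterate h0 hW hd n
  have hn : (0 : ℝ) ≤ n := n.cast_nonneg
  -- The kernel at time t has no mass after t, so Y t agrees almost surely with an ℱ t-measurable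
  -- variable; completeness removes the exceptional set.
  have hadapt : ∀ t ∈ Set.Icc (0 : ℝ) 1, Measurable[incrFiltration P W hW.measurable t] (Y t) := by
    intro t ht
    have h4 := hW.aestronglyMeasurable_of_tailR_eq_zero (h1.mem t)
      (tailR_eq_zero_of_kernel ht.1 (h2 t ht))
    exact measurable_of_ae_eq ((incrFiltration P W hW.measurable).le t)
      (incrFiltration_complete hW.measurable t) (h1.measurable t)
      h4.stronglyMeasurable_mk.measurable ((h1.ae_eq t ht.1).symm.trans h4.ae_eq_mk)
  refine ⟨fun t => Y (clampTime t), c / Real.sqrt (2 * (n + (h - 1 / 2)) + 1), ?_, ?_, ?_⟩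
  · exact div_pos hc (Real.sqrt_pos.2 (by linarith))
  · refine ⟨fun t => h1.measurable _, fun t ht => ?_, fun ω => (h1.cont ω).comp continuous_clampTime,
      fun u r hu hur hr => ?_⟩
    · exact (hadapt _ (clampTime_mem t)).mono
        ((incrFiltration P W hW.measurable).mono (clampTime_le ht)) le_rfl
    · have hr' : r ∈ Set.Icc (0 : ℝ) 1 := ⟨hu.trans hur.le, hr⟩
      obtain ⟨M, G, hM, hG, hMG, hind, hlaw⟩ := hW.exists_split (h1.mem r) u
      refine ⟨M, G, hM, hG, ?_, hind, ?_⟩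
      · simp only [clampTime_of_mem hr']
        exact (h1.ae_eq r hr'.1).symm.trans hMG
      · rw [hlaw, norm_tailR_of_kernel hc.le (by linarith) hu hur (h2 r hr')]
        have e : (n : ℝ) + (h - 1 / 2) + 1 / 2 = n + h := by ring
        rw [e]
  · filter_upwards [h3] with ω hω t ht
    simp only [clampTime_of_mem ht]
    exact hω t ht

end Noise

/-! ### Reduction to Hölder exponents below one -/

section Drift

/-- Landau–Kolmogorov type inequality: on an interval, the first derivative is controlled by the
function and the oscillation of a higher derivative. -/
lemma exists_bound_iteratedDeriv_one (m : ℕ) : ∃ A : ℝ, 0 ≤ A ∧ ∀ (g : ℝ → ℝ) (M C : ℝ),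
    ContDiff ℝ (m + 1 : ℕ) g → (∀ t, |g t| ≤ M) →
    (∀ t ∈ Set.Icc (0 : ℝ) 1, |iteratedDeriv (m + 1) g t - iteratedDeriv (m + 1) g 0| ≤ C) →
    |iteratedDeriv 1 g 0| ≤ A * (M + C) := by
  -- The Taylor polynomial of degree m + 1 at 0 is bounded by M + C on [0, 1], and its linear
  -- coefficient is a fixed linear function of its values at m + 2 distinct nodes.
  let node : ℕ → ℝ := fun i => i / (m + 1 : ℕ)
  have hpos : (0 : ℝ) < (m + 1 : ℕ) := by positivity
  refine ⟨∑ i ∈ Finset.range (m + 2), |(Lagrange.basis (Finset.range (m + 2)) node i).coeff 1|,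
    Finset.sum_nonneg fun _ _ => abs_nonneg _, fun g M C hg hM hC => ?_⟩
  have hC0 : 0 ≤ C := (abs_nonneg _).trans (hC 0 ⟨le_rfl, zero_le_one⟩)
  let p : Polynomial ℝ := ∑ k : Fin (m + 2),
    Polynomial.C (((k : ℕ).factorial : ℝ)⁻¹ * iteratedDeriv k g 0) * Polynomial.X ^ (k : ℕ)
  have hpdeg : p.degree < (m + 2 : ℕ) := Polynomial.degree_sum_fin_lt _
  have hpeval : ∀ t, p.eval t = ∑ k ∈ Finset.range (m + 2),
      (((k : ℕ).factorial : ℝ)⁻¹ * t ^ k) * iteratedDeriv k g 0 := fun t => by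
    rw [← Fin.sum_univ_eq_sum_range (fun k => ((k.factorial : ℝ)⁻¹ * t ^ k) * iteratedDeriv k g 0),
      Polynomial.eval_finsetSum]
    refine Finset.sum_congr rfl fun k _ => ?_
    simp only [Polynomial.eval_mul, Polynomial.eval_C, Polynomial.eval_pow, Polynomial.eval_X]
    ring
  have hp1 : p.coeff 1 = iteratedDeriv 1 g 0 := by
    simp only [p, Polynomial.finsetSum_coeff, Polynomial.coeff_C_mul, Polynomial.coeff_X_pow]
    rw [Finset.sum_eq_single (⟨1, by omega⟩ : Fin (m + 2))]
    · simp
    · intro k _ hk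
      rw [if_neg fun h => hk (Fin.ext h.symm), mul_zero]
    · simp
  have hclose : ∀ t ∈ Set.Icc (0 : ℝ) 1, |p.eval t| ≤ M + C := by
    intro t ht
    rcases ht.1.eq_or_lt with rfl | h0
    · rw [hpeval, Finset.sum_eq_single 0]
      · simpa using (hM 0).trans (le_add_of_nonneg_right hC0)
      · intro k _ hk
        rw [zero_pow hk]; ring
      · simp
    · have hu : UniqueDiffOn ℝ (Set.Icc 0 t) := uniqueDiffOn_Icc h0
      obtain ⟨ξ, hξ, e⟩ := taylor_mean_remainder_lagrange_iteratedDeriv (n := m) h0.ne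
        (hg.contDiffOn (s := Set.uIcc 0 t))
      rw [Set.uIcc_of_le h0.le, taylor_within_apply] at e
      rw [Set.uIoo_of_le h0.le] at hξ
      have e2 : ∀ k ∈ Finset.range (m + 1), (((k : ℕ).factorial : ℝ)⁻¹ * (t - 0) ^ k) •
          iteratedDerivWithin k g (Set.Icc 0 t) 0 =
          (((k : ℕ).factorial : ℝ)⁻¹ * t ^ k) * iteratedDeriv k g 0 := fun k hk => by
        rw [iteratedDerivWithin_eq_iteratedDeriv hu, sub_zero, smul_eq_mul]
        · exact (hg.contDiffAt).of_le (by
            exact_mod_cast (Finset.mem_range.1 hk).le)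
        · exact ⟨le_rfl, h0.le⟩
      rw [Finset.sum_congr rfl e2, sub_zero] at e
      -- `p` includes the top derivative at 0, so the Lagrange remainder contributes only the
      -- oscillation of that derivative.
      have e3 : p.eval t = g t - (iteratedDeriv (m + 1) g ξ - iteratedDeriv (m + 1) g 0) *
          (((m + 1).factorial : ℝ)⁻¹ * t ^ (m + 1)) := by
        rw [hpeval, Finset.sum_range_succ]
        linear_combination -e
      have h1 : |((m + 1).factorial : ℝ)⁻¹ * t ^ (m + 1)| ≤ 1 := by
        rw [abs_of_nonneg (by positivity)]
        have hf : (1 : ℝ) ≤ ((m + 1).factorial : ℝ) := by exact_mod_cast (m + 1).factorial_pos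
        exact mul_le_one₀ (inv_le_one_of_one_le₀ hf) (by positivity) (pow_le_one₀ ht.1 ht.2)
      rw [e3]
      refine (abs_sub _ _).trans (add_le_add (hM t) ?_)
      rw [abs_mul]
      calc _ ≤ C * 1 := mul_le_mul (hC ξ ⟨hξ.1.le, hξ.2.le.trans ht.2⟩) h1 (abs_nonneg _) hC0
        _ = C := mul_one C
  have hinj : Set.InjOn node (Finset.range (m + 2)) := fun i _ j _ h => by
    have := (div_left_inj' hpos.ne').1 h
    exact_mod_cast this
  have hint := Lagrange.eq_interpolate (f := p) hinj (by simpa using hpdeg)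
  rw [← hp1, hint, Lagrange.interpolate_apply, Polynomial.finsetSum_coeff, Finset.sum_mul]
  refine (Finset.abs_sum_le_sum_abs _ _).trans (Finset.sum_le_sum fun i hi => ?_)
  rw [Polynomial.coeff_C_mul, abs_mul, mul_comm]
  refine mul_le_mul_of_nonneg_left (hclose _ ⟨by positivity, ?_⟩) (abs_nonneg _)
  rw [div_le_one hpos]
  exact_mod_cast Nat.le_of_lt_succ (Finset.mem_range.1 hi)

variable {d : ℕ}

lemma iteratedDeriv_inner_line {b : Vec d → Vec d} {n : ℕ} (hb : ContDiff ℝ n b) (x v w : Vec d)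
    {k : ℕ} (hk : k ≤ n) (t : ℝ) :
    iteratedDeriv k (fun t : ℝ => inner ℝ w (b (x + t • v))) t =
      inner ℝ w (iteratedFDeriv ℝ k b (x + t • v) fun _ => v) := by
  let L : ℝ →L[ℝ] Vec d := (ContinuousLinearMap.id ℝ ℝ).smulRight v
  have hc : ContDiff ℝ n fun z => b (x + z) := hb.comp (by fun_prop)
  have hk' : (k : WithTop ℕ∞) ≤ n := by exact_mod_cast hk
  have e1 : (fun t : ℝ => inner ℝ w (b (x + t • v))) =
      (innerSL ℝ w) ∘ ((fun z => b (x + z)) ∘ L) := rfl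
  rw [iteratedDeriv_eq_iteratedFDeriv, e1,
    ContinuousLinearMap.iteratedFDeriv_comp_left (innerSL ℝ w)
      (hc.comp L.contDiff).contDiffAt hk', L.iteratedFDeriv_comp_right hc t hk',
    iteratedFDeriv_comp_add_left]
  simp [L]

/-- A bounded function whose highest derivative is Hölder continuous is Lipschitz. -/
lemma exists_lipschitz_of_holder {b : Vec d → Vec d} {m : ℕ} {M C β : ℝ} (hM : ∀ x, ‖b x‖ ≤ M)
    (hb : ContDiff ℝ (m + 1 : ℕ) b) (hβ : 0 ≤ β)
    (hC : ∀ x y, ‖iteratedFDeriv ℝ (m + 1) b x - iteratedFDeriv ℝ (m + 1) b y‖ ≤ C * ‖x - y‖ ^ β) :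
    ∃ L, ∀ x y, ‖b x - b y‖ ≤ L * ‖x - y‖ := by
  obtain ⟨A, hA, hbound⟩ := exists_bound_iteratedDeriv_one m
  have hM0 : 0 ≤ M := (norm_nonneg _).trans (hM 0)
  have hK : 0 ≤ A * (M + |C|) := by positivity
  -- The one-dimensional inequality is applied to t ↦ ⟨w, b(x + t v)⟩, uniformly in the base point x
  -- and in unit vectors v, w.
  have key : ∀ x v w : Vec d, ‖v‖ = 1 → ‖w‖ = 1 → |inner ℝ w (fderiv ℝ b x v)| ≤ A * (M + |C|) := by
    intro x v w hv hw
    have h := hbound (fun t : ℝ => inner ℝ w (b (x + t • v))) M |C| ?_ ?_ ?_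
    · rw [iteratedDeriv_inner_line hb x v w (by omega), iteratedFDeriv_one_apply] at h
      simpa using h
    · exact contDiff_const.inner ℝ (hb.comp (by fun_prop))
    · intro t
      refine (abs_real_inner_le_norm _ _).trans ?_
      rw [hw, one_mul]; exact hM _
    · intro t ht
      rw [iteratedDeriv_inner_line hb x v w le_rfl, iteratedDeriv_inner_line hb x v w le_rfl,
        ← inner_sub_right]
      refine (abs_real_inner_le_norm _ _).trans ?_
      rw [hw, one_mul, ← _root_.sub_apply]
      refine (ContinuousMultilinearMap.le_opNorm _ _).trans ?_
      simp only [hv, Finset.prod_const_one, mul_one]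
      refine (hC _ _).trans ?_
      have e : ‖x + t • v - (x + (0 : ℝ) • v)‖ = t := by
        rw [zero_smul, add_zero, add_sub_cancel_left, norm_smul, hv, mul_one,
          Real.norm_of_nonneg ht.1]
      rw [e]
      calc C * t ^ β ≤ |C| * t ^ β :=
            mul_le_mul_of_nonneg_right (le_abs_self C) (Real.rpow_nonneg ht.1 _)
        _ ≤ |C| * 1 := mul_le_mul_of_nonneg_left (Real.rpow_le_one ht.1 ht.2 hβ) (abs_nonneg _)
        _ = |C| := mul_one _
  have hd : ∀ x, ‖fderiv ℝ b x‖ ≤ A * (M + |C|) := fun x => by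
    refine ContinuousLinearMap.opNorm_le_of_unit_norm hK fun v hv => ?_
    rcases eq_or_ne (fderiv ℝ b x v) 0 with h0 | h0
    · rwa [h0, norm_zero]
    · have h := key x v (‖fderiv ℝ b x v‖⁻¹ • fderiv ℝ b x v) hv (norm_smul_inv_norm h0)
      rw [inner_smul_left, real_inner_self_eq_norm_sq] at h
      have hn : ‖fderiv ℝ b x v‖ ≠ 0 := norm_ne_zero_iff.2 h0
      have e : (starRingEnd ℝ) ‖fderiv ℝ b x v‖⁻¹ * ‖fderiv ℝ b x v‖ ^ 2 = ‖fderiv ℝ b x v‖ := by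
        simp only [conj_trivial]; field_simp
      rwa [e, abs_of_nonneg (norm_nonneg _)] at h
  refine ⟨A * (M + |C|), fun x y => ?_⟩
  refine convex_univ.norm_image_sub_le_of_norm_fderiv_le (𝕜 := ℝ) (fun z _ => ?_)
    (fun z _ => hd z) (Set.mem_univ y) (Set.mem_univ x)
  exact (hb.differentiable (by simp)) z

/-- Lowering the exponent is harmless at distances up to one; beyond that, boundedness takes over.
-/
lemma exists_bddHolder {b : Vec d → Vec d} {M C β α : ℝ} (hM : ∀ x, ‖b x‖ ≤ M)
    (hC : ∀ x y, ‖b x - b y‖ ≤ C * ‖x - y‖ ^ β) (h0 : 0 ≤ α) (hαβ : α ≤ β) :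
    ∃ K, BddHolder α K b := by
  have hM0 : 0 ≤ M := (norm_nonneg _).trans (hM 0)
  refine ⟨|C| + 2 * M, fun x => (hM x).trans (by linarith [abs_nonneg C]), fun x y => ?_⟩
  rcases le_total ‖x - y‖ 1 with h | h
  · rcases eq_or_ne x y with rfl | hne
    · simp only [sub_self, norm_zero]
      positivity
    · have hp : 0 < ‖x - y‖ := norm_pos_iff.2 (sub_ne_zero.2 hne)
      calc ‖b x - b y‖ ≤ C * ‖x - y‖ ^ β := hC x y
        _ ≤ |C| * ‖x - y‖ ^ β := by gcongr; exact le_abs_self C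
        _ ≤ |C| * ‖x - y‖ ^ α :=
          mul_le_mul_of_nonneg_left (Real.rpow_le_rpow_of_exponent_ge hp h hαβ) (abs_nonneg _)
        _ ≤ (|C| + 2 * M) * ‖x - y‖ ^ α := by gcongr; linarith
  · have h1 : 1 ≤ ‖x - y‖ ^ α := Real.one_le_rpow h h0
    calc ‖b x - b y‖ ≤ M + M := (norm_sub_le _ _).trans (add_le_add (hM x) (hM y))
      _ = (2 * M) * 1 := by ring
      _ ≤ (|C| + 2 * M) * ‖x - y‖ ^ α := by
        gcongr
        linarith [abs_nonneg C]

/-- Drifts of class `C^α` are Hölder continuous with any smaller exponent below one. -/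
lemma MemHolder.exists_bddHolder {α δ : ℝ} {b : Vec d → Vec d} (hb : MemHolder α b) (h0 : 0 ≤ δ)
    (hδα : δ < α) (hδ : δ < 1) :
    ∃ α' K, δ < α' ∧ α' < 1 ∧ BddHolder α' K b := by
  obtain ⟨⟨M, hM⟩, hd, C, hC⟩ := hb
  have hα : 0 < α := h0.trans_lt hδα
  -- For α ≤ 1 the exponent is only lowered. For α > 1 the drift is Lipschitz, so every exponent in
  -- (δ, 1) is available.
  rcases Nat.eq_zero_or_pos (⌈α⌉₊ - 1) with h | h
  · rw [h] at hC
    obtain ⟨α', h1, h2⟩ := exists_between (lt_min hδα hδ)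
    have hC' : ∀ x y, ‖b x - b y‖ ≤ C * ‖x - y‖ ^ α := fun x y => by
      have := hC x y
      rw [iteratedFDeriv_zero_eq_comp, Function.comp_apply, Function.comp_apply, ← map_sub,
        LinearIsometryEquiv.norm_map] at this
      simpa using this
    obtain ⟨K, hK⟩ := RegNoise.exists_bddHolder hM hC' (h0.trans h1.le)
      (h2.le.trans (min_le_left _ _))
    exact ⟨α', K, h1, h2.trans_le (min_le_right _ _), hK⟩
  · obtain ⟨m, hm⟩ := Nat.exists_eq_succ_of_ne_zero h.ne'
    rw [hm] at hC hd
    have hβ : 0 ≤ α - ((m.succ : ℕ) : ℝ) := by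
      have h1 : m.succ < ⌈α⌉₊ := by omega
      exact sub_nonneg.2 (Nat.lt_ceil.1 h1).le
    obtain ⟨L, hL⟩ := exists_lipschitz_of_holder hM hd hβ hC
    obtain ⟨α', h1, h2⟩ := exists_between hδ
    obtain ⟨K, hK⟩ := RegNoise.exists_bddHolder (β := 1) hM (by simpa using hL) (h0.trans h1.le) h2.le
    exact ⟨α', K, h1, h2, hK⟩

end Drift

/-! ### Transfer to the given noise and conclusion -/

section Transfer
variable {Ω : Type*} [mΩ : MeasurableSpace Ω] {d : ℕ}
variable {P : Measure Ω} {ℱ : Filtration ℝ mΩ} {b : Vec d → Vec d} {T : ℝ}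

lemma IsStrongSolution.congr_noise {Z Z' X : ℝ → Ω → Vec d} (hX : IsStrongSolution P ℱ b Z T X)
    (h : ∀ᵐ ω ∂P, ∀ t ∈ Set.Icc (0 : ℝ) T, Z t ω = Z' t ω) : IsStrongSolution P ℱ b Z' T X where
  adapted := hX.adapted
  integrable := hX.integrable
  eqn := by
    filter_upwards [hX.eqn, h] with ω h1 h2 t ht
    rw [h1 t ht, h2 t ht]

end Transfer
end RegNoise

end

theorem theorem1 {Ω : Type*} [mΩ : MeasurableSpace Ω] (P : Measure Ω) [IsProbabilityMeasure P]
    {d : ℕ} (W : ℝ → Ω → RegNoise.Vec d) (hW : RegNoise.IsTwoSidedBM P W)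
    (H : ℝ) (hH : 1 / 2 ≤ H) (hHint : ∀ n : ℤ, H ≠ n)
    (B : ℝ → Ω → RegNoise.Vec d) (hB : RegNoise.IsFBM P W (Int.fract H) B)
    (α : ℝ) (hα : 1 - 1 / (2 * H) < α)
    (b : RegNoise.Vec d → RegNoise.Vec d) (hb : RegNoise.MemHolder α b) :
    (∃ X : ℝ → Ω → RegNoise.Vec d,
      RegNoise.IsStrongSolution P (RegNoise.incrFiltration P W hW.measurable) b
        (RegNoise.fracNoise H B) 1 X) ∧
    (∀ X Y : ℝ → Ω → RegNoise.Vec d,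
      RegNoise.IsStrongSolution P (RegNoise.incrFiltration P W hW.measurable) b
        (RegNoise.fracNoise H B) 1 X →
      RegNoise.IsStrongSolution P (RegNoise.incrFiltration P W hW.measurable) b
        (RegNoise.fracNoise H B) 1 Y →
      ∀ᵐ ω ∂P, ∀ t ∈ Set.Icc (0 : ℝ) 1, X t ω = Y t ω) := by
  rcases eq_or_ne d 0 with rfl | hd
  -- In dimension zero the state space is a single point.
  · refine ⟨⟨fun _ _ => 0, ⟨fun _ _ => measurable_const, ae_of_all _ fun ω =>
      intervalIntegrable_const, ae_of_all _ fun ω t _ => Subsingleton.elim _ _⟩⟩,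
      fun X Y _ _ => ae_of_all _ fun ω t _ => Subsingleton.elim _ _⟩
  have hH0 : 0 < H := by linarith
  have hfr : 0 < Int.fract H := Int.fract_pos.2 (hHint _)
  obtain ⟨Z, c, hc, hZ, hZB⟩ := hB.exists_isSplitNoise hfr hW hd ⌊H⌋₊
  have e : (⌊H⌋₊ : ℝ) + Int.fract H = H := by
    rw [natCast_floor_eq_intCast_floor hH0.le, Int.floor_add_fract]
  rw [e] at hZ
  have hδ : 0 ≤ 1 - 1 / (2 * H) := by
    rw [sub_nonneg, div_le_one (by linarith)]; linarith
  obtain ⟨α', K, h1, h2, hK⟩ := hb.exists_bddHolder hδ hα (by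
    have : 0 < 1 / (2 * H) := by positivity
    linarith)
  -- The threshold α' > 1 - 1/(2H) is precisely the summability condition of the sewing estimate.
  have hp : H * (1 - α') < 1 / 2 := by
    have : 1 - α' < 1 / (2 * H) := by linarith
    calc H * (1 - α') < H * (1 / (2 * H)) := mul_lt_mul_of_pos_left this hH0
      _ = 1 / 2 := by field_simp
  obtain ⟨⟨X, hX⟩, huniq⟩ := RegNoise.strong_existence_uniqueness
    (RegNoise.incrFiltration_complete hW.measurable) hZ hc (hδ.trans_lt h1) h2 hH0 hp hK
  have hBZ : ∀ᵐ ω ∂P, ∀ t ∈ Set.Icc (0 : ℝ) 1, RegNoise.fracNoise H B t ω = Z t ω :=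
    hZB.mono fun ω h t ht => (h t ht).symm
  exact ⟨⟨X, hX.congr_noise hZB⟩, fun X Y hX hY => huniq X Y (hX.congr_noise hBZ) (hY.congr_noise hBZ)⟩
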